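/- Let $Z_I<0$ and let $\hat\mu,\hat\lambda:(-\infty,0]\to\mathbb R$ be smooth functions that are constant on $(-\infty,Z_I]$ and satisfy $$0<\hat\mu(0)=\inf_{Z\le 0}\hat\mu(Z)<\sup_{Z\le 0}\hat\mu(Z)=\hat\mu(Z_I),\qquad \hat\lambda(Z)+2\hat\mu(Z)\ge\hat\mu(Z_I)\quad\text{for all } Z\in[Z_I,0].$$ For $h>0$ let $H_{0,h}$ be the Rayleigh operator on $L^2((-\infty,0];\mathbb C^2)$, $$H_{0,h}\begin{pmatrix}\varphi_2\\ \varphi_3\end{pmatrix}=\begin{pmatrix}-h^2\partial_Z(\hat\mu\,\partial_Z\varphi_2)-\mathrm i h\big(\partial_Z(\hat\mu\varphi_3)+\hat\lambda\,\partial_Z\varphi_3\big)+(\hat\lambda+2\hat\mu)\varphi_2\\ -h^2\partial_Z\big((\hat\lambda+2\hat\mu)\partial_Z\varphi_3\big)-\mathrm i h\big(\partial_Z(\hat\lambda\varphi_2)+\hat\mu\,\partial_Z\varphi_2\big)+\hat\mu\varphi_3\end{pmatrix},$$ whose domain consists of the $(\varphi_2,\varphi_3)\in H^2((-\infty,0];\mathbb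 C^2)$ that satisfy the Neumann boundary conditions $$\mathrm i\varphi_3(0)+h\,\partial_Z\varphi_2(0)=0,\qquad \mathrm i\hat\lambda(0)\varphi_2(0)+(\hat\lambda(0)+2\hat\mu(0))\,h\,\partial_Z\varphi_3(0)=0.$$ Put $E_0=\hat\mu(0)$, and let $\lambda_0(h)\le\lambda_1(h)\le\cdots$ be the eigenvalues of $H_{0,h}$ counted with multiplicity. Then the second eigenvalue $\lambda_1(h)$ exists for all sufficiently small $h>0$, and $$\lim_{h\to0}\lambda_1(h)=E_0.$$ Moreover $\lambda_1(h)=E_0+O(h^{2/3})$ as $h\to0$, and if $\hat\mu'(0)=0$, then $\lambda_1(h)=E_0+O(h)$ as $h\to 0$. -/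

import Mathlib

open Set Filter Topology MeasureTheory Asymptotics
open scoped ContDiff

noncomputable section

namespace Rayleigh

/-- The derivative `∂/∂Z` of a complex function on the half-line `ℝ⁻ = (-∞, 0]` (one-sided at
`Z = 0`). At points of `ℝ⁻` it only depends on the restriction of `u` to `ℝ⁻`. -/
def D (u : ℝ → ℂ) : ℝ → ℂ := fun Z => derivWithin u (Iic 0) Z

/-- The Sobolev space `H¹(ℝ⁻)`, in terms of the continuous representative: `u` is locally absolutely
continuous on `(-∞, 0]`, and `u` and its (almost everywhere defined) derivative are in `L²(ℝ⁻)`. -/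
structure MemH1 (u : ℝ → ℂ) : Prop where
  ac : ∀ a : ℝ, a ≤ 0 → AbsolutelyContinuousOnInterval u a 0
  memLp : MemLp u 2 (volume.restrict (Iic 0))
  memLp_deriv : MemLp (D u) 2 (volume.restrict (Iic 0))

/-- The Sobolev space `H²(ℝ⁻)`: both `u` and its derivative are in `H¹(ℝ⁻)`. -/
structure MemH2 (u : ℝ → ℂ) : Prop where
  memH1 : MemH1 u
  memH1_deriv : MemH1 (D u)

/-- The domain of `H_{0,h}`: pairs `(φ₂, φ₃)` in `H²(ℝ⁻)` that satisfy the Neumann boundary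
conditions at `Z = 0`, multiplied here by `h = |ξ|⁻¹`. -/
structure MemDomain (μ lam : ℝ → ℝ) (h : ℝ) (φ : (ℝ → ℂ) × (ℝ → ℂ)) : Prop where
  memH2_fst : MemH2 φ.1
  memH2_snd : MemH2 φ.2
  neumann_fst : Complex.I * φ.2 0 + (h : ℂ) * D φ.1 0 = 0
  neumann_snd : Complex.I * (lam 0 : ℂ) * φ.1 0
    + ((lam 0 : ℂ) + 2 * (μ 0 : ℂ)) * ((h : ℂ) * D φ.2 0) = 0

/-- The action of the Rayleigh operator `H_{0,h}` with Lamé moduli `lam`, `μ` on `φ = (φ₂, φ₃)`. -/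
def op (μ lam : ℝ → ℝ) (h : ℝ) (φ : (ℝ → ℂ) × (ℝ → ℂ)) : (ℝ → ℂ) × (ℝ → ℂ) :=
  (fun Z =>
      -(h : ℂ) ^ 2 * D (fun s => (μ s : ℂ) * D φ.1 s) Z
        - Complex.I * (h : ℂ) * (D (fun s => (μ s : ℂ) * φ.2 s) Z + (lam Z : ℂ) * D φ.2 Z)
        + ((lam Z : ℂ) + 2 * (μ Z : ℂ)) * φ.1 Z,
   fun Z =>
      -(h : ℂ) ^ 2 * D (fun s => ((lam s : ℂ) + 2 * (μ s : ℂ)) * D φ.2 s) Z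
        - Complex.I * (h : ℂ) * (D (fun s => (lam s : ℂ) * φ.1 s) Z + (μ Z : ℂ) * D φ.1 Z)
        + (μ Z : ℂ) * φ.2 Z)

/-- `φ` is an eigenfunction of `H_{0,h}` with (real) eigenvalue `E`: it is in the domain, it does not
vanish identically on `ℝ⁻`, and `H_{0,h} φ = E φ` in `L²(ℝ⁻)`, that is, almost everywhere. -/
structure IsEigenfunction (μ lam : ℝ → ℝ) (h E : ℝ) (φ : (ℝ → ℂ) × (ℝ → ℂ)) : Prop where
  memDomain : MemDomain μ lam h φ
  ne_zero : ∃ Z ≤ (0 : ℝ), (φ.1 Z, φ.2 Z) ≠ (0, 0)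
  eq_fst : ∀ᵐ Z ∂(volume.restrict (Iic (0 : ℝ))), (op μ lam h φ).1 Z = (E : ℂ) * φ.1 Z
  eq_snd : ∀ᵐ Z ∂(volume.restrict (Iic (0 : ℝ))), (op μ lam h φ).2 Z = (E : ℂ) * φ.2 Z

/-- `E` is an eigenvalue of `H_{0,h}`. -/
def IsEigenvalue (μ lam : ℝ → ℝ) (h E : ℝ) : Prop :=
  ∃ φ, IsEigenfunction μ lam h E φ

/-- The restriction of `φ = (φ₂, φ₃)` to the half-line. -/
def restr (φ : (ℝ → ℂ) × (ℝ → ℂ)) : Iic (0 : ℝ) → ℂ × ℂ := fun Z => (φ.1 Z, φ.2 Z)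

/-- There are two eigenfunctions of `H_{0,h}`, linearly independent on the half-line, whose
eigenvalues satisfy `P`; in other words, at least two eigenvalues of `H_{0,h}`, counted with
multiplicity, satisfy `P`. -/
def HasTwoEigenvalues (μ lam : ℝ → ℝ) (h : ℝ) (P : ℝ → Prop) : Prop :=
  ∃ E₁ E₂ φ₁ φ₂, P E₁ ∧ P E₂ ∧ IsEigenfunction μ lam h E₁ φ₁ ∧ IsEigenfunction μ lam h E₂ φ₂ ∧
    LinearIndependent ℂ ![restr φ₁, restr φ₂]

/-- `E` is the second eigenvalue `λ₁(h)` in the list `λ₀(h) ≤ λ₁(h) ≤ …` of the eigenvalues of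
`H_{0,h}`, counted with multiplicity: it is an eigenvalue, at most one eigenvalue is smaller than
`E`, and at least two are not larger than `E`. -/
structure IsSecondEigenvalue (μ lam : ℝ → ℝ) (h E : ℝ) : Prop where
  isEigenvalue : IsEigenvalue μ lam h E
  lt : ¬ HasTwoEigenvalues μ lam h (fun E' => E' < E)
  le : HasTwoEigenvalues μ lam h (fun E' => E' ≤ E)

/-- The assumptions on the profile: `μ` and `lam` are smooth on `(-∞, 0]` and constant on
`(-∞, Z_I]`, `0 < μ(0) = inf μ < sup μ = μ(Z_I)`, and `lam + 2 μ ≥ μ(Z_I)` on `[Z_I, 0]`. -/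
structure Profile (μ lam : ℝ → ℝ) (ZI : ℝ) : Prop where
  ZI_neg : ZI < 0
  smooth_mu : ContDiffOn ℝ ∞ μ (Iic 0)
  smooth_lam : ContDiffOn ℝ ∞ lam (Iic 0)
  mu_const : ∀ Z ≤ ZI, μ Z = μ ZI
  lam_const : ∀ Z ≤ ZI, lam Z = lam ZI
  mu_pos : 0 < μ 0
  mu_min : IsLeast (μ '' Iic 0) (μ 0)
  mu_lt : μ 0 < μ ZI
  mu_max : IsGreatest (μ '' Iic 0) (μ ZI)
  lam_add : ∀ Z ∈ Icc ZI 0, μ ZI ≤ lam Z + 2 * μ Z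

end Rayleigh

end

noncomputable section

namespace Rayleigh

open scoped ComplexConjugate

/-! The operator comes from a Hermitian form `energy` on `H¹`, and the second eigenvalue is found by
min-max. It is at most `r` when every hyperplane contains a vector with Rayleigh quotient at most `r
< μ ZI`; a two-dimensional space of trial functions ensures this. It is at least `r` when the
quotient is at least `r` on one fixed hyperplane, because the span of two eigenfunctions meets that
hyperplane.

Lower bound: put `d = h φ₃' + i φ₂`, `c = h φ₂' - i φ₃` and `β = Im (φ₃ φ̄₂)`. The energy density
equals `(λ + 2μ)|d|² + μ|c|² - 4hμ β'` (`energy_density_identity`), while `|d|² + |c|² = |φ|² +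
h²|φ'|² + 2h β'` (`div_curl_identity`). Both weights are at least `μ(0)`, so after integration by
parts only the boundary value `β(0)` can push the energy below `μ(0)` by more than `O(h)`: the other
error is `4h ∫ μ' β`. On the hyperplane `φ₂(0) = 0` that boundary value vanishes
(`energy_ge_of_fst_eq_zero`), whence `λ₁ ≥ μ(0) - O(h)`.

Upper bound: on `(0, φ₃)` the density is `μ|φ₃|² + (λ + 2μ) h²|φ₃'|²`. Combinations of `e^{Z/s}` and
`e^{2Z/s}` concentrate at depth `s`, and if `μ(Z) ≤ μ(0) + B|Z|^q` their quotient is `μ(0) + O(s^q +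
h²/s²)` (`trial_energy_le`). For `q = 1` take `s = h^{2/3}`; if `μ'(0) = 0`, then `q = 2` is
available and `s = h^{1/2}` gives `O(h)`.

Existence: for `e < μ(Z_I)` the form `energy - e · mass` is coercive up to finitely many point
values of `φ` (`energy_garding`). On `(-∞, Z_I]` the coefficients are constant and the identities
above lose only a point value; on `[Z_I, 0]` a Poincaré inequality on a fine grid suffices.
Minimizing sequences therefore have strongly convergent subsequences
(`IsHermForm.exists_minimizer`). Finally, the du Bois-Reymond lemma turns weak eigenvectors into
`H²` eigenfunctions, with the Neumann conditions as natural boundary conditions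
(`isEigenfunction_of_energy_eq`). -/

/-- Lebesgue measure on the half-line `(-∞, 0]`. -/
abbrev ν : Measure ℝ := volume.restrict (Iic 0)

/-! ### Absolutely continuous complex functions and the fundamental theorem of calculus -/

theorem absolutelyContinuousOnInterval_const (c : ℂ) (a b : ℝ) :
    AbsolutelyContinuousOnInterval (fun _ : ℝ => c) a b :=
  (LipschitzWith.const (α := ℝ) c).lipschitzOnWith.absolutelyContinuousOnInterval

theorem AbsolutelyContinuousOnInterval.ofReal {f : ℝ → ℝ} {a b : ℝ}
    (hf : AbsolutelyContinuousOnInterval f a b) :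
    AbsolutelyContinuousOnInterval (fun x => (f x : ℂ)) a b := by
  have h := hf.fun_smul (absolutelyContinuousOnInterval_const 1 a b)
  simpa using h

theorem AbsolutelyContinuousOnInterval.conj {f : ℝ → ℂ} {a b : ℝ}
    (hf : AbsolutelyContinuousOnInterval f a b) :
    AbsolutelyContinuousOnInterval (fun x => conj (f x)) a b := by
  unfold AbsolutelyContinuousOnInterval at *
  simpa [Complex.dist_conj_conj] using hf

theorem absolutelyContinuousOnInterval_primitive {f : ℝ → ℂ} {a b c : ℝ}
    (h : IntervalIntegrable f volume a b) (hc : c ∈ uIcc a b) :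
    AbsolutelyContinuousOnInterval (fun x => ∫ v in c..x, f v) a b := by
  have hre : IntervalIntegrable (fun x => (f x).re) volume a b := by
    constructor
    · exact h.1.re
    · exact h.2.re
  have him : IntervalIntegrable (fun x => (f x).im) volume a b := by
    constructor
    · exact h.1.im
    · exact h.2.im
  have h1 := AbsolutelyContinuousOnInterval.ofReal
    (hre.absolutelyContinuousOnInterval_intervalIntegral hc)
  have h2 := AbsolutelyContinuousOnInterval.ofReal
    (him.absolutelyContinuousOnInterval_intervalIntegral hc)
  have h3 := h1.fun_add (h2.const_smul Complex.I)
  -- Absolute continuity only samples points of `uIcc a b`, and only there do the real and imaginary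
  -- primitives have to recombine.
  unfold AbsolutelyContinuousOnInterval at h3 ⊢
  refine h3.congr' ?_
  filter_upwards [mem_inf_of_right (mem_principal_self _)] with E hE
  refine Finset.sum_congr rfl fun i hi => ?_
  have key : ∀ x ∈ uIcc a b, ((∫ v in c..x, (f v).re : ℝ) : ℂ)
      + Complex.I • ((∫ v in c..x, (f v).im : ℝ) : ℂ) = ∫ v in c..x, f v := by
    intro x hx
    have hi : IntervalIntegrable f volume c x :=
      h.mono_set (uIcc_subset_uIcc hc hx)
    rw [← intervalIntegral.integral_ofReal, ← intervalIntegral.integral_ofReal,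
      ← intervalIntegral.integral_smul, ← intervalIntegral.integral_add]
    · refine intervalIntegral.integral_congr fun v _ => ?_
      simp only [smul_eq_mul]
      rw [mul_comm, Complex.re_add_im]
    · exact ⟨hi.1.re.ofReal, hi.2.re.ofReal⟩
    · refine IntervalIntegrable.smul (r := Complex.I) ?_
      exact ⟨hi.1.im.ofReal, hi.2.im.ofReal⟩
  rw [key _ (hE.1 i hi).1, key _ (hE.1 i hi).2]

/-- The difference of `f` and the primitive of `f'` is absolutely continuous with zero derivative
almost everywhere, hence constant. -/
theorem integral_eq_sub_of_absolutelyContinuousOnInterval {f f' : ℝ → ℂ} {a b : ℝ} (hab : a ≤ b)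
    (hf : AbsolutelyContinuousOnInterval f a b)
    (hd : ∀ᵐ x, x ∈ Ioo a b → HasDerivAt f (f' x) x)
    (hi : IntervalIntegrable f' volume a b) :
    ∫ x in a..b, f' x = f b - f a := by
  have hp := absolutelyContinuousOnInterval_primitive (c := a) hi (by simp)
  have h1 := hf.fun_sub hp
  have h2 : ∀ᵐ x, x ∈ uIcc a b → HasDerivAt (fun x => f x - ∫ v in a..x, f' v) 0 x := by
    have ha : ∀ᵐ x : ℝ, x ≠ a := by simp [ae_iff, measure_singleton]
    have hb : ∀ᵐ x : ℝ, x ≠ b := by simp [ae_iff, measure_singleton]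
    filter_upwards [hd, hi.ae_hasDerivAt_integral, ha, hb] with x hx hx2 hxa hxb hxm
    have hxm' : x ∈ Ioo a b := by
      rw [uIcc_of_le hab] at hxm
      exact ⟨lt_of_le_of_ne hxm.1 (Ne.symm hxa), lt_of_le_of_ne hxm.2 hxb⟩
    have h3 := (hx hxm').sub (hx2 hxm a (by simp))
    rw [sub_self] at h3
    exact h3
  obtain ⟨C, hC⟩ := h1.const_of_ae_hasDerivAt_zero h2
  have e1 := hC a (by simp)
  have e2 := hC b (by simp)
  simp only [intervalIntegral.integral_same, sub_zero] at e1
  rw [← e1] at e2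
  rw [eq_sub_iff_add_eq, ← sub_eq_iff_eq_add'.1 e2]

/-! ### Primitives, `H¹` on the half-line and integration by parts -/

/-- `u` is a primitive on `(-∞, 0]` of the square integrable function `g`. -/
structure IsPrim (u g : ℝ → ℂ) : Prop where
  memLp_deriv : MemLp g 2 ν
  integral_eq : ∀ a b : ℝ, a ≤ b → b ≤ 0 → ∫ s in a..b, g s = u b - u a

/-- `u` is a continuous representative of an element of `H¹(ℝ⁻)` whose weak derivative is `g`. -/
structure IsH1 (u g : ℝ → ℂ) : Prop where
  memLp : MemLp u 2 ν
  memLp_deriv : MemLp g 2 ν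
  integral_eq : ∀ a b : ℝ, a ≤ b → b ≤ 0 → ∫ s in a..b, g s = u b - u a

theorem MemLp.intervalIntegrable {g : ℝ → ℂ} (hg : MemLp g 2 ν) {a b : ℝ} (ha : a ≤ 0)
    (hb : b ≤ 0) : IntervalIntegrable g volume a b := by
  have h : IntegrableOn g (uIcc a b) := by
    have hL : MemLp g 2 (volume.restrict (uIcc a b)) :=
      hg.mono_measure (Measure.restrict_mono (fun x hx => hx.2.trans (sup_le ha hb)) le_rfl)
    have : IsFiniteMeasure (volume.restrict (uIcc a b)) :=
      ⟨by simp [uIcc]⟩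
    exact hL.integrable (by norm_num)
  exact ⟨h.mono_set (by exact Ioc_subset_Icc_self.trans Icc_subset_uIcc),
    h.mono_set (by exact Ioc_subset_Icc_self.trans Icc_subset_uIcc')⟩

namespace IsPrim

variable {u g v w : ℝ → ℂ}

theorem ae_hasDerivAt (h : IsPrim u g) :
    ∀ᵐ x, x < 0 → HasDerivAt u (g x) x := by
  have key : ∀ n : ℕ, ∀ᵐ x, x ∈ Ioo (-(n : ℝ)) 0 → HasDerivAt u (g x) x := by
    intro n
    have hn : (-(n : ℝ)) ≤ 0 := by simp
    have hi := MemLp.intervalIntegrable h.memLp_deriv hn le_rfl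
    filter_upwards [hi.ae_hasDerivAt_integral] with x hx hxm
    have h1 := hx (by rw [uIcc_of_le hn]; exact Ioo_subset_Icc_self hxm) (-(n : ℝ)) (by simp)
    have h2 := h1.add_const (u (-(n : ℝ)))
    refine h2.congr_of_eventuallyEq ?_
    filter_upwards [Ioo_mem_nhds hxm.1 hxm.2] with y hy
    rw [h.integral_eq _ _ hy.1.le hy.2.le]
    simp
  rw [← ae_all_iff] at key
  filter_upwards [key] with x hx hx0
  obtain ⟨n, hn⟩ := exists_nat_gt (-x)
  exact hx n ⟨by linarith, hx0⟩

theorem absolutelyContinuousOnInterval (h : IsPrim u g) {a b : ℝ} (ha : a ≤ b) (hb : b ≤ 0) :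
    AbsolutelyContinuousOnInterval u a b := by
  have h1 := (absolutelyContinuousOnInterval_primitive (c := a)
    (MemLp.intervalIntegrable h.memLp_deriv (ha.trans hb) hb) (by simp)).fun_add
    (absolutelyContinuousOnInterval_const (u a) a b)
  unfold AbsolutelyContinuousOnInterval at h1 ⊢
  refine h1.congr' ?_
  filter_upwards [mem_inf_of_right (mem_principal_self _)] with E hE
  refine Finset.sum_congr rfl fun i hi => ?_
  have key : ∀ x ∈ uIcc a b, (∫ v in a..x, g v) + u a = u x := by
    intro x hx
    rw [uIcc_of_le ha] at hx
    rw [h.integral_eq a x hx.1 (hx.2.trans hb)]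
    ring
  rw [key _ (hE.1 i hi).1, key _ (hE.1 i hi).2]

theorem continuousOn (h : IsPrim u g) : ContinuousOn u (Iic 0) := by
  intro x hx
  have hx0 : x ≤ 0 := hx
  have h1 := (h.absolutelyContinuousOnInterval (show x - 1 ≤ 0 by linarith) le_rfl).continuousOn
  rw [uIcc_of_le (by linarith)] at h1
  refine (h1 x ⟨by linarith, hx⟩).mono_of_mem_nhdsWithin ?_
  have : Iic (0 : ℝ) ∩ Ioi (x - 1) ∈ 𝓝[Iic 0] x :=
    inter_mem self_mem_nhdsWithin (mem_nhdsWithin_of_mem_nhds (Ioi_mem_nhds (by linarith)))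
  filter_upwards [this] with y hy
  exact ⟨le_of_lt hy.2, hy.1⟩

theorem interval_by_parts (h : IsPrim u g) (h' : IsPrim v w) {a b : ℝ} (hab : a ≤ b) (hb : b ≤ 0) :
    ∫ x in a..b, (g x * conj (v x) + u x * conj (w x)) = u b * conj (v b) - u a * conj (v a) := by
  have hac := h.absolutelyContinuousOnInterval hab hb
  have hac' := AbsolutelyContinuousOnInterval.conj (h'.absolutelyContinuousOnInterval hab hb)
  have hac'' := hac.fun_smul hac'
  simp only [smul_eq_mul] at hac''
  refine integral_eq_sub_of_absolutelyContinuousOnInterval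
    (f := fun x => u x * conj (v x)) hab hac'' ?_ ?_
  · filter_upwards [h.ae_hasDerivAt, h'.ae_hasDerivAt] with x hx hx' hxm
    have hx0 : x < 0 := hxm.2.trans_le hb
    exact (hx hx0).mul (hx' hx0).star
  · refine IntervalIntegrable.add ?_ ?_
    · exact (MemLp.intervalIntegrable h.memLp_deriv (hab.trans hb) hb).mul_continuousOn
        hac'.continuousOn
    · exact (MemLp.intervalIntegrable h'.memLp_deriv.star (hab.trans hb) hb).continuousOn_mul
        hac.continuousOn

end IsPrim

namespace IsH1

variable {u g v w : ℝ → ℂ}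

theorem isPrim (h : IsH1 u g) : IsPrim u g := ⟨h.memLp_deriv, h.integral_eq⟩

theorem ae_hasDerivAt (h : IsH1 u g) : ∀ᵐ x, x < 0 → HasDerivAt u (g x) x :=
  h.isPrim.ae_hasDerivAt

theorem absolutelyContinuousOnInterval (h : IsH1 u g) {a b : ℝ} (ha : a ≤ b) (hb : b ≤ 0) :
    AbsolutelyContinuousOnInterval u a b :=
  h.isPrim.absolutelyContinuousOnInterval ha hb

theorem continuousOn (h : IsH1 u g) : ContinuousOn u (Iic 0) := h.isPrim.continuousOn

theorem integrable_mul_conj {f g : ℝ → ℂ} (hf : MemLp f 2 ν) (hg : MemLp g 2 ν) :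
    Integrable (fun x => f x * conj (g x)) ν := by
  have h := hf.integrable_mul hg.star
  exact h

/-- Integration by parts on a half-line. -/
theorem integral_by_parts (h : IsH1 u g) (h' : IsH1 v w) {b : ℝ} (hb : b ≤ 0) :
    ∫ x in Iic b, (g x * conj (v x) + u x * conj (w x)) = u b * conj (v b) := by
  have hint : IntegrableOn (fun x => g x * conj (v x) + u x * conj (w x)) (Iic b) :=
    IntegrableOn.mono_set (t := Iic 0) ((integrable_mul_conj h.memLp_deriv h'.memLp).add
      (integrable_mul_conj h.memLp h'.memLp_deriv)) (Iic_subset_Iic.2 hb)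
  have hlim := intervalIntegral_tendsto_integral_Iic b hint tendsto_id
  have hl2 : Tendsto (fun a => u a * conj (v a)) atBot
      (𝓝 (u b * conj (v b) - ∫ x in Iic b, (g x * conj (v x) + u x * conj (w x)))) := by
    have := (tendsto_const_nhds (x := u b * conj (v b))).sub hlim
    refine this.congr' ?_
    filter_upwards [eventually_le_atBot b] with a ha
    simp only [id]
    rw [h.isPrim.interval_by_parts h'.isPrim ha hb]
    ring
  have hint2 : IntegrableOn (fun x => u x * conj (v x)) (Iic 0) :=
    integrable_mul_conj h.memLp h'.memLp
  -- The boundary term at `-∞` has a limit; a nonzero limit would contradict the integrability of `u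
  -- * conj v`.
  have h0 : u b * conj (v b) - ∫ x in Iic b, (g x * conj (v x) + u x * conj (w x)) = 0 := by
    by_contra hne
    set L := u b * conj (v b) - ∫ x in Iic b, (g x * conj (v x) + u x * conj (w x))
    have hpos : 0 < ‖L‖ := norm_pos_iff.2 hne
    have hev := hl2.norm.eventually (lt_mem_nhds (show ‖L‖ / 2 < ‖L‖ by linarith))
    obtain ⟨c, hc⟩ := (eventually_atBot.1 hev)
    have hint3 : IntegrableOn (fun x => u x * conj (v x)) (Iic (min c 0)) :=
      hint2.mono_set (Iic_subset_Iic.2 (min_le_right _ _))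
    have : IntegrableOn (fun _ : ℝ => ‖L‖ / 2) (Iic (min c 0)) := by
      refine Integrable.mono' hint3.norm aestronglyMeasurable_const ?_
      filter_upwards [ae_restrict_mem measurableSet_Iic] with x hx
      rw [Real.norm_of_nonneg (by positivity)]
      exact (hc x (le_trans hx (min_le_left _ _))).le
    rw [integrableOn_const_iff (by simp)] at this
    simp [hpos.ne'] at this
  rw [sub_eq_zero] at h0
  exact h0.symm

end IsH1

/-- A function in `H¹(ℝ⁻)`, with its derivative. -/
theorem MemH1.isH1 {u : ℝ → ℂ} (h : MemH1 u) : IsH1 u (D u) := by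
  refine ⟨h.memLp, h.memLp_deriv, fun a b hab hb => ?_⟩
  have hac : AbsolutelyContinuousOnInterval u a b := by
    refine (h.ac a (hab.trans hb)).mono ?_
    rw [uIcc_of_le hab, uIcc_of_le (hab.trans hb)]
    exact Icc_subset_Icc_right hb
  refine integral_eq_sub_of_absolutelyContinuousOnInterval hab hac ?_
    (MemLp.intervalIntegrable h.memLp_deriv (hab.trans hb) hb)
  filter_upwards [hac.boundedVariationOn.ae_differentiableAt_of_mem_uIcc] with x hx hxm
  have hx1 := hx (by rw [uIcc_of_le hab]; exact Ioo_subset_Icc_self hxm)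
  have : D u x = deriv u x := derivWithin_of_mem_nhds (Iic_mem_nhds (hxm.2.trans_le hb))
  rw [this]
  exact hx1.hasDerivAt

theorem IsH1.ae_D_eq {u g : ℝ → ℂ} (h : IsH1 u g) : D u =ᵐ[ν] g := by
  have h0 : ∀ᵐ x : ℝ, x ≠ 0 := by simp [ae_iff, measure_singleton]
  rw [Filter.EventuallyEq, ae_restrict_iff' measurableSet_Iic]
  filter_upwards [h.ae_hasDerivAt, h0] with x hx hx0 hxm
  have hlt : x < 0 := lt_of_le_of_ne hxm hx0
  have : D u x = deriv u x := derivWithin_of_mem_nhds (Iic_mem_nhds hlt)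
  rw [this, (hx hlt).deriv]

theorem IsH1.memH1 {u g : ℝ → ℂ} (h : IsH1 u g) : MemH1 u :=
  ⟨fun _ ha => h.absolutelyContinuousOnInterval ha le_rfl, h.memLp,
    h.memLp_deriv.ae_eq h.ae_D_eq.symm⟩

/-! ### Hermitian forms and variational eigenvectors -/

/-- A Hermitian sesquilinear form, linear in the second argument. -/
structure IsHermForm {E : Type*} [AddCommGroup E] [Module ℂ E] (q : E → E → ℂ) : Prop where
  add_right : ∀ x y z, q x (y + z) = q x y + q x z
  smul_right : ∀ (c : ℂ) x y, q x (c • y) = c * q x y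
  conj_symm : ∀ x y, conj (q x y) = q y x

namespace IsHermForm

variable {E : Type*} [AddCommGroup E] [Module ℂ E] {q b : E → E → ℂ}

theorem add_left (h : IsHermForm q) (x y z : E) : q (x + y) z = q x z + q y z := by
  rw [← h.conj_symm, h.add_right, map_add, h.conj_symm, h.conj_symm]

theorem smul_left (h : IsHermForm q) (c : ℂ) (x y : E) : q (c • x) y = conj c * q x y := by
  rw [← h.conj_symm, h.smul_right, map_mul, h.conj_symm]

theorem neg_right (h : IsHermForm q) (x y : E) : q x (-y) = -q x y := by
  rw [← neg_one_smul ℂ, h.smul_right, neg_one_mul]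

theorem neg_left (h : IsHermForm q) (x y : E) : q (-x) y = -q x y := by
  rw [← neg_one_smul ℂ, h.smul_left]; simp

theorem sub_right (h : IsHermForm q) (x y z : E) : q x (y - z) = q x y - q x z := by
  rw [sub_eq_add_neg, h.add_right, h.neg_right, sub_eq_add_neg]

theorem sub_left (h : IsHermForm q) (x y z : E) : q (x - y) z = q x z - q y z := by
  rw [sub_eq_add_neg, h.add_left, h.neg_left, sub_eq_add_neg]

theorem re_symm (h : IsHermForm q) (x y : E) : (q x y).re = (q y x).re := by
  rw [← h.conj_symm, Complex.conj_re]

theorem add (h : IsHermForm q) (h' : IsHermForm b) : IsHermForm fun x y => q x y + b x y :=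
  ⟨fun x y z => by rw [h.add_right, h'.add_right]; ring,
    fun c x y => by rw [h.smul_right, h'.smul_right]; ring,
    fun x y => by rw [map_add, h.conj_symm, h'.conj_symm]⟩

theorem real_mul (h : IsHermForm q) (r : ℝ) : IsHermForm fun x y => (r : ℂ) * q x y :=
  ⟨fun x y z => by rw [h.add_right]; ring,
    fun c x y => by rw [h.smul_right]; ring,
    fun x y => by rw [map_mul, h.conj_symm, Complex.conj_ofReal]⟩

theorem sub_real_mul (h : IsHermForm q) (h' : IsHermForm b) (r : ℝ) :
    IsHermForm fun x y => q x y - (r : ℂ) * b x y := by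
  have := h.add (h'.real_mul (-r))
  simpa [← sub_eq_add_neg] using this

theorem re_add_self (h : IsHermForm q) (x y : E) :
    (q (x + y) (x + y)).re = (q x x).re + 2 * (q x y).re + (q y y).re := by
  rw [h.add_right, h.add_left, h.add_left]
  simp only [Complex.add_re]
  rw [h.re_symm y x]; ring

theorem re_sub_self (h : IsHermForm q) (x y : E) :
    (q (x - y) (x - y)).re = (q x x).re - 2 * (q x y).re + (q y y).re := by
  rw [h.sub_right, h.sub_left, h.sub_left]
  simp only [Complex.sub_re]
  rw [h.re_symm y x]; ring

theorem re_smul_self (h : IsHermForm q) (c : ℂ) (x : E) :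
    (q (c • x) (c • x)).re = ‖c‖ ^ 2 * (q x x).re := by
  rw [h.smul_right, h.smul_left, ← mul_assoc, Complex.mul_conj, Complex.normSq_eq_norm_sq,
    Complex.re_ofReal_mul]

/-- A vector on which a nonnegative form vanishes is in the kernel of the form. -/
theorem eq_zero_of_nonneg (h : IsHermForm q) {N : Submodule ℂ E}
    (h0 : ∀ y ∈ N, 0 ≤ (q y y).re) {x : E} (hx : x ∈ N) (hxx : (q x x).re ≤ 0) {y : E}
    (hy : y ∈ N) : q x y = 0 := by
  -- Nonnegativity at `x - t * conj (q x y) • y`, where `q x x ≤ 0` is discarded; for small `t > 0`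
  -- the linear term dominates.
  have key : ∀ t : ℝ, 0 ≤ -(2 * t * ‖q x y‖ ^ 2) + t ^ 2 * ‖q x y‖ ^ 2 * (q y y).re := by
    intro t
    have h1 := h0 _ (N.add_mem hx (N.smul_mem (-(t : ℂ) * conj (q x y)) hy))
    rw [h.re_add_self, h.re_smul_self, h.smul_right] at h1
    have e : -(t : ℂ) * conj (q x y) * q x y = ((-(t * ‖q x y‖ ^ 2) : ℝ) : ℂ) := by
      rw [mul_assoc, mul_comm (conj (q x y)), Complex.mul_conj, Complex.normSq_eq_norm_sq]
      push_cast; ring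
    rw [e, Complex.ofReal_re] at h1
    have e2 : ‖-(t : ℂ) * conj (q x y)‖ ^ 2 = t ^ 2 * ‖q x y‖ ^ 2 := by
      rw [norm_mul, mul_pow]; simp
    rw [e2] at h1
    linarith
  by_contra hne
  have hpos : 0 < ‖q x y‖ ^ 2 := by positivity
  have hyy := h0 y hy
  have k := key (1 / ((q y y).re + 1))
  have hd : 0 < (q y y).re + 1 := by linarith
  have : -(2 * (1 / ((q y y).re + 1)) * ‖q x y‖ ^ 2)
      + (1 / ((q y y).re + 1)) ^ 2 * ‖q x y‖ ^ 2 * (q y y).re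
      = -(‖q x y‖ ^ 2 * ((q y y).re + 2) / ((q y y).re + 1) ^ 2) := by
    field_simp; ring
  rw [this] at k
  have : 0 < ‖q x y‖ ^ 2 * ((q y y).re + 2) / ((q y y).re + 1) ^ 2 := by positivity
  linarith

/-- The infimum of the Rayleigh quotient `q / b` over a closed subspace `N` is attained when it
lies below `m`, provided that for `e < m` the form `q - e b` is coercive up to a finite-rank
perturbation. -/
theorem exists_minimizer {n : E → E → ℂ} {m : ℝ} (hq : IsHermForm q) (hb : IsHermForm b)
    (hn0 : ∀ x, 0 ≤ (n x x).re) (hb0 : ∀ x, 0 ≤ (b x x).re)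
    (hgard : ∀ e < m, ∃ (k : ℕ) (T : E →ₗ[ℂ] (Fin k → ℂ × ℂ)) (κ C C' : ℝ), 0 < κ ∧
      (∀ x, κ * (n x x).re ≤ (q x x).re - e * (b x x).re + C * ‖T x‖ ^ 2) ∧
      ∀ x, ‖T x‖ ^ 2 ≤ C' * (n x x).re)
    (hcoer : ∃ κ C : ℝ, 0 < κ ∧ ∀ x, κ * (n x x).re ≤ (q x x).re + C * (b x x).re)
    (hqn : ∃ C : ℝ, ∀ x, |(q x x).re| ≤ C * (n x x).re)
    (hbn : ∃ C : ℝ, ∀ x, (b x x).re ≤ C * (n x x).re)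
    {N : Submodule ℂ E}
    (hcomplete : ∀ s : ℕ → E, (∀ k, s k ∈ N) →
      (∀ ε > 0, ∃ K, ∀ j ≥ K, ∀ l ≥ K, (n (s j - s l) (s j - s l)).re ≤ ε) →
      ∃ x ∈ N, Tendsto (fun k => (n (s k - x) (s k - x)).re) atTop (𝓝 0))
    {x₀ : E} (hx₀ : x₀ ∈ N) (hbx₀ : 0 < (b x₀ x₀).re) (hqx₀ : (q x₀ x₀).re < m * (b x₀ x₀).re) :
    ∃ e < m, ∃ x ∈ N, 0 < (b x x).re ∧ (∀ y ∈ N, e * (b y y).re ≤ (q y y).re) ∧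
      ∀ y ∈ N, q x y = e * b x y := by
  obtain ⟨κ₀, C₀, hκ₀, hcoer⟩ := hcoer
  obtain ⟨C₁, hqn⟩ := hqn
  obtain ⟨C₂, hbn⟩ := hbn
  set Q : Set ℝ := {r | ∃ y ∈ N, (b y y).re = 1 ∧ (q y y).re = r} with hQ
  have hscale : ∀ y ∈ N, 0 < (b y y).re → (q y y).re / (b y y).re ∈ Q := by
    intro y hy hby
    refine ⟨((Real.sqrt (b y y).re)⁻¹ : ℂ) • y, N.smul_mem _ hy, ?_, ?_⟩
    · rw [hb.re_smul_self, ← Complex.ofReal_inv, Complex.norm_real, Real.norm_eq_abs, sq_abs,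
        inv_pow, Real.sq_sqrt hby.le]
      field_simp
    · rw [hq.re_smul_self, ← Complex.ofReal_inv, Complex.norm_real, Real.norm_eq_abs, sq_abs,
        inv_pow, Real.sq_sqrt hby.le]
      field_simp
  have hbdd : BddBelow Q := by
    refine ⟨-C₀, ?_⟩
    rintro r ⟨y, -, hy1, rfl⟩
    have := hcoer y
    rw [hy1] at this
    nlinarith [hn0 y]
  have hne : Q.Nonempty := ⟨_, hscale x₀ hx₀ hbx₀⟩
  set e := sInf Q with he
  have hem : e < m := by
    refine (csInf_le hbdd (hscale x₀ hx₀ hbx₀)).trans_lt ?_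
    rwa [div_lt_iff₀ hbx₀]
  have hmin : ∀ y ∈ N, e * (b y y).re ≤ (q y y).re := by
    intro y hy
    rcases (hb0 y).eq_or_lt with h | h
    · have := hcoer y
      rw [← h] at this ⊢
      nlinarith [hn0 y]
    · rw [← le_div_iff₀ h]
      exact csInf_le hbdd (hscale y hy h)
  have hS := hq.sub_real_mul hb e
  have hSre : ∀ x, (q x x - (e : ℂ) * b x x).re = (q x x).re - e * (b x x).re := by
    intro x; simp
  have hseq : ∀ k : ℕ, ∃ y ∈ N, (b y y).re = 1 ∧ (q y y).re < e + 1 / ((k : ℝ) + 1) := by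
    intro k
    obtain ⟨r, ⟨y, hy, hy1, rfl⟩, hr⟩ := exists_lt_of_csInf_lt hne
      (show sInf Q < e + 1 / ((k : ℝ) + 1) by
        rw [← he]; exact lt_add_of_pos_right _ (by positivity))
    exact ⟨y, hy, hy1, hr⟩
  choose s hsN hsb hsq using hseq
  obtain ⟨d, T, κ, C, C', hκ, hgard, hT⟩ := hgard e hem
  have hns : ∀ k, (n (s k) (s k)).re ≤ (e + 1 + C₀) / κ₀ := by
    intro k
    rw [le_div_iff₀ hκ₀]
    have h1 := hcoer (s k)
    have h2 := hsq k
    have h3 : 1 / ((k : ℝ) + 1) ≤ 1 := by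
      rw [div_le_one (by positivity)]; simp
    rw [hsb k] at h1
    linarith
  have hTb : ∀ k, T (s k) ∈ Metric.closedBall (0 : Fin d → ℂ × ℂ)
      (Real.sqrt (|C'| * ((e + 1 + C₀) / κ₀))) := by
    intro k
    rw [mem_closedBall_zero_iff]
    refine Real.le_sqrt_of_sq_le ((hT _).trans ?_)
    exact mul_le_mul (le_abs_self _) (hns k) (hn0 _) (abs_nonneg _)
  -- The finite rank of `T` supplies the compactness: the bounded sequence `T (s k)` has a
  -- convergent subsequence.
  obtain ⟨z, -, φ, hφ, hz⟩ := tendsto_subseq_of_bounded Metric.isBounded_closedBall hTb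
  have hSs : Tendsto (fun k => (q (s (φ k)) (s (φ k))).re - e) atTop (𝓝 0) := by
    have h1 : Tendsto (fun k : ℕ => 1 / ((φ k : ℝ) + 1)) atTop (𝓝 0) :=
      tendsto_one_div_add_atTop_nhds_zero_nat.comp hφ.tendsto_atTop
    refine squeeze_zero (fun k => ?_) (fun k => ?_) h1
    · have := hmin _ (hsN (φ k))
      rw [hsb] at this
      linarith
    · linarith [hsq (φ k)]
  -- Parallelogram identity for `q - e b`, whose value at `x + y` is nonnegative by minimality.
  have hpar : ∀ x ∈ N, ∀ y ∈ N, (q (x - y) (x - y)).re - e * (b (x - y) (x - y)).re ≤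
      2 * ((q x x).re - e * (b x x).re) + 2 * ((q y y).re - e * (b y y).re) := by
    intro x hx y hy
    have h1 := hmin _ (N.add_mem hx hy)
    rw [hq.re_add_self, hb.re_add_self] at h1
    rw [hq.re_sub_self, hb.re_sub_self]
    linarith
  -- On differences of the subsequence, `q - e b` is small by `hpar` and `T` is small by
  -- convergence; the coercivity estimate makes `n` small as well.
  obtain ⟨x, hxN, hx⟩ := hcomplete (fun k => s (φ k)) (fun k => hsN _) (by
    intro ε hε
    have hc := hz.cauchySeq
    rw [Metric.cauchySeq_iff] at hc
    obtain ⟨K₁, hK₁⟩ := hc (Real.sqrt (κ * ε / (2 * (|C| + 1)))) (by positivity)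
    have hev := hSs.eventually (gt_mem_nhds (show 0 < κ * ε / 8 by positivity))
    obtain ⟨K₂, hK₂⟩ := eventually_atTop.1 hev
    refine ⟨max K₁ K₂, fun j hj l hl => ?_⟩
    have h1 := hgard (s (φ j) - s (φ l))
    have h2 := hpar _ (hsN (φ j)) _ (hsN (φ l))
    have h3 := hK₂ j ((le_max_right _ _).trans hj)
    have h4 := hK₂ l ((le_max_right _ _).trans hl)
    have h5 := (hK₁ j ((le_max_left _ _).trans hj) l ((le_max_left _ _).trans hl)).le
    rw [dist_eq_norm, Function.comp, Function.comp, ← map_sub] at h5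
    have h6 := (Real.le_sqrt (norm_nonneg _) (by positivity)).1 h5
    rw [le_div_iff₀ (by positivity)] at h6
    have h7 : C * ‖T (s (φ j) - s (φ l))‖ ^ 2 ≤ (|C| + 1) * ‖T (s (φ j) - s (φ l))‖ ^ 2 := by
      gcongr
      linarith [le_abs_self C]
    rw [hsb, hsb] at h2
    have h8 : κ * (n (s (φ j) - s (φ l)) (s (φ j) - s (φ l))).re ≤ κ * ε := by nlinarith
    exact le_of_mul_le_mul_left h8 hκ)
  -- `hpar` is applied to `s (φ k)` and `s (φ k) - x`, whose difference is `x`.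
  have hxS : (q x x).re - e * (b x x).re ≤ 0 := by
    have h1 : ∀ k, (q x x).re - e * (b x x).re ≤ 2 * ((q (s (φ k)) (s (φ k))).re - e)
        + 2 * ((C₁ + |e| * |C₂|) * (n (s (φ k) - x) (s (φ k) - x)).re) := by
      intro k
      have h2 := hpar _ (hsN (φ k)) _ (N.sub_mem (hsN (φ k)) hxN)
      rw [sub_sub_cancel, hsb] at h2
      have h3 := (le_abs_self _).trans (hqn (s (φ k) - x))
      have h4 : -(e * (b (s (φ k) - x) (s (φ k) - x)).re) ≤
          |e| * |C₂| * (n (s (φ k) - x) (s (φ k) - x)).re := by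
        calc -(e * (b (s (φ k) - x) (s (φ k) - x)).re)
            ≤ |e| * (b (s (φ k) - x) (s (φ k) - x)).re := by
              nlinarith [neg_abs_le e, hb0 (s (φ k) - x)]
          _ ≤ |e| * (|C₂| * (n (s (φ k) - x) (s (φ k) - x)).re) := by
              refine mul_le_mul_of_nonneg_left ((hbn _).trans ?_) (abs_nonneg _)
              exact mul_le_mul_of_nonneg_right (le_abs_self _) (hn0 _)
          _ = _ := by ring
      linarith
    have h2 := ((hSs.const_mul 2).add ((hx.const_mul (C₁ + |e| * |C₂|)).const_mul 2))
    simp only [mul_zero, add_zero] at h2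
    exact ge_of_tendsto' h2 h1
  -- No mass is lost in the limit: `1 = b (s (φ k)) (s (φ k))` is at most twice the mass of `x` plus
  -- twice that of `s (φ k) - x`.
  have hbx : 0 < (b x x).re := by
    have h1 : ∀ k, 1 ≤ 2 * (b x x).re + 2 * (C₂ * (n (s (φ k) - x) (s (φ k) - x)).re) := by
      intro k
      have h2 := hb0 ((s (φ k) - x) - x)
      have h4 := hb.re_add_self (s (φ k) - x) x
      rw [hb.re_sub_self] at h2
      rw [sub_add_cancel, hsb] at h4
      have h3 := hbn (s (φ k) - x)
      linarith
    have h2 := ((hx.const_mul C₂).const_mul 2).const_add (2 * (b x x).re)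
    simp only [mul_zero, add_zero] at h2
    have := ge_of_tendsto' h2 h1
    linarith
  refine ⟨e, hem, x, hxN, hbx, hmin, fun y hy => ?_⟩
  have h0 := hS.eq_zero_of_nonneg (N := N) (fun y hy => by rw [hSre]; linarith [hmin y hy]) hxN
    (by rw [hSre]; exact hxS) hy
  exact sub_eq_zero.1 h0

theorem norm_sq_le_mul (hb : IsHermForm b) (hb0 : ∀ x, 0 ≤ (b x x).re) (x y : E) :
    ‖b x y‖ ^ 2 ≤ (b x x).re * (b y y).re := by
  rcases (hb0 x).eq_or_lt with h | h
  · rw [hb.eq_zero_of_nonneg (N := ⊤) (fun z _ => hb0 z) (x := x) trivial h.symm.le trivial, ← h]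
    simp
  · have h1 := hb0 (y - (b x y / ((b x x).re : ℂ)) • x)
    rw [hb.re_sub_self, hb.re_smul_self, hb.smul_right] at h1
    have e : b x y / ((b x x).re : ℂ) * b y x = ((‖b x y‖ ^ 2 / (b x x).re : ℝ) : ℂ) := by
      rw [← hb.conj_symm x y, div_mul_eq_mul_div, Complex.mul_conj, Complex.normSq_eq_norm_sq]
      push_cast; ring
    rw [e, Complex.ofReal_re, norm_div, Complex.norm_real, Real.norm_of_nonneg h.le] at h1
    have e2 : (‖b x y‖ / (b x x).re) ^ 2 * (b x x).re = ‖b x y‖ ^ 2 / (b x x).re := by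
      field_simp
    rw [e2] at h1
    have h2 : ‖b x y‖ ^ 2 / (b x x).re ≤ (b y y).re := by linarith
    rw [div_le_iff₀ h] at h2
    linarith

/-- The first two eigenvectors of `q` relative to `b`, when `q < m b` on a two-dimensional space. -/
theorem exists_two_eigenvectors {n : E → E → ℂ} {m r : ℝ} (hq : IsHermForm q) (hb : IsHermForm b)
    (hn0 : ∀ x, 0 ≤ (n x x).re) (hb0 : ∀ x, 0 ≤ (b x x).re)
    (hgard : ∀ e < m, ∃ (k : ℕ) (T : E →ₗ[ℂ] (Fin k → ℂ × ℂ)) (κ C C' : ℝ), 0 < κ ∧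
      (∀ x, κ * (n x x).re ≤ (q x x).re - e * (b x x).re + C * ‖T x‖ ^ 2) ∧
      ∀ x, ‖T x‖ ^ 2 ≤ C' * (n x x).re)
    (hcoer : ∃ κ C : ℝ, 0 < κ ∧ ∀ x, κ * (n x x).re ≤ (q x x).re + C * (b x x).re)
    (hqn : ∃ C : ℝ, ∀ x, |(q x x).re| ≤ C * (n x x).re)
    (hbn : ∃ C : ℝ, ∀ x, (b x x).re ≤ C * (n x x).re)
    (hcomplete : ∀ s : ℕ → E,
      (∀ ε > 0, ∃ K, ∀ j ≥ K, ∀ l ≥ K, (n (s j - s l) (s j - s l)).re ≤ ε) →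
      ∃ x, Tendsto (fun k => (n (s k - x) (s k - x)).re) atTop (𝓝 0))
    (hr : r < m)
    (htrial : ∀ ℓ : E →ₗ[ℂ] ℂ, ∃ x, ℓ x = 0 ∧ 0 < (b x x).re ∧ (q x x).re ≤ r * (b x x).re) :
    ∃ e₁ e₂ : ℝ, ∃ x₁ x₂ : E, e₁ ≤ e₂ ∧ e₂ ≤ r ∧ 0 < (b x₁ x₁).re ∧ 0 < (b x₂ x₂).re ∧
      b x₁ x₂ = 0 ∧ (∀ y, q x₁ y = e₁ * b x₁ y) ∧ (∀ y, q x₂ y = e₂ * b x₂ y) ∧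
      ∀ y, b x₁ y = 0 → e₂ * (b y y).re ≤ (q y y).re := by
  obtain ⟨x₀, -, hbx₀, hqx₀⟩ := htrial 0
  obtain ⟨e₁, -, x₁, -, hbx₁, hmin₁, heig₁⟩ := exists_minimizer (N := ⊤) hq hb hn0 hb0 hgard hcoer
    hqn hbn (fun s _ hs => by simpa using hcomplete s hs) (x₀ := x₀) trivial hbx₀
    (hqx₀.trans_lt (mul_lt_mul_of_pos_right hr hbx₀))
  let ℓ : E →ₗ[ℂ] ℂ :=
    { toFun := b x₁
      map_add' := hb.add_right x₁
      map_smul' := fun c y => hb.smul_right c x₁ y }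
  have hℓ : ∀ y, y ∈ LinearMap.ker ℓ ↔ b x₁ y = 0 := fun y => LinearMap.mem_ker
  obtain ⟨y₀, hy₀, hby₀, hqy₀⟩ := htrial ℓ
  have hclosed : ∀ s : ℕ → E, (∀ k, s k ∈ LinearMap.ker ℓ) →
      (∀ ε > 0, ∃ K, ∀ j ≥ K, ∀ l ≥ K, (n (s j - s l) (s j - s l)).re ≤ ε) →
      ∃ x ∈ LinearMap.ker ℓ, Tendsto (fun k => (n (s k - x) (s k - x)).re) atTop (𝓝 0) := by
    intro s hsN hs
    obtain ⟨x, hx⟩ := hcomplete s hs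
    refine ⟨x, ?_, hx⟩
    rw [hℓ]
    obtain ⟨C, hC⟩ := hbn
    have h1 : ∀ k, ‖b x₁ x‖ ^ 2 ≤ (b x₁ x₁).re * (C * (n (s k - x) (s k - x)).re) := by
      intro k
      have h2 := hb.norm_sq_le_mul hb0 x₁ (s k - x)
      rw [hb.sub_right, (hℓ _).1 (hsN k), zero_sub, norm_neg] at h2
      exact h2.trans (mul_le_mul_of_nonneg_left (hC _) hbx₁.le)
    have h2 := (hx.const_mul C).const_mul (b x₁ x₁).re
    simp only [mul_zero] at h2
    have h3 := ge_of_tendsto' h2 h1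
    have h4 : ‖b x₁ x‖ ^ 2 = 0 := le_antisymm h3 (by positivity)
    simpa using h4
  obtain ⟨e₂, -, x₂, hx₂, hbx₂, hmin₂, heig₂⟩ := exists_minimizer hq hb hn0 hb0 hgard hcoer
    hqn hbn hclosed (x₀ := y₀) hy₀ hby₀ (hqy₀.trans_lt (mul_lt_mul_of_pos_right hr hby₀))
  have hx₂' := (hℓ _).1 hx₂
  have h21 : b x₂ x₁ = 0 := by rw [← hb.conj_symm, hx₂', map_zero]
  refine ⟨e₁, e₂, x₁, x₂, ?_, ?_, hbx₁, hbx₂, hx₂', fun y => heig₁ y trivial, ?_,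
    fun y hy => hmin₂ y ((hℓ y).2 hy)⟩
  · have h1 := hmin₁ x₂ trivial
    rw [heig₂ x₂ hx₂, Complex.re_ofReal_mul] at h1
    exact le_of_mul_le_mul_right h1 hbx₂
  · exact le_of_mul_le_mul_right ((hmin₂ y₀ hy₀).trans hqy₀) hby₀
  -- The equation for `x₂` is known only on the `b`-orthogonal complement of `x₁`. It extends to all
  -- `y` because both forms vanish on the pair `x₂`, `x₁`, by the equation for `x₁`.
  · intro y
    have hne : b x₁ x₁ ≠ 0 := fun h => by simp [h] at hbx₁
    have hy : y - (b x₁ y / b x₁ x₁) • x₁ ∈ LinearMap.ker ℓ := by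
      rw [hℓ, hb.sub_right, hb.smul_right, div_mul_cancel₀ _ hne, sub_self]
    have h1 := heig₂ _ hy
    rw [hq.sub_right, hb.sub_right, hq.smul_right, hb.smul_right, h21, ← hq.conj_symm x₁ x₂,
      heig₁ x₂ trivial, hx₂'] at h1
    simpa using h1

/-- A vector in the span of two eigenvectors that lies in a given hyperplane. -/
theorem exists_le_of_two_eigenvectors (hq : IsHermForm q) (hb : IsHermForm b) {e₁ e₂ r : ℝ}
    {x₁ x₂ : E} (h₁ : ∀ y, q x₁ y = e₁ * b x₁ y) (h₂ : ∀ y, q x₂ y = e₂ * b x₂ y)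
    (hb0 : ∀ x, 0 ≤ (b x x).re)
    (hr₁ : e₁ ≤ r) (hr₂ : e₂ ≤ r)
    (hind : ∀ c₁ c₂ : ℂ, (c₁ ≠ 0 ∨ c₂ ≠ 0) →
      0 < (b (c₁ • x₁ + c₂ • x₂) (c₁ • x₁ + c₂ • x₂)).re)
    (ℓ : E →ₗ[ℂ] ℂ) :
    ∃ y, ℓ y = 0 ∧ 0 < (b y y).re ∧ (q y y).re ≤ r * (b y y).re := by
  -- Evaluating `q x₁ x₂` through either eigenvector gives `(e₂ - e₁) * b x₁ x₂ = 0`. So on the span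
  -- `q` is either a multiple of `b` or diagonal together with `b`.
  have horth : e₁ = e₂ ∨ b x₁ x₂ = 0 := by
    have e := h₁ x₂
    rw [← hq.conj_symm, h₂, map_mul, hb.conj_symm, Complex.conj_ofReal] at e
    have : ((e₂ : ℂ) - e₁) * b x₁ x₂ = 0 := by linear_combination e
    rcases mul_eq_zero.1 this with h | h
    · left
      exact_mod_cast (sub_eq_zero.1 h).symm
    · exact Or.inr h
  have key : ∀ c₁ c₂ : ℂ, (q (c₁ • x₁ + c₂ • x₂) (c₁ • x₁ + c₂ • x₂)).re
      ≤ r * (b (c₁ • x₁ + c₂ • x₂) (c₁ • x₁ + c₂ • x₂)).re := by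
    intro c₁ c₂
    rcases horth with h | h
    · have : q (c₁ • x₁ + c₂ • x₂) (c₁ • x₁ + c₂ • x₂)
          = e₁ * b (c₁ • x₁ + c₂ • x₂) (c₁ • x₁ + c₂ • x₂) := by
        rw [hq.add_left, hq.smul_left, hq.smul_left, h₁, h₂, hb.add_left, hb.smul_left,
          hb.smul_left, h]
        ring
      rw [this, Complex.re_ofReal_mul]
      exact mul_le_mul_of_nonneg_right hr₁ (hb0 _)
    · have hq0 : q x₁ x₂ = 0 := by rw [h₁, h, mul_zero]
      rw [hq.re_add_self, hb.re_add_self, hq.re_smul_self, hq.re_smul_self, hb.re_smul_self,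
        hb.re_smul_self, hq.smul_right, hq.smul_left, hb.smul_right, hb.smul_left, h, hq0, h₁, h₂,
        Complex.re_ofReal_mul, Complex.re_ofReal_mul]
      simp only [mul_zero, Complex.zero_re, add_zero]
      have k1 := mul_le_mul_of_nonneg_right hr₁ (mul_nonneg (sq_nonneg ‖c₁‖) (hb0 x₁))
      have k2 := mul_le_mul_of_nonneg_right hr₂ (mul_nonneg (sq_nonneg ‖c₂‖) (hb0 x₂))
      linarith
  by_cases hℓ : ℓ x₁ = 0
  · refine ⟨(1 : ℂ) • x₁ + (0 : ℂ) • x₂, by simp [hℓ], hind 1 0 (by simp), key 1 0⟩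
  · refine ⟨(-ℓ x₂) • x₁ + ℓ x₁ • x₂, ?_, hind _ _ (Or.inr hℓ), key _ _⟩
    rw [map_add, map_smul, map_smul, smul_eq_mul, smul_eq_mul]
    ring

end IsHermForm

/-! ### Completeness, point evaluation and Poincaré inequalities in `H¹` -/

theorem norm_toLp_sq {f : ℝ → ℂ} (hf : MemLp f 2 ν) : ‖hf.toLp f‖ ^ 2 = ∫ x in Iic 0, ‖f x‖ ^ 2 := by
  rw [← inner_self_eq_norm_sq (𝕜 := ℂ), L2.inner_def, ← integral_re (L2.integrable_inner _ _)]
  refine integral_congr_ae ?_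
  filter_upwards [hf.coeFn_toLp] with x hx
  rw [hx, inner_self_eq_norm_sq]

/-- Completeness of `L²(ℝ⁻)`. -/
theorem exists_L2_limit {s : ℕ → ℝ → ℂ} (hs : ∀ k, MemLp (s k) 2 ν)
    (hc : ∀ ε > 0, ∃ K, ∀ j ≥ K, ∀ l ≥ K, ∫ x in Iic 0, ‖s j x - s l x‖ ^ 2 ≤ ε) :
    ∃ f, MemLp f 2 ν ∧ Tendsto (fun k => ∫ x in Iic 0, ‖s k x - f x‖ ^ 2) atTop (𝓝 0) ∧
      ∃ φ : ℕ → ℕ, StrictMono φ ∧ ∀ᵐ x ∂ν, Tendsto (fun k => s (φ k) x) atTop (𝓝 (f x)) := by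
  have hcs : CauchySeq fun k => (hs k).toLp (s k) := by
    rw [Metric.cauchySeq_iff]
    intro ε hε
    obtain ⟨K, hK⟩ := hc ((ε / 2) ^ 2) (by positivity)
    refine ⟨K, fun j hj l hl => ?_⟩
    rw [dist_eq_norm, ← MemLp.toLp_sub]
    have h1 : ‖((hs j).sub (hs l)).toLp (s j - s l)‖ ^ 2 ≤ (ε / 2) ^ 2 := by
      rw [norm_toLp_sq]; exact hK j hj l hl
    have := abs_le_of_sq_le_sq h1 (by positivity)
    rw [abs_of_nonneg (norm_nonneg _)] at this
    linarith
  obtain ⟨F, hF⟩ := cauchySeq_tendsto_of_complete hcs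
  have hFm : MemLp F 2 ν := Lp.memLp F
  refine ⟨F, hFm, ?_, ?_⟩
  · have h1 : Tendsto (fun k => ‖(hs k).toLp (s k) - F‖ ^ 2) atTop (𝓝 0) := by
      have := (tendsto_iff_norm_sub_tendsto_zero.1 hF).pow 2
      simpa using this
    refine h1.congr fun k => ?_
    conv_lhs => rw [← Lp.toLp_coeFn F hFm, ← MemLp.toLp_sub, norm_toLp_sq]
    rfl
  · have h1 := tendstoInMeasure_of_tendsto_Lp hF
    obtain ⟨φ, hφ, h2⟩ := h1.exists_seq_tendsto_ae
    refine ⟨φ, hφ, ?_⟩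
    have h3 : ∀ᵐ x ∂ν, ∀ k, ((hs k).toLp (s k)) x = s k x :=
      ae_all_iff.2 fun k => (hs k).coeFn_toLp
    filter_upwards [h2, h3] with x hx hx3
    simpa [hx3] using hx

theorem integrable_norm_sq {f : ℝ → ℂ} (hf : MemLp f 2 ν) :
    IntegrableOn (fun x => ‖f x‖ ^ 2) (Iic 0) :=
  hf.integrable_norm_pow (by norm_num)

theorem MemLp.norm_integral_sq_le {g : ℝ → ℂ} (hg : MemLp g 2 ν) {a b : ℝ} (hab : a ≤ b)
    (hb : b ≤ 0) : ‖∫ s in a..b, g s‖ ^ 2 ≤ (b - a) * ∫ x in Ioc a b, ‖g x‖ ^ 2 := by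
  have h1 := intervalIntegral.norm_integral_le_integral_norm (f := g) (μ := volume) hab
  rw [intervalIntegral.integral_of_le (f := fun x => ‖g x‖) hab] at h1
  have hg' : MemLp (fun x => ‖g x‖) 2 (volume.restrict (Ioc a b)) :=
    (hg.mono_measure (Measure.restrict_mono (fun x hx => hx.2.trans hb) le_rfl)).norm
  have h1' : MemLp (fun _ : ℝ => (1 : ℝ)) 2 (volume.restrict (Ioc a b)) := memLp_const 1
  have hcs := integral_mul_le_Lp_mul_Lq_of_nonneg (μ := volume.restrict (Ioc a b))
    (p := 2) (q := 2) ⟨by norm_num, by norm_num, by norm_num⟩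
    (f := fun _ => (1 : ℝ)) (g := fun x => ‖g x‖)
    (Eventually.of_forall fun _ => zero_le_one)
    (Eventually.of_forall fun _ => norm_nonneg _) (by simpa using h1') (by simpa using hg')
  simp only [one_mul, Real.rpow_two, one_pow, integral_const, smul_eq_mul, mul_one] at hcs
  have hI : 0 ≤ ∫ x in Ioc a b, ‖g x‖ ^ 2 := integral_nonneg fun x => sq_nonneg _
  have hv : (volume.restrict (Ioc a b)).real univ = b - a := by
    simp [measureReal_def, hab]
  rw [hv, ← Real.sqrt_eq_rpow, ← Real.sqrt_eq_rpow, ← Real.sqrt_mul (by linarith)] at hcs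
  calc _ ≤ Real.sqrt ((b - a) * ∫ x in Ioc a b, ‖g x‖ ^ 2) ^ 2 :=
        pow_le_pow_left₀ (norm_nonneg _) (h1.trans hcs) 2
    _ = _ := Real.sq_sqrt (mul_nonneg (by linarith) hI)

namespace IsH1

variable {u g v w : ℝ → ℂ}

theorem add (h : IsH1 u g) (h' : IsH1 v w) : IsH1 (u + v) (g + w) := by
  refine ⟨h.memLp.add h'.memLp, h.memLp_deriv.add h'.memLp_deriv, fun a b hab hb => ?_⟩
  simp only [Pi.add_apply]
  rw [intervalIntegral.integral_add
    (MemLp.intervalIntegrable h.memLp_deriv (hab.trans hb) hb)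
    (MemLp.intervalIntegrable h'.memLp_deriv (hab.trans hb) hb), h.integral_eq a b hab hb,
    h'.integral_eq a b hab hb]
  ring

theorem smul (h : IsH1 u g) (c : ℂ) : IsH1 (c • u) (c • g) := by
  refine ⟨h.memLp.const_smul c, h.memLp_deriv.const_smul c, fun a b hab hb => ?_⟩
  simp only [Pi.smul_apply]
  rw [intervalIntegral.integral_smul, h.integral_eq a b hab hb, smul_sub]

theorem zero : IsH1 0 0 :=
  ⟨MemLp.zero, MemLp.zero, fun a b _ _ => by simp⟩

/-- `‖u‖²` at `b` is the integral of its derivative over `(-∞, b]`, and `2‖u‖‖g‖ ≤ ‖u‖² + ‖g‖²`.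
Point evaluations are thus continuous on `H¹`, uniformly in the point. -/
theorem norm_sq_le (h : IsH1 u g) {b : ℝ} (hb : b ≤ 0) :
    ‖u b‖ ^ 2 ≤ (∫ x in Iic 0, ‖u x‖ ^ 2) + ∫ x in Iic 0, ‖g x‖ ^ 2 := by
  have hsub : Iic b ⊆ Iic (0 : ℝ) := Iic_subset_Iic.2 hb
  have h1 := integral_by_parts h h hb
  rw [Complex.mul_conj, Complex.normSq_eq_norm_sq] at h1
  have hint : IntegrableOn (fun x => g x * conj (u x) + u x * conj (g x)) (Iic b) :=
    IntegrableOn.mono_set (t := Iic 0) ((integrable_mul_conj h.memLp_deriv h.memLp).add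
      (integrable_mul_conj h.memLp h.memLp_deriv)) hsub
  have h2 : ‖u b‖ ^ 2 = ‖∫ x in Iic b, (g x * conj (u x) + u x * conj (g x))‖ := by
    rw [h1, Complex.norm_real, Real.norm_of_nonneg (by positivity)]
  rw [h2, ← integral_add (integrable_norm_sq h.memLp) (integrable_norm_sq h.memLp_deriv)]
  have hI : IntegrableOn (fun x => ‖u x‖ ^ 2 + ‖g x‖ ^ 2) (Iic 0) :=
    (integrable_norm_sq h.memLp).add (integrable_norm_sq h.memLp_deriv)
  calc _ ≤ ∫ x in Iic b, ‖u x‖ ^ 2 + ‖g x‖ ^ 2 := by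
        refine norm_integral_le_of_norm_le (hI.mono_set hsub) (Eventually.of_forall fun x => ?_)
        refine (norm_add_le _ _).trans ?_
        rw [norm_mul, norm_mul, RCLike.norm_conj, RCLike.norm_conj]
        nlinarith [sq_nonneg (‖u x‖ - ‖g x‖)]
    _ ≤ _ := setIntegral_mono_set hI (Eventually.of_forall fun x => by positivity)
        (Eventually.of_forall hsub)

/-- Completeness of `H¹(ℝ⁻)`. -/
theorem exists_limit {u g : ℕ → ℝ → ℂ} (h : ∀ k, IsH1 (u k) (g k))
    (hu : ∀ ε > 0, ∃ K, ∀ j ≥ K, ∀ l ≥ K, ∫ x in Iic 0, ‖u j x - u l x‖ ^ 2 ≤ ε)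
    (hg : ∀ ε > 0, ∃ K, ∀ j ≥ K, ∀ l ≥ K, ∫ x in Iic 0, ‖g j x - g l x‖ ^ 2 ≤ ε) :
    ∃ v w, IsH1 v w ∧ Tendsto (fun k => ∫ x in Iic 0, ‖u k x - v x‖ ^ 2) atTop (𝓝 0) ∧
      Tendsto (fun k => ∫ x in Iic 0, ‖g k x - w x‖ ^ 2) atTop (𝓝 0) := by
  obtain ⟨f, hf, hfl, φ, hφ, hfφ⟩ := exists_L2_limit (fun k => (h k).memLp) hu
  obtain ⟨w, hw, hwl, -⟩ := exists_L2_limit (fun k => (h k).memLp_deriv) hg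
  have hcs : CauchySeq fun k => u k 0 := by
    rw [Metric.cauchySeq_iff]
    intro ε hε
    obtain ⟨K₁, hK₁⟩ := hu (ε ^ 2 / 4) (by positivity)
    obtain ⟨K₂, hK₂⟩ := hg (ε ^ 2 / 4) (by positivity)
    refine ⟨max K₁ K₂, fun j hj l hl => ?_⟩
    have h1 := ((h j).add ((h l).smul (-1))).norm_sq_le le_rfl
    simp only [Pi.add_apply, Pi.smul_apply, smul_eq_mul, neg_one_mul, ← sub_eq_add_neg] at h1
    have h2 := hK₁ j ((le_max_left _ _).trans hj) l ((le_max_left _ _).trans hl)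
    have h3 := hK₂ j ((le_max_right _ _).trans hj) l ((le_max_right _ _).trans hl)
    rw [dist_eq_norm]
    refine lt_of_pow_lt_pow_left₀ 2 hε.le ?_
    have : 0 < ε ^ 2 := by positivity
    linarith
  obtain ⟨c, hc⟩ := cauchySeq_tendsto_of_complete hcs
  -- The `L²` limit is only defined almost everywhere. Its continuous representative is rebuilt from
  -- the limit `c` of the values at `0` and the limit `w` of the derivatives.
  have hlim : ∀ a ≤ 0, Tendsto (fun k => u k a) atTop (𝓝 (c - ∫ s in a..0, w s)) := by
    intro a ha
    have h1 : ∀ k, u k a = u k 0 - ∫ s in a..0, g k s := by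
      intro k; rw [(h k).integral_eq a 0 ha le_rfl]; ring
    simp_rw [h1]
    refine hc.sub ?_
    rw [tendsto_iff_norm_sub_tendsto_zero]
    have h2 : ∀ k, ‖(∫ s in a..0, g k s) - ∫ s in a..0, w s‖ ≤
        Real.sqrt ((0 - a) * ∫ x in Iic 0, ‖g k x - w x‖ ^ 2) := by
      intro k
      have hgw := (h k).memLp_deriv.sub hw
      rw [← intervalIntegral.integral_sub
        (MemLp.intervalIntegrable (h k).memLp_deriv ha le_rfl)
        (MemLp.intervalIntegrable hw ha le_rfl)]
      refine Real.le_sqrt_of_sq_le ((MemLp.norm_integral_sq_le hgw ha le_rfl).trans ?_)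
      refine mul_le_mul_of_nonneg_left ?_ (by linarith)
      exact setIntegral_mono_set (integrable_norm_sq hgw)
        (Eventually.of_forall fun x => sq_nonneg _) (Eventually.of_forall fun x hx => hx.2)
    refine squeeze_zero (fun _ => norm_nonneg _) h2 ?_
    have h3 := hwl.const_mul (0 - a)
    rw [mul_zero] at h3
    have h4 := (Real.continuous_sqrt.tendsto 0).comp h3
    rw [Real.sqrt_zero] at h4
    exact h4
  have hae : (fun a => c - ∫ s in a..0, w s) =ᵐ[ν] f := by
    filter_upwards [hfφ, ae_restrict_mem measurableSet_Iic] with x hx hx0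
    exact tendsto_nhds_unique ((hlim x hx0).comp hφ.tendsto_atTop) hx
  refine ⟨fun a => c - ∫ s in a..0, w s, w, ⟨hf.ae_eq hae.symm, hw, ?_⟩, ?_, hwl⟩
  · intro a b hab hb
    have := intervalIntegral.integral_add_adjacent_intervals
      (MemLp.intervalIntegrable hw (hab.trans hb) hb) (MemLp.intervalIntegrable hw hb le_rfl)
    rw [← this]
    ring
  · refine hfl.congr fun k => integral_congr_ae ?_
    filter_upwards [hae] with x hx
    rw [hx]

theorem intervalIntegrable_norm_sq {f : ℝ → ℂ} (hf : MemLp f 2 ν) {a b : ℝ} (hab : a ≤ b)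
    (hb : b ≤ 0) : IntervalIntegrable (fun x => ‖f x‖ ^ 2) volume a b := by
  rw [intervalIntegrable_iff_integrableOn_Ioc_of_le hab]
  exact (integrable_norm_sq hf).mono_set fun x hx => hx.2.trans hb

/-- By Cauchy–Schwarz, `u` moves away from its left end value by at most `√(b - a)` times the `L²`
norm of `g`. -/
theorem interval_norm_sq_le (h : IsH1 u g) {a b : ℝ} (hab : a ≤ b) (hb : b ≤ 0) :
    ∫ x in a..b, ‖u x‖ ^ 2 ≤
      2 * (b - a) ^ 2 * (∫ x in a..b, ‖g x‖ ^ 2) + 2 * (b - a) * ‖u a‖ ^ 2 := by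
  have hpt : ∀ x ∈ Icc a b, ‖u x‖ ^ 2 ≤
      2 * ‖u a‖ ^ 2 + 2 * ((b - a) * ∫ x in a..b, ‖g x‖ ^ 2) := by
    intro x hx
    have e : u x = u a + ∫ s in a..x, g s := by
      rw [h.integral_eq a x hx.1 (hx.2.trans hb)]; ring
    have h1 := MemLp.norm_integral_sq_le h.memLp_deriv hx.1 (hx.2.trans hb)
    have h2 : (x - a) * ∫ x in Ioc a x, ‖g x‖ ^ 2 ≤ (b - a) * ∫ x in a..b, ‖g x‖ ^ 2 := by
      rw [intervalIntegral.integral_of_le hab]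
      refine mul_le_mul (by linarith [hx.2]) ?_ (integral_nonneg fun x => sq_nonneg _)
        (by linarith)
      exact setIntegral_mono_set
        ((integrable_norm_sq h.memLp_deriv).mono_set fun x hx => hx.2.trans hb)
        (Eventually.of_forall fun x => sq_nonneg _)
        (Eventually.of_forall (Ioc_subset_Ioc_right hx.2))
    have h3 : ‖u x‖ ^ 2 ≤ (‖u a‖ + ‖∫ s in a..x, g s‖) ^ 2 := by
      rw [e]; exact pow_le_pow_left₀ (norm_nonneg _) (norm_add_le _ _) 2
    nlinarith [sq_nonneg (‖u a‖ - ‖∫ s in a..x, g s‖)]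
  have h1 := intervalIntegral.integral_mono_on hab (intervalIntegrable_norm_sq h.memLp hab hb)
    intervalIntegrable_const hpt
  rw [intervalIntegral.integral_const, smul_eq_mul] at h1
  linarith

/-- A Poincaré inequality on `[a, 0]` with the values on a grid. -/
theorem grid_norm_sq_le (h : IsH1 u g) {a δ : ℝ} (hδ : 0 ≤ δ) {k : ℕ} (hk : a + k * δ = 0) :
    ∫ x in a..0, ‖u x‖ ^ 2 ≤
      2 * δ ^ 2 * (∫ x in a..0, ‖g x‖ ^ 2) + 2 * δ * ∑ j ∈ Finset.range k, ‖u (a + j * δ)‖ ^ 2 := by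
  have hle : ∀ j < k, a + ((j : ℕ) + 1 : ℕ) * δ ≤ 0 := by
    intro j hj
    rw [← hk]
    gcongr
    exact hj
  have hmono : ∀ j : ℕ, a + j * δ ≤ a + ((j + 1 : ℕ) : ℝ) * δ := by
    intro j; gcongr; simp
  have e1 := intervalIntegral.sum_integral_adjacent_intervals (n := k)
    (a := fun j : ℕ => a + j * δ) (f := fun x => ‖u x‖ ^ 2) (μ := volume)
    (fun j hj => intervalIntegrable_norm_sq h.memLp (hmono j) (hle j hj))
  have e2 := intervalIntegral.sum_integral_adjacent_intervals (n := k)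
    (a := fun j : ℕ => a + j * δ) (f := fun x => ‖g x‖ ^ 2) (μ := volume)
    (fun j hj => intervalIntegrable_norm_sq h.memLp_deriv (hmono j) (hle j hj))
  simp only [hk, Nat.cast_zero, zero_mul, add_zero] at e1 e2
  rw [← e1, ← e2, Finset.mul_sum, Finset.mul_sum, ← Finset.sum_add_distrib]
  refine Finset.sum_le_sum fun j hj => ?_
  have h1 := h.interval_norm_sq_le (hmono j) (hle j (Finset.mem_range.1 hj))
  have e : a + ((j + 1 : ℕ) : ℝ) * δ - (a + j * δ) = δ := by push_cast; ring
  rwa [e] at h1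

end IsH1

/-! ### Weighted products, the form domain and the quadratic forms -/

/-- Bounded measurable weights on the half-line. -/
structure IsWeight (w : ℝ → ℝ) : Prop where
  aestronglyMeasurable : AEStronglyMeasurable w ν
  bound : ∃ C, ∀ Z ≤ 0, |w Z| ≤ C

theorem IsWeight.one : IsWeight fun _ => 1 :=
  ⟨aestronglyMeasurable_const, 1, fun _ _ => by simp⟩

theorem IsWeight.integrable_mul {w : ℝ → ℝ} (hw : IsWeight w) {f : ℝ → ℂ}
    (hf : IntegrableOn f (Iic 0)) : IntegrableOn (fun x => (w x : ℂ) * f x) (Iic 0) := by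
  obtain ⟨C, hC⟩ := hw.bound
  refine Integrable.bdd_mul (c := C) hf
    (Complex.continuous_ofReal.comp_aestronglyMeasurable hw.aestronglyMeasurable) ?_
  filter_upwards [ae_restrict_mem measurableSet_Iic] with x hx
  simpa using hC x hx

theorem IsWeight.integrable_mul_real {w : ℝ → ℝ} (hw : IsWeight w) {f : ℝ → ℝ}
    (hf : IntegrableOn f (Iic 0)) : IntegrableOn (fun x => w x * f x) (Iic 0) := by
  obtain ⟨C, hC⟩ := hw.bound
  refine Integrable.bdd_mul (c := C) hf hw.aestronglyMeasurable ?_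
  filter_upwards [ae_restrict_mem measurableSet_Iic] with x hx
  simpa using hC x hx

theorem IsWeight.memLp_mul {w : ℝ → ℝ} (hw : IsWeight w) {f : ℝ → ℂ}
    (hf : MemLp f 2 ν) : MemLp (fun x => (w x : ℂ) * f x) 2 ν := by
  obtain ⟨C, hC⟩ := hw.bound
  refine MemLp.of_le_mul (c := C) hf
    ((Complex.continuous_ofReal.comp_aestronglyMeasurable hw.aestronglyMeasurable).mul
      hf.aestronglyMeasurable) ?_
  filter_upwards [ae_restrict_mem measurableSet_Iic] with x hx
  rw [norm_mul, Complex.norm_real, Real.norm_eq_abs]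
  exact mul_le_mul_of_nonneg_right (hC x hx) (norm_nonneg _)

/-- The weighted `L²(ℝ⁻)` product. -/
def weightedInner (w : ℝ → ℝ) (f g : ℝ → ℂ) : ℂ := ∫ x in Iic 0, (w x : ℂ) * (conj (f x) * g x)

section

variable {E : Type*} [AddCommGroup E] [Module ℂ E] {w : ℝ → ℝ} {L : E →ₗ[ℂ] (ℝ → ℂ)}

theorem IsWeight.integrable_conj_mul (hw : IsWeight w) {f g : ℝ → ℂ} (hf : MemLp f 2 ν)
    (hg : MemLp g 2 ν) : IntegrableOn (fun x => (w x : ℂ) * (conj (f x) * g x)) (Iic 0) := by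
  refine hw.integrable_mul ?_
  have := IsH1.integrable_mul_conj hg hf
  simp_rw [mul_comm (conj (f _))]
  exact this

theorem IsWeight.isHermForm (hw : IsWeight w) (hL : ∀ x, MemLp (L x) 2 ν) :
    IsHermForm fun x y => weightedInner w (L x) (L y) := by
  refine ⟨fun x y z => ?_, fun c x y => ?_, fun x y => ?_⟩
  · simp only [weightedInner]
    rw [← integral_add (hw.integrable_conj_mul (hL x) (hL y))
      (hw.integrable_conj_mul (hL x) (hL z))]
    congr 1 with Z
    rw [map_add, Pi.add_apply]; ring
  · simp only [weightedInner]
    rw [← integral_const_mul]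
    congr 1 with Z
    rw [map_smul, Pi.smul_apply, smul_eq_mul]; ring
  · simp only [weightedInner]
    rw [← integral_conj]
    congr 1 with Z
    simp only [map_mul, Complex.conj_ofReal, Complex.conj_conj]
    ring

theorem weightedInner_self_re (w : ℝ → ℝ) (f : ℝ → ℂ) :
    (weightedInner w f f).re = ∫ x in Iic 0, w x * ‖f x‖ ^ 2 := by
  have : weightedInner w f f = ((∫ x in Iic 0, w x * ‖f x‖ ^ 2 : ℝ) : ℂ) := by
    rw [weightedInner, ← integral_complex_ofReal]
    congr 1 with Z
    rw [mul_comm (conj (f Z)), Complex.mul_conj, Complex.normSq_eq_norm_sq]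
    push_cast; ring
  rw [this, Complex.ofReal_re]

end

/-- The form domain `H¹(ℝ⁻; ℂ²)`. An element is `((φ₂, φ₂'), (φ₃, φ₃'))`. -/
def FormSpace : Submodule ℂ (((ℝ → ℂ) × (ℝ → ℂ)) × ((ℝ → ℂ) × (ℝ → ℂ))) where
  carrier := {p | IsH1 p.1.1 p.1.2 ∧ IsH1 p.2.1 p.2.2}
  add_mem' := fun ha hb => ⟨ha.1.add hb.1, ha.2.add hb.2⟩
  zero_mem' := ⟨IsH1.zero, IsH1.zero⟩
  smul_mem' := fun c _ ha => ⟨ha.1.smul c, ha.2.smul c⟩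

namespace FormSpace

/-- The component `φ₂`. -/
def U₂ : FormSpace →ₗ[ℂ] (ℝ → ℂ) where
  toFun x := x.1.1.1
  map_add' _ _ := rfl
  map_smul' _ _ := rfl

/-- The derivative of `φ₂`. -/
def G₂ : FormSpace →ₗ[ℂ] (ℝ → ℂ) where
  toFun x := x.1.1.2
  map_add' _ _ := rfl
  map_smul' _ _ := rfl

/-- The component `φ₃`. -/
def U₃ : FormSpace →ₗ[ℂ] (ℝ → ℂ) where
  toFun x := x.1.2.1
  map_add' _ _ := rfl
  map_smul' _ _ := rfl

/-- The derivative of `φ₃`. -/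
def G₃ : FormSpace →ₗ[ℂ] (ℝ → ℂ) where
  toFun x := x.1.2.2
  map_add' _ _ := rfl
  map_smul' _ _ := rfl

theorem isH1_fst (x : FormSpace) : IsH1 (U₂ x) (G₂ x) := x.2.1

theorem isH1_snd (x : FormSpace) : IsH1 (U₃ x) (G₃ x) := x.2.2

theorem memLp_U₂ (x : FormSpace) : MemLp (U₂ x) 2 ν := (isH1_fst x).memLp

theorem memLp_G₂ (x : FormSpace) : MemLp (G₂ x) 2 ν := (isH1_fst x).memLp_deriv

theorem memLp_U₃ (x : FormSpace) : MemLp (U₃ x) 2 ν := (isH1_snd x).memLp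

theorem memLp_G₃ (x : FormSpace) : MemLp (G₃ x) 2 ν := (isH1_snd x).memLp_deriv

/-- The shear strain `h φ₂' + i φ₃`. -/
def shear (h : ℝ) : FormSpace →ₗ[ℂ] (ℝ → ℂ) := (h : ℂ) • G₂ + Complex.I • U₃

/-- The divergence `h φ₃' + i φ₂`. -/
def div (h : ℝ) : FormSpace →ₗ[ℂ] (ℝ → ℂ) := (h : ℂ) • G₃ + Complex.I • U₂

theorem shear_apply (h : ℝ) (x : FormSpace) (Z : ℝ) :
    shear h x Z = h * G₂ x Z + Complex.I * U₃ x Z := rfl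

theorem div_apply (h : ℝ) (x : FormSpace) (Z : ℝ) :
    div h x Z = h * G₃ x Z + Complex.I * U₂ x Z := rfl

theorem memLp_shear (h : ℝ) (x : FormSpace) : MemLp (shear h x) 2 ν :=
  ((memLp_G₂ x).const_smul (h : ℂ)).add ((memLp_U₃ x).const_smul Complex.I)

theorem memLp_div (h : ℝ) (x : FormSpace) : MemLp (div h x) 2 ν :=
  ((memLp_G₃ x).const_smul (h : ℂ)).add ((memLp_U₂ x).const_smul Complex.I)

/-- The quadratic form of the Rayleigh operator. -/
def energy (μ lam : ℝ → ℝ) (h : ℝ) (x y : FormSpace) : ℂ :=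
  weightedInner μ (shear h x) (shear h y) + weightedInner lam (div h x) (div h y)
    + ((2 * h ^ 2 : ℝ) : ℂ) * weightedInner μ (G₃ x) (G₃ y)
    + ((2 : ℝ) : ℂ) * weightedInner μ (U₂ x) (U₂ y)

/-- The `L²` inner product. -/
def mass (x y : FormSpace) : ℂ :=
  weightedInner (fun _ => 1) (U₂ x) (U₂ y) + weightedInner (fun _ => 1) (U₃ x) (U₃ y)

/-- The `H¹` inner product. -/
def sobolev (x y : FormSpace) : ℂ :=
  mass x y + weightedInner (fun _ => 1) (G₂ x) (G₂ y) + weightedInner (fun _ => 1) (G₃ x) (G₃ y)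

/-- The `L²` density. -/
def massDensity (x : FormSpace) (Z : ℝ) : ℝ := ‖U₂ x Z‖ ^ 2 + ‖U₃ x Z‖ ^ 2

/-- The `L²` density of the derivative. -/
def gradDensity (x : FormSpace) (Z : ℝ) : ℝ := ‖G₂ x Z‖ ^ 2 + ‖G₃ x Z‖ ^ 2

/-- The energy density. -/
def energyDensity (μ lam : ℝ → ℝ) (h : ℝ) (x : FormSpace) (Z : ℝ) : ℝ :=
  μ Z * ‖shear h x Z‖ ^ 2 + lam Z * ‖div h x Z‖ ^ 2 + 2 * h ^ 2 * (μ Z * ‖G₃ x Z‖ ^ 2)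
    + 2 * (μ Z * ‖U₂ x Z‖ ^ 2)

theorem integrable_massDensity (x : FormSpace) : IntegrableOn (massDensity x) (Iic 0) :=
  (integrable_norm_sq (memLp_U₂ x)).add (integrable_norm_sq (memLp_U₃ x))

theorem integrable_gradDensity (x : FormSpace) : IntegrableOn (gradDensity x) (Iic 0) :=
  (integrable_norm_sq (memLp_G₂ x)).add (integrable_norm_sq (memLp_G₃ x))

theorem massDensity_nonneg (x : FormSpace) (Z : ℝ) : 0 ≤ massDensity x Z := by
  unfold massDensity; positivity

theorem gradDensity_nonneg (x : FormSpace) (Z : ℝ) : 0 ≤ gradDensity x Z := by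
  unfold gradDensity; positivity

section

variable {μ lam : ℝ → ℝ}

theorem integrable_energyDensity (hμ : IsWeight μ) (hlam : IsWeight lam) (h : ℝ)
    (x : FormSpace) : IntegrableOn (energyDensity μ lam h x) (Iic 0) :=
  (((hμ.integrable_mul_real (integrable_norm_sq (memLp_shear h x))).add
    (hlam.integrable_mul_real (integrable_norm_sq (memLp_div h x)))).add
    ((hμ.integrable_mul_real (integrable_norm_sq (memLp_G₃ x))).const_mul _)).add
    ((hμ.integrable_mul_real (integrable_norm_sq (memLp_U₂ x))).const_mul _)

theorem energy_re (hμ : IsWeight μ) (hlam : IsWeight lam) (h : ℝ) (x : FormSpace) :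
    (energy μ lam h x x).re = ∫ Z in Iic 0, energyDensity μ lam h x Z := by
  have i1 := hμ.integrable_mul_real (integrable_norm_sq (memLp_shear h x))
  have i2 := hlam.integrable_mul_real (integrable_norm_sq (memLp_div h x))
  have i3 := (hμ.integrable_mul_real (integrable_norm_sq (memLp_G₃ x))).const_mul (2 * h ^ 2)
  have i4 := (hμ.integrable_mul_real (integrable_norm_sq (memLp_U₂ x))).const_mul 2
  have e2 := integral_add (i1.add i2) i3
  have e3 := integral_add ((i1.add i2).add i3) i4
  simp only [Pi.add_apply] at e2 e3
  unfold energy energyDensity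
  rw [Complex.add_re, Complex.add_re, Complex.add_re, Complex.re_ofReal_mul,
    Complex.re_ofReal_mul, weightedInner_self_re, weightedInner_self_re, weightedInner_self_re,
    weightedInner_self_re, e3, e2, integral_add i1 i2, integral_const_mul, integral_const_mul]

theorem mass_re (x : FormSpace) : (mass x x).re = ∫ Z in Iic 0, massDensity x Z := by
  unfold mass massDensity
  rw [Complex.add_re, weightedInner_self_re, weightedInner_self_re,
    integral_add (integrable_norm_sq (memLp_U₂ x)) (integrable_norm_sq (memLp_U₃ x))]
  simp only [one_mul]

theorem sobolev_re (x : FormSpace) :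
    (sobolev x x).re = (∫ Z in Iic 0, massDensity x Z) + ∫ Z in Iic 0, gradDensity x Z := by
  unfold sobolev gradDensity
  rw [Complex.add_re, Complex.add_re, mass_re, weightedInner_self_re, weightedInner_self_re,
    integral_add (integrable_norm_sq (memLp_G₂ x)) (integrable_norm_sq (memLp_G₃ x))]
  simp only [one_mul]
  ring

theorem isHermForm_energy (hμ : IsWeight μ) (hlam : IsWeight lam) (h : ℝ) :
    IsHermForm (energy μ lam h) :=
  (((hμ.isHermForm (memLp_shear h)).add (hlam.isHermForm (memLp_div h))).add
    ((hμ.isHermForm memLp_G₃).real_mul _)).add ((hμ.isHermForm memLp_U₂).real_mul _)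

theorem isHermForm_mass : IsHermForm mass :=
  (IsWeight.one.isHermForm memLp_U₂).add (IsWeight.one.isHermForm memLp_U₃)

theorem mass_nonneg (x : FormSpace) : 0 ≤ (mass x x).re := by
  rw [mass_re]; exact integral_nonneg (massDensity_nonneg x)

theorem integral_gradDensity_nonneg (x : FormSpace) : 0 ≤ ∫ Z in Iic 0, gradDensity x Z :=
  integral_nonneg (gradDensity_nonneg x)

theorem sobolev_nonneg (x : FormSpace) : 0 ≤ (sobolev x x).re := by
  rw [sobolev_re, ← mass_re]; exact add_nonneg (mass_nonneg x) (integral_gradDensity_nonneg x)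

theorem mass_le_sobolev (x : FormSpace) : (mass x x).re ≤ (sobolev x x).re := by
  rw [sobolev_re, ← mass_re]; linarith [(integral_gradDensity_nonneg x)]

theorem exists_sobolev_limit (s : ℕ → FormSpace)
    (hs : ∀ ε > 0, ∃ K, ∀ j ≥ K, ∀ l ≥ K, (sobolev (s j - s l) (s j - s l)).re ≤ ε) :
    ∃ x, Tendsto (fun k => (sobolev (s k - x) (s k - x)).re) atTop (𝓝 0) := by
  have hsplit : ∀ x : FormSpace, (sobolev x x).re = (∫ Z in Iic 0, ‖U₂ x Z‖ ^ 2)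
      + (∫ Z in Iic 0, ‖U₃ x Z‖ ^ 2) + (∫ Z in Iic 0, ‖G₂ x Z‖ ^ 2)
      + ∫ Z in Iic 0, ‖G₃ x Z‖ ^ 2 := by
    intro x
    simp only [sobolev, mass, Complex.add_re, weightedInner_self_re, one_mul]
  have hnn : ∀ f : ℝ → ℂ, 0 ≤ ∫ Z in Iic 0, ‖f Z‖ ^ 2 :=
    fun f => integral_nonneg fun Z => by positivity
  obtain ⟨v, w, h1, hv, hw⟩ := IsH1.exists_limit (fun k => isH1_fst (s k))
    (fun ε hε => (hs ε hε).imp fun K hK j hj l hl => by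
      have := hK j hj l hl
      rw [hsplit] at this
      have e : ∫ x in Iic 0, ‖U₂ (s j) x - U₂ (s l) x‖ ^ 2
        = ∫ x in Iic 0, ‖U₂ (s j - s l) x‖ ^ 2 := rfl
      rw [e]
      linarith [hnn (U₃ (s j - s l)), hnn (G₂ (s j - s l)), hnn (G₃ (s j - s l))])
    (fun ε hε => (hs ε hε).imp fun K hK j hj l hl => by
      have := hK j hj l hl
      rw [hsplit] at this
      have e : ∫ x in Iic 0, ‖G₂ (s j) x - G₂ (s l) x‖ ^ 2
        = ∫ x in Iic 0, ‖G₂ (s j - s l) x‖ ^ 2 := rfl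
      rw [e]
      linarith [hnn (U₃ (s j - s l)), hnn (U₂ (s j - s l)), hnn (G₃ (s j - s l))])
  obtain ⟨v', w', h1', hv', hw'⟩ := IsH1.exists_limit (fun k => isH1_snd (s k))
    (fun ε hε => (hs ε hε).imp fun K hK j hj l hl => by
      have := hK j hj l hl
      rw [hsplit] at this
      have e : ∫ x in Iic 0, ‖U₃ (s j) x - U₃ (s l) x‖ ^ 2
        = ∫ x in Iic 0, ‖U₃ (s j - s l) x‖ ^ 2 := rfl
      rw [e]
      linarith [hnn (U₂ (s j - s l)), hnn (G₂ (s j - s l)), hnn (G₃ (s j - s l))])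
    (fun ε hε => (hs ε hε).imp fun K hK j hj l hl => by
      have := hK j hj l hl
      rw [hsplit] at this
      have e : ∫ x in Iic 0, ‖G₃ (s j) x - G₃ (s l) x‖ ^ 2
        = ∫ x in Iic 0, ‖G₃ (s j - s l) x‖ ^ 2 := rfl
      rw [e]
      linarith [hnn (U₃ (s j - s l)), hnn (U₂ (s j - s l)), hnn (G₂ (s j - s l))])
  refine ⟨⟨((v, w), (v', w')), h1, h1'⟩, ?_⟩
  simp_rw [hsplit]
  have := ((hv.add hv').add hw).add hw'
  simp only [add_zero] at this
  exact this

end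

end FormSpace

/-! ### Bounds on the profile and multiplication by its coefficients -/

theorem isWeight_of_eventually_const {f : ℝ → ℝ} {a : ℝ}
    (hc : ContinuousOn f (Iic 0)) {c : ℝ} (h : ∀ Z < a, f Z = c) : IsWeight f := by
  refine ⟨hc.aestronglyMeasurable measurableSet_Iic, ?_⟩
  obtain ⟨C, hC⟩ := (isCompact_Icc (a := a) (b := 0)).exists_bound_of_continuousOn
    (hc.mono fun x hx => hx.2)
  refine ⟨max C |c|, fun Z hZ => ?_⟩
  rcases lt_or_ge Z a with h1 | h1
  · rw [h Z h1]; exact le_max_right _ _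
  · exact (hC Z ⟨h1, hZ⟩).trans (le_max_left _ _)

theorem hasDerivWithinAt_of_contDiffOn {f : ℝ → ℝ} (hf : ContDiffOn ℝ ∞ f (Iic 0)) {Z : ℝ}
    (hZ : Z ≤ 0) : HasDerivWithinAt f (derivWithin f (Iic 0) Z) (Iic 0) Z :=
  ((hf.differentiableOn (by simp)) Z hZ).hasDerivWithinAt

theorem isWeight_derivWithin {f : ℝ → ℝ} {a : ℝ} (ha : a < 0)
    (hf : ContDiffOn ℝ ∞ f (Iic 0)) (h : ∀ Z ≤ a, f Z = f a) :
    IsWeight (derivWithin f (Iic 0)) := by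
  refine isWeight_of_eventually_const (a := a)
    (hf.continuousOn_derivWithin (uniqueDiffOn_Iic 0) (by simp)) (c := 0) fun Z hZ => ?_
  rw [derivWithin_of_mem_nhds (Iic_mem_nhds (hZ.trans ha))]
  have : f =ᶠ[𝓝 Z] fun _ => f a := by
    filter_upwards [Iio_mem_nhds hZ] with x hx using h x (le_of_lt hx)
  rw [this.deriv_eq, deriv_const]

namespace Profile

variable {μ lam : ℝ → ℝ} {ZI : ℝ}

theorem mu_ge (p : Profile μ lam ZI) {Z : ℝ} (hZ : Z ≤ 0) : μ 0 ≤ μ Z :=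
  p.mu_min.2 ⟨Z, hZ, rfl⟩

theorem lam_add_two_mu_ge (p : Profile μ lam ZI) {Z : ℝ} (hZ : Z ≤ 0) :
    μ ZI ≤ lam Z + 2 * μ Z := by
  rcases le_total ZI Z with h | h
  · exact p.lam_add Z ⟨h, hZ⟩
  · rw [p.mu_const Z h, p.lam_const Z h]
    exact p.lam_add ZI ⟨le_rfl, p.ZI_neg.le⟩

theorem isWeight_mu (p : Profile μ lam ZI) : IsWeight μ :=
  isWeight_of_eventually_const p.smooth_mu.continuousOn fun Z hZ => p.mu_const Z hZ.le

theorem isWeight_lam (p : Profile μ lam ZI) : IsWeight lam :=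
  isWeight_of_eventually_const p.smooth_lam.continuousOn fun Z hZ => p.lam_const Z hZ.le

theorem isWeight_deriv_mu (p : Profile μ lam ZI) : IsWeight (derivWithin μ (Iic 0)) :=
  isWeight_derivWithin p.ZI_neg p.smooth_mu p.mu_const

end Profile

/-- `H¹(ℝ⁻)` is closed under multiplication by bounded smooth functions with bounded derivative. -/
theorem IsH1.weight_mul {u g : ℝ → ℂ} (h : IsH1 u g) {ρ : ℝ → ℝ} (hs : ContDiffOn ℝ ∞ ρ (Iic 0))
    (hρ : IsWeight ρ) (hρ' : IsWeight (derivWithin ρ (Iic 0))) :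
    IsH1 (fun Z => (ρ Z : ℂ) * u Z)
      (fun Z => ((derivWithin ρ (Iic 0) Z : ℝ) : ℂ) * u Z + (ρ Z : ℂ) * g Z) := by
  have hm : MemLp (fun Z => ((derivWithin ρ (Iic 0) Z : ℝ) : ℂ) * u Z + (ρ Z : ℂ) * g Z) 2 ν :=
    (hρ'.memLp_mul h.memLp).add (hρ.memLp_mul h.memLp_deriv)
  refine ⟨hρ.memLp_mul h.memLp, hm, fun a b hab hb => ?_⟩
  have hac : AbsolutelyContinuousOnInterval ρ a b := by
    refine ContDiffOn.absolutelyContinuousOnInterval ((hs.of_le (by simp)).mono ?_)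
    rw [uIcc_of_le hab]
    exact fun x hx => hx.2.trans hb
  have hac2 := (AbsolutelyContinuousOnInterval.ofReal hac).fun_smul
    (h.absolutelyContinuousOnInterval hab hb)
  simp only [smul_eq_mul] at hac2
  refine integral_eq_sub_of_absolutelyContinuousOnInterval
    (f := fun Z => (ρ Z : ℂ) * u Z) hab hac2 ?_
    (MemLp.intervalIntegrable hm (hab.trans hb) hb)
  filter_upwards [h.ae_hasDerivAt] with x hx hxm
  have hx0 : x < 0 := hxm.2.trans_le hb
  have h1 : HasDerivAt ρ (derivWithin ρ (Iic 0) x) x :=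
    (hasDerivWithinAt_of_contDiffOn hs hx0.le).hasDerivAt (Iic_mem_nhds hx0)
  exact h1.ofReal_comp.mul (hx hx0)

/-! ### Divergence-curl identities and lower bounds for the energy -/

/-- Everything without a sign is moved into the last term, which is `μ` times the derivative of `Im
(φ₃ φ̄₂)`. What remains is a sum of squares with weights `λ + 2μ` and `μ`, exactly the quantities
that the hypotheses bound from below. -/
theorem energy_density_identity (μ l h : ℝ) (u₂ g₂ u₃ g₃ : ℂ) :
    μ * ‖h * g₂ + Complex.I * u₃‖ ^ 2 + l * ‖h * g₃ + Complex.I * u₂‖ ^ 2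
      + 2 * h ^ 2 * (μ * ‖g₃‖ ^ 2) + 2 * (μ * ‖u₂‖ ^ 2)
      = (l + 2 * μ) * ‖h * g₃ + Complex.I * u₂‖ ^ 2 + μ * ‖h * g₂ - Complex.I * u₃‖ ^ 2
        - 4 * h * (μ * (g₃ * conj u₂ + u₃ * conj g₂).im) := by
  simp only [Complex.sq_norm, Complex.normSq_apply, Complex.add_re, Complex.add_im,
    Complex.sub_re, Complex.sub_im, Complex.mul_re, Complex.mul_im, Complex.ofReal_re,
    Complex.ofReal_im, Complex.I_re, Complex.I_im, Complex.conj_re, Complex.conj_im]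
  ring

/-- The two squares of the preceding identity control the full `H¹` density, again up to a total
derivative. -/
theorem div_curl_identity (h : ℝ) (u₂ g₂ u₃ g₃ : ℂ) :
    ‖h * g₃ + Complex.I * u₂‖ ^ 2 + ‖h * g₂ - Complex.I * u₃‖ ^ 2
      = (‖u₂‖ ^ 2 + ‖u₃‖ ^ 2) + h ^ 2 * (‖g₂‖ ^ 2 + ‖g₃‖ ^ 2)
        + 2 * h * (g₃ * conj u₂ + u₃ * conj g₂).im := by
  simp only [Complex.sq_norm, Complex.normSq_apply, Complex.add_re, Complex.add_im,
    Complex.sub_re, Complex.sub_im, Complex.mul_re, Complex.mul_im, Complex.ofReal_re,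
    Complex.ofReal_im, Complex.I_re, Complex.I_im, Complex.conj_re, Complex.conj_im]
  ring

namespace FormSpace

/-- The boundary density `Im (φ₃ φ̄₂)`. -/
def bdry (x : FormSpace) (Z : ℝ) : ℝ := (U₃ x Z * conj (U₂ x Z)).im

/-- The derivative of the boundary density. -/
def bdryDeriv (x : FormSpace) (Z : ℝ) : ℝ := (G₃ x Z * conj (U₂ x Z) + U₃ x Z * conj (G₂ x Z)).im

theorem abs_bdry_le (x : FormSpace) (Z : ℝ) : |bdry x Z| ≤ massDensity x Z / 2 := by
  refine (Complex.abs_im_le_norm _).trans ?_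
  rw [norm_mul, RCLike.norm_conj, massDensity]
  nlinarith [sq_nonneg (‖U₃ x Z‖ - ‖U₂ x Z‖)]

theorem integrable_bdry (x : FormSpace) : IntegrableOn (bdry x) (Iic 0) :=
  Integrable.im (IsH1.integrable_mul_conj (memLp_U₃ x) (memLp_U₂ x))

theorem integrable_bdryDeriv (x : FormSpace) : IntegrableOn (bdryDeriv x) (Iic 0) :=
  Integrable.im ((IsH1.integrable_mul_conj (memLp_G₃ x) (memLp_U₂ x)).add
    (IsH1.integrable_mul_conj (memLp_U₃ x) (memLp_G₂ x)))

theorem integral_bdryDeriv (x : FormSpace) {b : ℝ} (hb : b ≤ 0) :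
    ∫ Z in Iic b, bdryDeriv x Z = bdry x b := by
  have h1 := (isH1_snd x).integral_by_parts (isH1_fst x) hb
  have hi : IntegrableOn (fun Z => G₃ x Z * conj (U₂ x Z) + U₃ x Z * conj (G₂ x Z)) (Iic b) :=
    IntegrableOn.mono_set (t := Iic 0) ((IsH1.integrable_mul_conj (memLp_G₃ x) (memLp_U₂ x)).add
      (IsH1.integrable_mul_conj (memLp_U₃ x) (memLp_G₂ x))) (Iic_subset_Iic.2 hb)
  have h2 := congrArg Complex.im h1
  rw [← RCLike.im_eq_complex_im, ← integral_im hi] at h2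
  exact h2

variable {μ lam : ℝ → ℝ} {ZI : ℝ}

/-- Integration by parts trades the derivatives of `φ` for `μ'`. The bulk term left over is bounded
by the mass, so with its factor `h` it costs only `O(h)`. -/
theorem integral_mu_bdryDeriv (p : Profile μ lam ZI) (x : FormSpace) :
    ∫ Z in Iic 0, μ Z * bdryDeriv x Z
      = μ 0 * bdry x 0 - ∫ Z in Iic 0, derivWithin μ (Iic 0) Z * bdry x Z := by
  have h3 := (isH1_snd x).weight_mul p.smooth_mu p.isWeight_mu p.isWeight_deriv_mu
  have h1 := h3.integral_by_parts (isH1_fst x) le_rfl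
  have hi : IntegrableOn (fun Z => (((derivWithin μ (Iic 0) Z : ℝ) : ℂ) * U₃ x Z + (μ Z : ℂ) * G₃ x Z)
      * conj (U₂ x Z) + (μ Z : ℂ) * U₃ x Z * conj (G₂ x Z)) (Iic 0) :=
    (IsH1.integrable_mul_conj h3.memLp_deriv (memLp_U₂ x)).add
      (IsH1.integrable_mul_conj h3.memLp (memLp_G₂ x))
  have h2 := congrArg Complex.im h1
  rw [← RCLike.im_eq_complex_im, ← integral_im hi] at h2
  have e : ∀ Z, RCLike.im ((((derivWithin μ (Iic 0) Z : ℝ) : ℂ) * U₃ x Z + (μ Z : ℂ) * G₃ x Z)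
      * conj (U₂ x Z) + (μ Z : ℂ) * U₃ x Z * conj (G₂ x Z))
      = μ Z * bdryDeriv x Z + derivWithin μ (Iic 0) Z * bdry x Z := by
    intro Z
    rw [RCLike.im_eq_complex_im, bdryDeriv, bdry, ← Complex.im_ofReal_mul,
      ← Complex.im_ofReal_mul, ← Complex.add_im]
    congr 1; ring
  have e0 : RCLike.im ((μ 0 : ℂ) * U₃ x 0 * conj (U₂ x 0)) = μ 0 * bdry x 0 := by
    rw [RCLike.im_eq_complex_im, bdry, ← Complex.im_ofReal_mul, mul_assoc]
  simp_rw [e] at h2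
  rw [e0, integral_add (p.isWeight_mu.integrable_mul_real (integrable_bdryDeriv x))
    (p.isWeight_deriv_mu.integrable_mul_real (integrable_bdry x))] at h2
  linarith

/-- In the divergence-curl form both weights are at least `c`: `μ Z` by `hc`, and `lam Z + 2 * μ Z`
because it is at least `μ ZI`. The cases of interest are `c = μ 0` on the whole half-line and `c = μ
ZI` to the left of `ZI`. -/
theorem energyDensity_ge (p : Profile μ lam ZI) (h : ℝ) (x : FormSpace) {Z c : ℝ} (hZ : Z ≤ 0)
    (hc : c ≤ μ Z) (hc' : c ≤ μ ZI) :
    c * massDensity x Z + c * h ^ 2 * gradDensity x Z + 2 * h * c * bdryDeriv x Z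
      - 4 * h * (μ Z * bdryDeriv x Z) ≤ energyDensity μ lam h x Z := by
  have h1 := energy_density_identity (μ Z) (lam Z) h (U₂ x Z) (G₂ x Z) (U₃ x Z) (G₃ x Z)
  have h2 := div_curl_identity h (U₂ x Z) (G₂ x Z) (U₃ x Z) (G₃ x Z)
  rw [energyDensity, shear_apply, div_apply, h1, massDensity, gradDensity, bdryDeriv]
  have k1 := mul_le_mul_of_nonneg_right (hc'.trans (p.lam_add_two_mu_ge hZ))
    (sq_nonneg ‖h * G₃ x Z + Complex.I * U₂ x Z‖)
  have k2 := mul_le_mul_of_nonneg_right hc (sq_nonneg ‖h * G₂ x Z - Complex.I * U₃ x Z‖)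
  have h3 := congrArg (HMul.hMul c) h2
  linarith

/-- On functions with `φ₂(0) = 0` the energy is bounded below by `μ(0) - O(h)`. -/
theorem energy_ge_of_fst_eq_zero (p : Profile μ lam ZI) :
    ∃ C, 0 ≤ C ∧ ∀ h > 0, ∀ x : FormSpace, U₂ x 0 = 0 →
      (μ 0 - C * h) * (mass x x).re ≤ (energy μ lam h x x).re := by
  obtain ⟨C, hC⟩ := p.isWeight_deriv_mu.bound
  have hC0 : 0 ≤ C := (abs_nonneg _).trans (hC 0 le_rfl)
  refine ⟨2 * C, by positivity, fun h hh x hx => ?_⟩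
  -- The condition `φ₂(0) = 0` enters here only: both total derivatives integrate to multiples of
  -- this boundary value.
  have hb0 : bdry x 0 = 0 := by rw [bdry, hx]; simp
  have i1 := (integrable_massDensity x).const_mul (μ 0)
  have i2 := (integrable_bdryDeriv x).const_mul (2 * h * μ 0)
  have i3 := (p.isWeight_mu.integrable_mul_real (integrable_bdryDeriv x)).const_mul (4 * h)
  have e12 := integral_add i1 i2
  have e123 := integral_sub (i1.add i2) i3
  simp only [Pi.add_apply] at e123
  have hle : ∫ Z in Iic 0, (μ 0 * massDensity x Z + 2 * h * μ 0 * bdryDeriv x Z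
      - 4 * h * (μ Z * bdryDeriv x Z)) ≤ ∫ Z in Iic 0, energyDensity μ lam h x Z := by
    refine setIntegral_mono_on ((i1.add i2).sub i3)
      (integrable_energyDensity p.isWeight_mu p.isWeight_lam h x) measurableSet_Iic
      fun Z hZ => ?_
    have h1 := energyDensity_ge p h x hZ (p.mu_ge hZ) p.mu_lt.le
    have h2 : 0 ≤ μ 0 * h ^ 2 * gradDensity x Z :=
      mul_nonneg (mul_nonneg p.mu_pos.le (sq_nonneg h)) (gradDensity_nonneg x Z)
    linarith
  rw [e123, e12, integral_const_mul, integral_const_mul, integral_const_mul,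
    integral_bdryDeriv x le_rfl, integral_mu_bdryDeriv p x, hb0] at hle
  -- The surviving error is `4 h` times this integral; with `|bdry|` at most half the mass density
  -- it yields the constant `2 * C`.
  have hw : -(C / 2 * ∫ Z in Iic 0, massDensity x Z) ≤
      ∫ Z in Iic 0, derivWithin μ (Iic 0) Z * bdry x Z := by
    rw [← integral_const_mul, ← integral_neg]
    refine setIntegral_mono_on ((integrable_massDensity x).const_mul _).neg
      (p.isWeight_deriv_mu.integrable_mul_real (integrable_bdry x)) measurableSet_Iic
      fun Z hZ => ?_
    have h1 := abs_mul (derivWithin μ (Iic 0) Z) (bdry x Z)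
    have h2 := mul_le_mul (hC Z hZ) (abs_bdry_le x Z) (abs_nonneg _) hC0
    rw [← h1] at h2
    have h3 := neg_abs_le (derivWithin μ (Iic 0) Z * bdry x Z)
    linarith
  rw [energy_re p.isWeight_mu p.isWeight_lam, mass_re]
  have hw2 := mul_le_mul_of_nonneg_left hw (show 0 ≤ 4 * h by positivity)
  linarith

/-- The shear square controls half of `h² |g₂|²` up to `|u₃|²`. The only other term without a sign
is the cross term `2 l h Im (g₃ ū₂)`, which Young's inequality absorbs into half of `μ₀ h² |g₃|²`.
The bound is pointwise, so it can be integrated over any interval without boundary terms. -/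
theorem coercive_density_aux {m μ₀ μ l Λ h : ℝ} (hμ₀ : 0 < μ₀) (hm : μ₀ ≤ m) (hμ : μ₀ ≤ μ)
    (hl : m ≤ l + 2 * μ) (hΛ : |l| ≤ Λ) (u₂ g₂ u₃ g₃ : ℂ) :
    μ₀ * h ^ 2 / 2 * (‖g₂‖ ^ 2 + ‖g₃‖ ^ 2) ≤
      μ * ‖h * g₂ + Complex.I * u₃‖ ^ 2 + l * ‖h * g₃ + Complex.I * u₂‖ ^ 2
      + 2 * h ^ 2 * (μ * ‖g₃‖ ^ 2) + 2 * (μ * ‖u₂‖ ^ 2)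
      + (2 * Λ ^ 2 / μ₀ + μ₀) * (‖u₂‖ ^ 2 + ‖u₃‖ ^ 2) := by
  have e1 : l * ‖h * g₃ + Complex.I * u₂‖ ^ 2 + 2 * h ^ 2 * (μ * ‖g₃‖ ^ 2) + 2 * (μ * ‖u₂‖ ^ 2)
      = (l + 2 * μ) * (h ^ 2 * ‖g₃‖ ^ 2) + (l + 2 * μ) * ‖u₂‖ ^ 2
        + 2 * l * h * (g₃ * conj u₂).im := by
    simp only [Complex.sq_norm, Complex.normSq_apply, Complex.add_re, Complex.add_im,
      Complex.mul_re, Complex.mul_im, Complex.ofReal_re,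
      Complex.ofReal_im, Complex.I_re, Complex.I_im, Complex.conj_re, Complex.conj_im]
    ring
  have h1 : |2 * l * h * (g₃ * conj u₂).im| ≤ 2 * Λ * (|h| * ‖g₃‖) * ‖u₂‖ := by
    have hΛ0 : 0 ≤ Λ := (abs_nonneg _).trans hΛ
    have : |(g₃ * conj u₂).im| ≤ ‖g₃‖ * ‖u₂‖ := by
      refine (Complex.abs_im_le_norm _).trans ?_
      rw [norm_mul, RCLike.norm_conj]
    rw [abs_mul, abs_mul, abs_mul, abs_two]
    calc 2 * |l| * |h| * |(g₃ * conj u₂).im| ≤ 2 * Λ * |h| * (‖g₃‖ * ‖u₂‖) := by gcongr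
      _ = _ := by ring
  have hΛ0 : 0 ≤ Λ := (abs_nonneg _).trans hΛ
  have h2 : 2 * Λ * (|h| * ‖g₃‖) * ‖u₂‖ ≤
      μ₀ / 2 * (h ^ 2 * ‖g₃‖ ^ 2) + 2 * Λ ^ 2 / μ₀ * ‖u₂‖ ^ 2 := by
    have h3 := sq_nonneg (μ₀ * (|h| * ‖g₃‖) - 2 * Λ * ‖u₂‖)
    have h4 : μ₀ / 2 * (h ^ 2 * ‖g₃‖ ^ 2) + 2 * Λ ^ 2 / μ₀ * ‖u₂‖ ^ 2
        - 2 * Λ * (|h| * ‖g₃‖) * ‖u₂‖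
        = (μ₀ * (|h| * ‖g₃‖) - 2 * Λ * ‖u₂‖) ^ 2 / (2 * μ₀) := by
      rw [← sq_abs h]
      field_simp
      ring
    have h5 : 0 ≤ (μ₀ * (|h| * ‖g₃‖) - 2 * Λ * ‖u₂‖) ^ 2 / (2 * μ₀) := by positivity
    linarith
  have h3 : μ₀ * (h ^ 2 * ‖g₃‖ ^ 2) ≤ (l + 2 * μ) * (h ^ 2 * ‖g₃‖ ^ 2) := by
    gcongr; linarith
  have h4 : 0 ≤ (l + 2 * μ) * ‖u₂‖ ^ 2 := mul_nonneg (by linarith) (sq_nonneg _)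
  have h5 : μ₀ * ‖h * g₂ + Complex.I * u₃‖ ^ 2 ≤ μ * ‖h * g₂ + Complex.I * u₃‖ ^ 2 := by gcongr
  have h6 : h ^ 2 * ‖g₂‖ ^ 2 / 2 - ‖u₃‖ ^ 2 ≤ ‖h * g₂ + Complex.I * u₃‖ ^ 2 := by
    have h7 : ‖(h : ℂ) * g₂‖ ≤ ‖h * g₂ + Complex.I * u₃‖ + ‖u₃‖ := by
      have := norm_sub_le (h * g₂ + Complex.I * u₃) (Complex.I * u₃)
      rw [add_sub_cancel_right, norm_mul Complex.I, Complex.norm_I, one_mul] at this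
      exact this
    have h8 : ‖(h : ℂ) * g₂‖ ^ 2 = h ^ 2 * ‖g₂‖ ^ 2 := by
      rw [norm_mul, mul_pow, Complex.norm_real, Real.norm_eq_abs, sq_abs]
    have h9 := pow_le_pow_left₀ (norm_nonneg _) h7 2
    rw [h8] at h9
    nlinarith [sq_nonneg (‖h * g₂ + Complex.I * u₃‖ - ‖u₃‖)]
  have h6' := mul_le_mul_of_nonneg_left h6 hμ₀.le
  have h7 := neg_abs_le (2 * l * h * (g₃ * conj u₂).im)
  have h8 : 0 ≤ 2 * Λ ^ 2 / μ₀ * ‖u₃‖ ^ 2 := by positivity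
  have h9 : 0 ≤ μ₀ * ‖u₂‖ ^ 2 := by positivity
  linarith

theorem exists_coercive_density (p : Profile μ lam ZI) :
    ∃ C, 0 ≤ C ∧ ∀ h : ℝ, ∀ x : FormSpace, ∀ Z ≤ 0, μ 0 * h ^ 2 / 2 * gradDensity x Z ≤
      energyDensity μ lam h x Z + C * massDensity x Z := by
  obtain ⟨Λ, hΛ⟩ := p.isWeight_lam.bound
  have hp := p.mu_pos
  refine ⟨2 * Λ ^ 2 / μ 0 + μ 0, by positivity, fun h x Z hZ => ?_⟩
  exact coercive_density_aux p.mu_pos p.mu_lt.le (p.mu_ge hZ) (p.lam_add_two_mu_ge hZ) (hΛ Z hZ)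
    _ _ _ _

theorem energy_coercive (p : Profile μ lam ZI) {h : ℝ} (hh : 0 < h) :
    ∃ κ C : ℝ, 0 < κ ∧ ∀ x : FormSpace,
      κ * (sobolev x x).re ≤ (energy μ lam h x x).re + C * (mass x x).re := by
  obtain ⟨C, hC0, hC⟩ := exists_coercive_density p
  have hp := p.mu_pos
  refine ⟨μ 0 * h ^ 2 / 2, C + μ 0 * h ^ 2 / 2, by positivity, fun x => ?_⟩
  have i1 := (integrable_energyDensity p.isWeight_mu p.isWeight_lam h x)
  have i2 := (integrable_massDensity x).const_mul C
  have h1 : ∫ Z in Iic 0, μ 0 * h ^ 2 / 2 * gradDensity x Z ≤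
      ∫ Z in Iic 0, (energyDensity μ lam h x Z + C * massDensity x Z) :=
    setIntegral_mono_on ((integrable_gradDensity x).const_mul _) (i1.add i2) measurableSet_Iic
      fun Z hZ => hC h x Z hZ
  rw [integral_add i1 i2, integral_const_mul, integral_const_mul] at h1
  rw [sobolev_re, energy_re p.isWeight_mu p.isWeight_lam, mass_re]
  linarith

theorem abs_energy_le (p : Profile μ lam ZI) (h : ℝ) :
    ∃ C : ℝ, ∀ x : FormSpace, |(energy μ lam h x x).re| ≤ C * (sobolev x x).re := by
  obtain ⟨M, hM⟩ := p.isWeight_mu.bound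
  obtain ⟨Λ, hΛ⟩ := p.isWeight_lam.bound
  have hM0 : 0 ≤ M := (abs_nonneg _).trans (hM 0 le_rfl)
  have hΛ0 : 0 ≤ Λ := (abs_nonneg _).trans (hΛ 0 le_rfl)
  refine ⟨(2 * M + 2 * Λ) * (h ^ 2 + 1) + 2 * h ^ 2 * M + 2 * M, fun x => ?_⟩
  rw [energy_re p.isWeight_mu p.isWeight_lam, sobolev_re,
    ← integral_add (integrable_massDensity x) (integrable_gradDensity x), ← integral_const_mul,
    ← Real.norm_eq_abs]
  refine norm_integral_le_of_norm_le
    (((integrable_massDensity x).add (integrable_gradDensity x)).const_mul _) ?_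
  filter_upwards [ae_restrict_mem measurableSet_Iic] with Z hZ
  rw [Real.norm_eq_abs]
  have key : ∀ a b : ℂ, ‖h * a + Complex.I * b‖ ^ 2 ≤ 2 * (h ^ 2 + 1) * (‖a‖ ^ 2 + ‖b‖ ^ 2) := by
    intro a b
    have h1 := norm_add_le ((h : ℂ) * a) (Complex.I * b)
    rw [norm_mul, norm_mul, Complex.norm_I, one_mul, Complex.norm_real, Real.norm_eq_abs] at h1
    have h2 := pow_le_pow_left₀ (norm_nonneg _) h1 2
    have h3 := sq_nonneg (|h| * ‖a‖ - ‖b‖)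
    have h4 : (|h| * ‖a‖) ^ 2 = h ^ 2 * ‖a‖ ^ 2 := by rw [mul_pow, sq_abs]
    have h5 : 0 ≤ h ^ 2 * ‖b‖ ^ 2 := by positivity
    nlinarith [sq_nonneg ‖a‖]
  have e1 : |μ Z * ‖shear h x Z‖ ^ 2| ≤ M * (2 * (h ^ 2 + 1) * (‖G₂ x Z‖ ^ 2 + ‖U₃ x Z‖ ^ 2)) := by
    rw [abs_mul, abs_of_nonneg (sq_nonneg ‖shear h x Z‖)]
    exact mul_le_mul (hM Z hZ) (key _ _) (sq_nonneg _) hM0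
  have e2 : |lam Z * ‖div h x Z‖ ^ 2| ≤ Λ * (2 * (h ^ 2 + 1) * (‖G₃ x Z‖ ^ 2 + ‖U₂ x Z‖ ^ 2)) := by
    rw [abs_mul, abs_of_nonneg (sq_nonneg ‖div h x Z‖)]
    exact mul_le_mul (hΛ Z hZ) (key _ _) (sq_nonneg _) hΛ0
  have e3 : |2 * h ^ 2 * (μ Z * ‖G₃ x Z‖ ^ 2)| ≤ 2 * h ^ 2 * (M * ‖G₃ x Z‖ ^ 2) := by
    rw [abs_mul, abs_of_nonneg (show 0 ≤ 2 * h ^ 2 by positivity), abs_mul,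
      abs_of_nonneg (sq_nonneg ‖G₃ x Z‖)]
    gcongr
    exact hM Z hZ
  have e4 : |2 * (μ Z * ‖U₂ x Z‖ ^ 2)| ≤ 2 * (M * ‖U₂ x Z‖ ^ 2) := by
    rw [abs_mul, abs_two, abs_mul, abs_of_nonneg (sq_nonneg ‖U₂ x Z‖)]
    gcongr
    exact hM Z hZ
  have e := (abs_add_le _ _).trans (add_le_add ((abs_add_le _ _).trans
    (add_le_add ((abs_add_le _ _).trans (add_le_add e1 e2)) e3)) e4)
  refine e.trans ?_
  rw [massDensity, gradDensity, ← sub_nonneg]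
  have : 0 ≤ 2 * M * (h ^ 2 + 1) * (‖U₂ x Z‖ ^ 2 + ‖G₃ x Z‖ ^ 2)
      + 2 * Λ * (h ^ 2 + 1) * (‖U₃ x Z‖ ^ 2 + ‖G₂ x Z‖ ^ 2)
      + 2 * h ^ 2 * M * (‖U₂ x Z‖ ^ 2 + ‖U₃ x Z‖ ^ 2 + ‖G₂ x Z‖ ^ 2)
      + 2 * M * (‖U₃ x Z‖ ^ 2 + ‖G₂ x Z‖ ^ 2 + ‖G₃ x Z‖ ^ 2) := by positivity
  refine this.trans (le_of_eq ?_)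
  ring

end FormSpace

/-! ### Coercivity below `μ ZI` up to finite rank -/

theorem setIntegral_Iic_split {f : ℝ → ℝ} (hf : IntegrableOn f (Iic 0)) {a : ℝ} (ha : a ≤ 0) :
    ∫ x in Iic 0, f x = (∫ x in Iic a, f x) + ∫ x in a..0, f x := by
  rw [← intervalIntegral.integral_Iic_sub_Iic (hf.mono_set (Iic_subset_Iic.2 ha)) hf]
  ring

namespace FormSpace

/-- The values of `φ` on a finite grid. -/
def gridEval {k : ℕ} (z : Fin k → ℝ) : FormSpace →ₗ[ℂ] (Fin k → ℂ × ℂ) where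
  toFun x j := (U₂ x (z j), U₃ x (z j))
  map_add' _ _ := rfl
  map_smul' _ _ := rfl

theorem massDensity_le_gridEval {k : ℕ} (z : Fin k → ℝ) (x : FormSpace) (j : Fin k) :
    massDensity x (z j) ≤ 2 * ‖gridEval z x‖ ^ 2 := by
  have h1 : ‖(U₂ x (z j), U₃ x (z j))‖ ≤ ‖gridEval z x‖ := norm_le_pi_norm (gridEval z x) j
  have h2 := pow_le_pow_left₀ (norm_nonneg _) ((norm_fst_le _).trans h1) 2
  have h3 := pow_le_pow_left₀ (norm_nonneg _) ((norm_snd_le _).trans h1) 2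
  rw [massDensity]
  simp only at h2 h3
  linarith

theorem massDensity_le_sobolev (x : FormSpace) {Z : ℝ} (hZ : Z ≤ 0) :
    massDensity x Z ≤ (sobolev x x).re := by
  have h1 := (isH1_fst x).norm_sq_le hZ
  have h2 := (isH1_snd x).norm_sq_le hZ
  simp only [sobolev, mass, Complex.add_re, weightedInner_self_re, one_mul]
  rw [massDensity]
  linarith

theorem gridEval_le_sobolev {k : ℕ} {z : Fin k → ℝ} (hz : ∀ j, z j ≤ 0) (x : FormSpace) :
    ‖gridEval z x‖ ^ 2 ≤ (sobolev x x).re := by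
  rw [← Real.le_sqrt (norm_nonneg _) (sobolev_nonneg x),
    pi_norm_le_iff_of_nonneg (Real.sqrt_nonneg _)]
  intro j
  have h1 := massDensity_le_sobolev x (hz j)
  rw [massDensity] at h1
  refine max_le ?_ ?_
  · refine Real.le_sqrt_of_sq_le ?_
    exact le_trans (le_add_of_nonneg_right (sq_nonneg _)) h1
  · refine Real.le_sqrt_of_sq_le ?_
    exact le_trans (le_add_of_nonneg_left (sq_nonneg _)) h1

variable {μ lam : ℝ → ℝ} {ZI : ℝ}

/-- To the left of `ZI` the factor `μ` is constant, so the total derivatives integrate exactly to a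
value at `ZI`. The full constant `μ ZI` in front of the mass is what permits every `e < μ ZI` below.
-/
theorem energy_left_ge (p : Profile μ lam ZI) {h : ℝ} (hh : 0 < h) (x : FormSpace) :
    μ ZI * (∫ Z in Iic ZI, massDensity x Z) + μ ZI * h ^ 2 * (∫ Z in Iic ZI, gradDensity x Z)
      - μ ZI * h * massDensity x ZI ≤ ∫ Z in Iic ZI, energyDensity μ lam h x Z := by
  have hsub : Iic ZI ⊆ Iic (0 : ℝ) := Iic_subset_Iic.2 p.ZI_neg.le
  have i1 := ((integrable_massDensity x).mono_set hsub).const_mul (μ ZI)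
  have i2 := ((integrable_gradDensity x).mono_set hsub).const_mul (μ ZI * h ^ 2)
  have i3 := ((integrable_bdryDeriv x).mono_set hsub).const_mul (2 * h * μ ZI)
  have e1 := integral_add i1 i2
  have e2 := integral_sub (i1.add i2) i3
  simp only [Pi.add_apply] at e2
  have hle : ∫ Z in Iic ZI, (μ ZI * massDensity x Z + μ ZI * h ^ 2 * gradDensity x Z
      - 2 * h * μ ZI * bdryDeriv x Z) ≤ ∫ Z in Iic ZI, energyDensity μ lam h x Z := by
    refine setIntegral_mono_on ((i1.add i2).sub i3)
      ((integrable_energyDensity p.isWeight_mu p.isWeight_lam h x).mono_set hsub)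
      measurableSet_Iic fun Z hZ => ?_
    have h1 := energyDensity_ge p h x (hsub hZ) (p.mu_const Z hZ).symm.le le_rfl
    rw [p.mu_const Z hZ] at h1
    linarith
  rw [e2, e1, integral_const_mul, integral_const_mul, integral_const_mul,
    integral_bdryDeriv x p.ZI_neg.le] at hle
  have h1 := (le_abs_self _).trans (abs_bdry_le x ZI)
  have hm : 0 < μ ZI := p.mu_pos.trans p.mu_lt
  have h2 := mul_le_mul_of_nonneg_left h1 (show 0 ≤ 2 * h * μ ZI by positivity)
  linarith

/-- Below `μ(Z_I)`, the form is coercive up to a finite-rank perturbation. -/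
theorem energy_garding (p : Profile μ lam ZI) {h : ℝ} (hh : 0 < h) {e : ℝ} (he : e < μ ZI) :
    ∃ (k : ℕ) (T : FormSpace →ₗ[ℂ] (Fin k → ℂ × ℂ)) (κ C C' : ℝ), 0 < κ ∧
      (∀ x, κ * (sobolev x x).re ≤
        (energy μ lam h x x).re - e * (mass x x).re + C * ‖T x‖ ^ 2) ∧
      ∀ x, ‖T x‖ ^ 2 ≤ C' * (sobolev x x).re := by
  obtain ⟨C₁, hC₁, hcoer⟩ := exists_coercive_density p
  have hZ := p.ZI_neg
  have hm : 0 < μ ZI := p.mu_pos.trans p.mu_lt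
  have hμ0 := p.mu_pos
  set P := μ 0 * h ^ 2 / 2 with hP
  have hP0 : 0 < P := by positivity
  -- Mass to be recovered on `[ZI, 0]`: the loss `C₁` of the pointwise bound, the shift by `e`, and
  -- one copy to keep.
  set A := C₁ + |e| + 1 with hA
  have hA0 : 0 < A := by positivity
  -- The mesh is so fine that `2 δ² A ≤ P / 2`: the Poincaré inequality then spends at most half of
  -- the gradient.
  obtain ⟨k₀, hk₀⟩ := exists_nat_gt (4 * A * ZI ^ 2 / P)
  -- The extra cell keeps `k` positive, so that `ZI` itself is a grid point and controls the
  -- boundary term of the left part.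
  set k := k₀ + 1 with hk
  have hkpos : (1 : ℝ) ≤ k := by rw [hk]; simp
  set δ := -ZI / k with hδ
  have hδ0 : 0 < δ := div_pos (by linarith) (by linarith)
  have hkδ : ZI + k * δ = 0 := by rw [hδ]; field_simp; ring
  have hδ2 : 2 * δ ^ 2 * A ≤ P / 2 := by
    have h1 : 4 * A * ZI ^ 2 ≤ P * k ^ 2 := by
      rw [div_lt_iff₀ hP0] at hk₀
      have h2 : (k₀ : ℝ) ≤ (k : ℝ) ^ 2 := by
        have : (k₀ : ℝ) ≤ k := by rw [hk]; simp
        nlinarith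
      nlinarith
    rw [hδ, div_pow, neg_sq, mul_div_assoc', div_mul_eq_mul_div, div_le_iff₀ (by positivity)]
    linarith
  let z : Fin k → ℝ := fun j => ZI + (j : ℕ) * δ
  have hz : ∀ j, z j ≤ 0 := by
    intro j
    rw [← hkδ]
    have : ((j : ℕ) : ℝ) ≤ k := by exact_mod_cast j.2.le
    simp only [z]
    gcongr
  -- The four entries serve the mass and gradient on the left, then the gradient and mass on `[ZI,
  -- 0]`.
  set κ := min (min (μ ZI - e) (μ ZI * h ^ 2)) (min (P / 2) 1) with hκ
  have hκ0 : 0 < κ := by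
    refine lt_min (lt_min (by linarith) (by positivity)) (lt_min (by positivity) one_pos)
  refine ⟨k, gridEval z, κ, (μ ZI * h + 2 * δ * A * k) * 2, 1, hκ0, fun x => ?_, fun x => ?_⟩
  swap
  · rw [one_mul]; exact gridEval_le_sobolev hz x
  have iM := integrable_massDensity x
  have iG := integrable_gradDensity x
  have iE := integrable_energyDensity p.isWeight_mu p.isWeight_lam h x
  have interval : ∀ {f : ℝ → ℝ}, IntegrableOn f (Iic 0) → IntervalIntegrable f volume ZI 0 := by
    intro f hf
    rw [intervalIntegrable_iff_integrableOn_Ioc_of_le hZ.le]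
    exact hf.mono_set fun x hx => hx.2
  rw [sobolev_re, energy_re p.isWeight_mu p.isWeight_lam, mass_re, setIntegral_Iic_split iM hZ.le,
    setIntegral_Iic_split iG hZ.le, setIntegral_Iic_split iE hZ.le]
  have hleft := energy_left_ge p hh x
  have hright : P * (∫ Z in ZI..0, gradDensity x Z) - C₁ * (∫ Z in ZI..0, massDensity x Z) ≤
      ∫ Z in ZI..0, energyDensity μ lam h x Z := by
    rw [← intervalIntegral.integral_const_mul, ← intervalIntegral.integral_const_mul,
      ← intervalIntegral.integral_sub ((interval iG).const_mul _) ((interval iM).const_mul _)]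
    refine intervalIntegral.integral_mono_on hZ.le
      (((interval iG).const_mul _).sub ((interval iM).const_mul _)) (interval iE) fun Z hZ' => ?_
    have h1 := hcoer h x Z hZ'.2
    rw [← hP] at h1
    linarith
  have hgrid : (∫ Z in ZI..0, massDensity x Z) ≤ 2 * δ ^ 2 * (∫ Z in ZI..0, gradDensity x Z)
      + 2 * δ * (k * (2 * ‖gridEval z x‖ ^ 2)) := by
    have h1 := (isH1_fst x).grid_norm_sq_le hδ0.le hkδ
    have h2 := (isH1_snd x).grid_norm_sq_le hδ0.le hkδ
    have e1 : (∫ Z in ZI..0, massDensity x Z) =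
        (∫ Z in ZI..0, ‖U₂ x Z‖ ^ 2) + ∫ Z in ZI..0, ‖U₃ x Z‖ ^ 2 :=
      intervalIntegral.integral_add (interval (integrable_norm_sq (memLp_U₂ x)))
        (interval (integrable_norm_sq (memLp_U₃ x)))
    have e2 : (∫ Z in ZI..0, gradDensity x Z) =
        (∫ Z in ZI..0, ‖G₂ x Z‖ ^ 2) + ∫ Z in ZI..0, ‖G₃ x Z‖ ^ 2 :=
      intervalIntegral.integral_add (interval (integrable_norm_sq (memLp_G₂ x)))
        (interval (integrable_norm_sq (memLp_G₃ x)))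
    have e3 : ∑ j ∈ Finset.range k, ‖U₂ x (ZI + j * δ)‖ ^ 2
        + ∑ j ∈ Finset.range k, ‖U₃ x (ZI + j * δ)‖ ^ 2 ≤ k * (2 * ‖gridEval z x‖ ^ 2) := by
      rw [← Finset.sum_add_distrib]
      have := Finset.sum_le_card_nsmul (Finset.range k)
        (fun j => ‖U₂ x (ZI + j * δ)‖ ^ 2 + ‖U₃ x (ZI + j * δ)‖ ^ 2) (2 * ‖gridEval z x‖ ^ 2)
        (fun j hj => massDensity_le_gridEval z x ⟨j, Finset.mem_range.1 hj⟩)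
      simpa using this
    have e3' := mul_le_mul_of_nonneg_left e3 (show 0 ≤ 2 * δ by positivity)
    rw [e1, e2]
    linarith
  have hpt : massDensity x ZI ≤ 2 * ‖gridEval z x‖ ^ 2 := by
    have := massDensity_le_gridEval z x ⟨0, by omega⟩
    simpa [z] using this
  have nMl : 0 ≤ ∫ Z in Iic ZI, massDensity x Z := integral_nonneg (massDensity_nonneg x)
  have nGl : 0 ≤ ∫ Z in Iic ZI, gradDensity x Z := integral_nonneg (gradDensity_nonneg x)
  have nMr : 0 ≤ ∫ Z in ZI..0, massDensity x Z :=
    intervalIntegral.integral_nonneg hZ.le fun Z _ => massDensity_nonneg x Z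
  have nGr : 0 ≤ ∫ Z in ZI..0, gradDensity x Z :=
    intervalIntegral.integral_nonneg hZ.le fun Z _ => gradDensity_nonneg x Z
  generalize (∫ Z in Iic ZI, massDensity x Z) = Ml at *
  generalize (∫ Z in Iic ZI, gradDensity x Z) = Gl at *
  generalize (∫ Z in ZI..0, massDensity x Z) = Mr at *
  generalize (∫ Z in ZI..0, gradDensity x Z) = Gr at *
  generalize ‖gridEval z x‖ ^ 2 = t at *
  have k1 : κ * Ml ≤ (μ ZI - e) * Ml :=
    mul_le_mul_of_nonneg_right ((min_le_left _ _).trans (min_le_left _ _)) nMl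
  have k2 : κ * Gl ≤ μ ZI * h ^ 2 * Gl :=
    mul_le_mul_of_nonneg_right ((min_le_left _ _).trans (min_le_right _ _)) nGl
  have k3 : κ * Gr ≤ P / 2 * Gr :=
    mul_le_mul_of_nonneg_right ((min_le_right _ _).trans (min_le_left _ _)) nGr
  have k4 : κ * Mr ≤ 1 * Mr :=
    mul_le_mul_of_nonneg_right ((min_le_right _ _).trans (min_le_right _ _)) nMr
  have k5 := mul_le_mul_of_nonneg_left hgrid hA0.le
  have k6 := mul_le_mul_of_nonneg_right hδ2 nGr
  have k7 := mul_le_mul_of_nonneg_left hpt (show 0 ≤ μ ZI * h by positivity)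
  have k8 : e * Mr ≤ |e| * Mr := mul_le_mul_of_nonneg_right (le_abs_self e) nMr
  have k9 : A * Mr = C₁ * Mr + |e| * Mr + Mr := by rw [hA]; ring
  linarith

end FormSpace

/-! ### Regularity: from weak eigenvectors to eigenfunctions -/

theorem isPrim_primitive {g : ℝ → ℂ} (hg : MemLp g 2 ν) {c : ℝ} (hc : c ≤ 0) :
    IsPrim (fun Z => ∫ s in c..Z, g s) g := by
  refine ⟨hg, fun a b hab hb => ?_⟩
  rw [eq_sub_iff_add_eq, add_comm]
  exact intervalIntegral.integral_add_adjacent_intervals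
    (MemLp.intervalIntegrable hg hc (hab.trans hb))
    (MemLp.intervalIntegrable hg (hab.trans hb) hb)

theorem eqOn_ae {u v : ℝ → ℂ} (h : EqOn u v (Iic 0)) : u =ᵐ[ν] v := by
  filter_upwards [ae_restrict_mem measurableSet_Iic] with x hx using h hx

theorem D_congr {u v : ℝ → ℂ} (h : EqOn u v (Iic 0)) : EqOn (D u) (D v) (Iic 0) :=
  fun _ hx => derivWithin_congr h (h hx)

theorem IsH1.congr {u g u' g' : ℝ → ℂ} (h : IsH1 u g) (hu : EqOn u' u (Iic 0))
    (hg : g' =ᵐ[ν] g) : IsH1 u' g' := by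
  refine ⟨h.memLp.ae_eq (eqOn_ae hu).symm, h.memLp_deriv.ae_eq hg.symm, fun a b hab hb => ?_⟩
  rw [hu hb, hu (hab.trans hb), ← h.integral_eq a b hab hb,
    intervalIntegral.integral_of_le hab, intervalIntegral.integral_of_le hab]
  exact integral_congr_ae (ae_restrict_of_ae_restrict_of_subset (fun x hx => hx.2.trans hb) hg)

/-- Extending `g` by the constant `g 0` beyond `0` makes `u` the restriction of a differentiable
function. Equality at every point matters because the Neumann conditions evaluate the derivative at
`0`. -/
theorem IsH1.D_eq {u g : ℝ → ℂ} (h : IsH1 u g) (hg : ContinuousOn g (Iic 0)) :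
    EqOn (D u) g (Iic 0) := by
  intro Z hZ
  have hZ0 : Z ≤ 0 := hZ
  have hcont : Continuous fun x : ℝ => g (min x 0) :=
    hg.comp_continuous (by fun_prop) fun x => mem_Iic.2 (min_le_right x 0)
  have h1 := (hcont.integral_hasStrictDerivAt 0 Z).hasDerivAt
  have h2 := (h1.const_add (u 0)).hasDerivWithinAt (s := Iic 0)
  rw [min_eq_left hZ0] at h2
  have heq : ∀ x ∈ Iic (0 : ℝ), u x = u 0 + ∫ s in 0..x, g (min s 0) := by
    intro x hx
    rw [intervalIntegral.integral_symm]
    have : ∫ s in x..0, g (min s 0) = ∫ s in x..0, g s := by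
      refine intervalIntegral.integral_congr fun s hs => ?_
      rw [uIcc_of_le hx] at hs
      simp only [min_eq_left hs.2]
    rw [this, h.integral_eq x 0 hx le_rfl]
    ring
  exact (h2.congr heq (heq Z hZ)).derivWithin (uniqueDiffOn_Iic 0 Z hZ)

/-- The du Bois-Reymond lemma on the half-line, with natural boundary condition at `0`. -/
theorem exists_isH1_of_weak {f F : ℝ → ℂ} (hf : MemLp f 2 ν) (hF : MemLp F 2 ν)
    (hw : ∀ v w, IsH1 v w → ∫ x in Iic 0, (conj (F x) * v x + conj (f x) * w x) = 0) :
    ∃ Φ, IsH1 Φ F ∧ Φ 0 = 0 ∧ f =ᵐ[ν] Φ := by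
  set Φ : ℝ → ℂ := fun Z => ∫ s in 0..Z, F s with hΦ
  have hΦp : IsPrim Φ F := isPrim_primitive hF le_rfl
  have hΦ0 : Φ 0 = 0 := by simp [hΦ]
  have key : ∀ n : ℕ, ∀ᵐ x, x ∈ Ioc (-(n : ℝ)) 0 → f x = Φ x := by
    intro n
    set a : ℝ := -(n : ℝ) with ha
    have ha0 : a ≤ 0 := by simp [ha]
    have hcont : ContinuousOn Φ (Icc a 0) := hΦp.continuousOn.mono fun x hx => hx.2
    have hfin : IsFiniteMeasure (volume.restrict (Ioc a 0)) := ⟨by simp⟩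
    have hΦm : MemLp Φ 2 (volume.restrict (Ioc a 0)) := by
      obtain ⟨C, hC⟩ := isCompact_Icc.exists_bound_of_continuousOn hcont
      refine MemLp.of_bound ((hcont.mono Ioc_subset_Icc_self).aestronglyMeasurable
        measurableSet_Ioc) C ?_
      filter_upwards [ae_restrict_mem measurableSet_Ioc] with x hx
      exact hC x (Ioc_subset_Icc_self hx)
    have hfm : MemLp f 2 (volume.restrict (Ioc a 0)) :=
      hf.mono_measure (Measure.restrict_mono (fun x hx => hx.2) le_rfl)
    have hdm : MemLp (f - Φ) 2 (volume.restrict (Ioc a 0)) := hfm.sub hΦm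
    -- The test function is the primitive of the cut-off error `f - Φ`. It vanishes to the left of
    -- `a` but is unconstrained at `0`, so not even an additive constant can remain between `f` and
    -- `Φ`.
    set w : ℝ → ℂ := (Ioc a 0).indicator (f - Φ) with hwdef
    have hw2' : MemLp w 2 (volume : Measure ℝ) := (memLp_indicator_iff_restrict measurableSet_Ioc).2 hdm
    have hw2 : MemLp w 2 ν := hw2'.mono_measure Measure.restrict_le_self
    set v : ℝ → ℂ := fun Z => ∫ s in a..Z, w s with hv
    have hvp : IsPrim v w := isPrim_primitive hw2 ha0
    have hva : v a = 0 := by simp [hv]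
    have hw0 : ∀ x ≤ a, w x = 0 := fun x hx => by
      rw [hwdef, indicator_of_notMem]; exact fun h => absurd h.1 (not_lt.2 hx)
    have hv0 : ∀ x ≤ a, v x = 0 := by
      intro x hx
      have h1 := hvp.integral_eq x a hx ha0
      rw [hva, zero_sub] at h1
      have h2 : ∫ s in x..a, w s = 0 := by
        rw [intervalIntegral.integral_of_le hx]
        exact setIntegral_eq_zero_of_forall_eq_zero fun s hs => hw0 s hs.2
      rw [h2] at h1
      simpa using h1.symm
    have hvm : MemLp v 2 ν := by
      have hvc : ContinuousOn v (Icc a 0) := hvp.continuousOn.mono fun x hx => hx.2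
      obtain ⟨C, hC⟩ := isCompact_Icc.exists_bound_of_continuousOn hvc
      have h1 : MemLp v 2 (volume.restrict (Ioc a 0)) := by
        refine MemLp.of_bound ((hvc.mono Ioc_subset_Icc_self).aestronglyMeasurable
          measurableSet_Ioc) C ?_
        filter_upwards [ae_restrict_mem measurableSet_Ioc] with x hx
        exact hC x (Ioc_subset_Icc_self hx)
      have h2 : MemLp ((Ioc a 0).indicator v) 2 (volume : Measure ℝ) :=
        (memLp_indicator_iff_restrict measurableSet_Ioc).2 h1
      refine (h2.mono_measure (Measure.restrict_le_self (s := Iic 0))).ae_eq ?_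
      filter_upwards [ae_restrict_mem measurableSet_Iic] with x hx
      by_cases hxa : x ≤ a
      · rw [hv0 x hxa, indicator_of_notMem]
        exact fun h => absurd h.1 (not_lt.2 hxa)
      · rw [indicator_of_mem]
        exact ⟨not_le.1 hxa, hx⟩
    have hvH : IsH1 v w := ⟨hvm, hw2, hvp.integral_eq⟩
    have h1 := hw v w hvH
    have hcm : ∀ {p q : ℝ → ℂ}, MemLp p 2 ν → MemLp q 2 ν →
        IntegrableOn (fun x => conj (p x) * q x) (Iic 0) := by
      intro p q hp hq
      have := IsH1.integrable_mul_conj hq hp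
      simp_rw [mul_comm (conj (p _))]
      exact this
    have h2 : ∫ x in a..0, (conj (F x) * v x + conj (f x) * w x) = 0 := by
      have hi : IntegrableOn (fun x => conj (F x) * v x + conj (f x) * w x) (Iic 0) :=
        (hcm hF hvm).add (hcm hf hw2)
      rw [← h1, ← intervalIntegral.integral_Iic_sub_Iic
        (hi.mono_set (Iic_subset_Iic.2 ha0)) hi, sub_eq_self]
      refine setIntegral_eq_zero_of_forall_eq_zero fun x hx => ?_
      rw [hv0 x hx, hw0 x hx, mul_zero, mul_zero, add_zero]
    -- No boundary terms occur, since `v a = 0` and `Φ 0 = 0`; subtracting this from the weak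
    -- equation leaves `∫ |f - Φ|² = 0`.
    have h3 := hvp.interval_by_parts hΦp ha0 le_rfl
    rw [hΦ0, hva, map_zero, mul_zero, zero_mul, sub_zero] at h3
    have i1 : IntervalIntegrable (fun x => conj (F x) * v x + conj (f x) * w x) volume a 0 := by
      rw [intervalIntegrable_iff_integrableOn_Ioc_of_le ha0]
      exact ((hcm hF hvm).add (hcm hf hw2)).mono_set fun x hx => hx.2
    have i2 : IntervalIntegrable (fun x => w x * conj (Φ x) + v x * conj (F x)) volume a 0 := by
      rw [intervalIntegrable_iff_integrableOn_Ioc_of_le ha0]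
      refine Integrable.add ?_ ?_
      · have : MemLp w 2 (volume.restrict (Ioc a 0)) := hw2'.restrict _
        exact this.integrable_mul hΦm.star
      · exact IntegrableOn.mono_set (t := Iic 0) (IsH1.integrable_mul_conj hvm hF) fun x hx => hx.2
    have h4 := intervalIntegral.integral_sub i1 i2
    rw [h2, h3, sub_zero, intervalIntegral.integral_of_le ha0] at h4
    have h5 : ∫ x in Ioc a 0, ‖(f - Φ) x‖ ^ 2 = 0 := by
      have : ((∫ x in Ioc a 0, ‖(f - Φ) x‖ ^ 2 : ℝ) : ℂ) = 0 := by
        rw [← integral_complex_ofReal, ← h4]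
        refine setIntegral_congr_fun measurableSet_Ioc fun x hx => ?_
        have hwx : w x = f x - Φ x := by rw [hwdef, indicator_of_mem hx]; rfl
        simp only [hwx, Pi.sub_apply]
        rw [← Complex.normSq_eq_norm_sq, ← Complex.mul_conj, map_sub]
        ring
      exact_mod_cast this
    rw [integral_eq_zero_iff_of_nonneg (fun x => sq_nonneg _)
      (hdm.integrable_norm_pow (by norm_num)), Filter.EventuallyEq,
      ae_restrict_iff' measurableSet_Ioc] at h5
    filter_upwards [h5] with x hx hxm
    have h6 := hx hxm
    simp only [Pi.zero_apply, Pi.sub_apply, ne_eq, OfNat.ofNat_ne_zero, not_false_eq_true,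
      pow_eq_zero_iff, norm_eq_zero] at h6
    exact sub_eq_zero.1 h6
  have hae : f =ᵐ[ν] Φ := by
    rw [Filter.EventuallyEq, ae_restrict_iff' measurableSet_Iic]
    rw [← ae_all_iff] at key
    filter_upwards [key] with x hx hx0
    obtain ⟨n, hn⟩ := exists_nat_gt (-x)
    exact hx n ⟨by linarith, hx0⟩
  exact ⟨Φ, ⟨hf.ae_eq hae, hF, hΦp.integral_eq⟩, hΦ0, hae⟩

/-- Smooth coefficients on the half-line that are constant below `a`. -/
structure IsCoeff (a : ℝ) (ρ : ℝ → ℝ) : Prop where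
  smooth : ContDiffOn ℝ ∞ ρ (Iic 0)
  const : ∀ Z ≤ a, ρ Z = ρ a

namespace IsCoeff

variable {a : ℝ} {ρ σ : ℝ → ℝ}

theorem isWeight (h : IsCoeff a ρ) : IsWeight ρ :=
  isWeight_of_eventually_const h.smooth.continuousOn fun Z hZ => h.const Z hZ.le

theorem add_two_mul (h : IsCoeff a ρ) (h' : IsCoeff a σ) : IsCoeff a fun Z => ρ Z + 2 * σ Z :=
  ⟨h.smooth.add (contDiffOn_const.mul h'.smooth), fun Z hZ => by rw [h.const Z hZ, h'.const Z hZ]⟩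

theorem inv (h : IsCoeff a ρ) (h0 : ∀ Z ≤ 0, ρ Z ≠ 0) : IsCoeff a fun Z => (ρ Z)⁻¹ :=
  ⟨h.smooth.inv fun Z hZ => h0 Z hZ, fun Z hZ => by rw [h.const Z hZ]⟩

theorem isH1_mul (ha : a < 0) (h : IsCoeff a ρ) {u g : ℝ → ℂ} (hu : IsH1 u g) :
    IsH1 (fun Z => (ρ Z : ℂ) * u Z)
      (fun Z => ((derivWithin ρ (Iic 0) Z : ℝ) : ℂ) * u Z + (ρ Z : ℂ) * g Z) :=
  hu.weight_mul h.smooth h.isWeight (isWeight_derivWithin ha h.smooth h.const)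

end IsCoeff

theorem Profile.isCoeff_mu {μ lam : ℝ → ℝ} {ZI : ℝ} (p : Profile μ lam ZI) : IsCoeff ZI μ :=
  ⟨p.smooth_mu, p.mu_const⟩

theorem Profile.isCoeff_lam {μ lam : ℝ → ℝ} {ZI : ℝ} (p : Profile μ lam ZI) : IsCoeff ZI lam :=
  ⟨p.smooth_lam, p.lam_const⟩

namespace FormSpace

/-- The shear stress. -/
def stress₂ (μ : ℝ → ℝ) (h : ℝ) (x : FormSpace) (Z : ℝ) : ℂ :=
  (μ Z : ℂ) * (h * G₂ x Z + Complex.I * U₃ x Z)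

/-- The normal stress. -/
def stress₃ (μ lam : ℝ → ℝ) (h : ℝ) (x : FormSpace) (Z : ℝ) : ℂ :=
  ((lam Z + 2 * μ Z : ℝ) : ℂ) * (h * G₃ x Z) + Complex.I * ((lam Z : ℂ) * U₂ x Z)

/-- The zeroth order part of the first component of the operator. -/
def force₂ (μ lam : ℝ → ℝ) (h : ℝ) (x : FormSpace) (Z : ℝ) : ℂ :=
  ((lam Z + 2 * μ Z : ℝ) : ℂ) * U₂ x Z - Complex.I * h * ((lam Z : ℂ) * G₃ x Z)

/-- The zeroth order part of the second component of the operator. -/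
def force₃ (μ : ℝ → ℝ) (h : ℝ) (x : FormSpace) (Z : ℝ) : ℂ :=
  (μ Z : ℂ) * U₃ x Z - Complex.I * h * ((μ Z : ℂ) * G₂ x Z)

variable {μ lam : ℝ → ℝ} {ZI : ℝ}

theorem memLp_stress₂ (p : Profile μ lam ZI) (h : ℝ) (x : FormSpace) :
    MemLp (stress₂ μ h x) 2 ν :=
  p.isWeight_mu.memLp_mul (memLp_shear h x)

theorem memLp_stress₃ (p : Profile μ lam ZI) (h : ℝ) (x : FormSpace) :
    MemLp (stress₃ μ lam h x) 2 ν :=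
  ((p.isCoeff_lam.add_two_mul p.isCoeff_mu).isWeight.memLp_mul
    ((memLp_G₃ x).const_smul (h : ℂ))).add
    ((p.isWeight_lam.memLp_mul (memLp_U₂ x)).const_smul Complex.I)

theorem memLp_force₂ (p : Profile μ lam ZI) (h : ℝ) (x : FormSpace) :
    MemLp (force₂ μ lam h x) 2 ν :=
  ((p.isCoeff_lam.add_two_mul p.isCoeff_mu).isWeight.memLp_mul (memLp_U₂ x)).sub
    ((p.isWeight_lam.memLp_mul (memLp_G₃ x)).const_smul (Complex.I * h))

theorem memLp_force₃ (p : Profile μ lam ZI) (h : ℝ) (x : FormSpace) :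
    MemLp (force₃ μ h x) 2 ν :=
  (p.isWeight_mu.memLp_mul (memLp_U₃ x)).sub
    ((p.isWeight_mu.memLp_mul (memLp_G₂ x)).const_smul (Complex.I * h))

theorem integrable_conj_mul {f g : ℝ → ℂ} (hf : MemLp f 2 ν) (hg : MemLp g 2 ν) :
    IntegrableOn (fun x => conj (f x) * g x) (Iic 0) := by
  have := IsH1.integrable_mul_conj hg hf
  simp_rw [mul_comm (conj (f _))]
  exact this

/-- The form as the pairing of stresses and forces with the test function. -/
theorem energy_sub_mass_eq (p : Profile μ lam ZI) (h E : ℝ) (x y : FormSpace) :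
    energy μ lam h x y - E * mass x y
      = (∫ Z in Iic 0, (conj (force₂ μ lam h x Z - E * U₂ x Z) * U₂ y Z
          + conj (h * stress₂ μ h x Z) * G₂ y Z))
        + ∫ Z in Iic 0, (conj (force₃ μ h x Z - E * U₃ x Z) * U₃ y Z
          + conj (h * stress₃ μ lam h x Z) * G₃ y Z) := by
  have i1 := p.isWeight_mu.integrable_conj_mul (memLp_shear h x) (memLp_shear h y)
  have i2 := p.isWeight_lam.integrable_conj_mul (memLp_div h x) (memLp_div h y)
  have i3 := (p.isWeight_mu.integrable_conj_mul (memLp_G₃ x) (memLp_G₃ y)).const_mul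
    ((2 * h ^ 2 : ℝ) : ℂ)
  have i4 := (p.isWeight_mu.integrable_conj_mul (memLp_U₂ x) (memLp_U₂ y)).const_mul
    ((2 : ℝ) : ℂ)
  have j1 := IsWeight.one.integrable_conj_mul (memLp_U₂ x) (memLp_U₂ y)
  have j2 := IsWeight.one.integrable_conj_mul (memLp_U₃ x) (memLp_U₃ y)
  have j3 := (j1.add j2).const_mul (E : ℂ)
  have k1 := integrable_conj_mul ((memLp_force₂ p h x).sub ((memLp_U₂ x).const_smul (E : ℂ)))
    (memLp_U₂ y)
  have k2 := integrable_conj_mul ((memLp_stress₂ p h x).const_smul (h : ℂ)) (memLp_G₂ y)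
  have k3 := integrable_conj_mul ((memLp_force₃ p h x).sub ((memLp_U₃ x).const_smul (E : ℂ)))
    (memLp_U₃ y)
  have k4 := integrable_conj_mul ((memLp_stress₃ p h x).const_smul (h : ℂ)) (memLp_G₃ y)
  have e1 := integral_add i1 i2
  have e2 := integral_add (i1.add i2) i3
  have e3 := integral_add ((i1.add i2).add i3) i4
  have e4 := integral_add j1 j2
  have e5 := integral_sub (((i1.add i2).add i3).add i4) j3
  have e6 := integral_add (k1.add k2) (k3.add k4)
  simp only [Pi.add_apply, Pi.sub_apply, Pi.smul_apply, smul_eq_mul] at e2 e3 e5 e6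
  rw [integral_const_mul] at e2 e3 e5
  rw [e3, e2, e1, e4] at e5
  unfold energy mass weightedInner
  rw [← e5, ← e6]
  refine integral_congr_ae (Eventually.of_forall fun Z => ?_)
  simp only [force₂, force₃, stress₂, stress₃, shear_apply, div_apply, map_add, map_sub, map_mul,
    Complex.conj_ofReal, Complex.conj_I]
  push_cast
  ring_nf
  simp only [Complex.I_sq]
  ring

/-- An element of the form domain given by two functions in `H¹`. -/
def ofMemH1 {φ : (ℝ → ℂ) × (ℝ → ℂ)} (h₂ : MemH1 φ.1) (h₃ : MemH1 φ.2) : FormSpace :=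
  ⟨((φ.1, D φ.1), (φ.2, D φ.2)), h₂.isH1, h₃.isH1⟩

end FormSpace

section

open FormSpace

variable {μ lam : ℝ → ℝ} {ZI : ℝ}

/-- This puts the operator in divergence form. Vanishing of the stress at `0` is the first Neumann
condition multiplied by `μ 0`. -/
theorem isH1_stress₂ (p : Profile μ lam ZI) (h : ℝ) {φ : (ℝ → ℂ) × (ℝ → ℂ)}
    (h₂ : MemH2 φ.1) (h₃ : MemH2 φ.2) :
    MemH1 (stress₂ μ h (ofMemH1 h₂.memH1 h₃.memH1)) ∧
    ∀ᵐ Z ∂ν, (op μ lam h φ).1 Z = force₂ μ lam h (ofMemH1 h₂.memH1 h₃.memH1) Z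
      - h * D (stress₂ μ h (ofMemH1 h₂.memH1 h₃.memH1)) Z := by
  have a := p.isCoeff_mu.isH1_mul p.ZI_neg h₂.memH1_deriv.isH1
  have b := p.isCoeff_mu.isH1_mul p.ZI_neg h₃.memH1.isH1
  have c := ((a.smul (h : ℂ)).add (b.smul Complex.I)).congr
    (u' := stress₂ μ h (ofMemH1 h₂.memH1 h₃.memH1)) (fun Z _ => by
      simp only [Pi.add_apply, Pi.smul_apply, smul_eq_mul]
      change (μ Z : ℂ) * (h * D φ.1 Z + Complex.I * φ.2 Z) = _
      ring) (EventuallyEq.refl _ _)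
  refine ⟨c.memH1, ?_⟩
  filter_upwards [a.ae_D_eq, b.ae_D_eq, c.ae_D_eq] with Z ha hb hc
  rw [hc, op]
  simp only [Pi.add_apply, Pi.smul_apply, smul_eq_mul]
  rw [ha, hb]
  change _ = ((lam Z + 2 * μ Z : ℝ) : ℂ) * φ.1 Z - Complex.I * h * ((lam Z : ℂ) * D φ.2 Z) - _
  push_cast
  ring

theorem isH1_stress₃ (p : Profile μ lam ZI) (h : ℝ) {φ : (ℝ → ℂ) × (ℝ → ℂ)}
    (h₂ : MemH2 φ.1) (h₃ : MemH2 φ.2) :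
    MemH1 (stress₃ μ lam h (ofMemH1 h₂.memH1 h₃.memH1)) ∧
    ∀ᵐ Z ∂ν, (op μ lam h φ).2 Z = force₃ μ h (ofMemH1 h₂.memH1 h₃.memH1) Z
      - h * D (stress₃ μ lam h (ofMemH1 h₂.memH1 h₃.memH1)) Z := by
  have a := (p.isCoeff_lam.add_two_mul p.isCoeff_mu).isH1_mul p.ZI_neg h₃.memH1_deriv.isH1
  have b := p.isCoeff_lam.isH1_mul p.ZI_neg h₂.memH1.isH1
  have c := ((a.smul (h : ℂ)).add (b.smul Complex.I)).congr
    (u' := stress₃ μ lam h (ofMemH1 h₂.memH1 h₃.memH1)) (fun Z _ => by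
      simp only [Pi.add_apply, Pi.smul_apply, smul_eq_mul]
      change ((lam Z + 2 * μ Z : ℝ) : ℂ) * (h * D φ.2 Z) + Complex.I * ((lam Z : ℂ) * φ.1 Z) = _
      ring) (EventuallyEq.refl _ _)
  refine ⟨c.memH1, ?_⟩
  filter_upwards [a.ae_D_eq, b.ae_D_eq, c.ae_D_eq] with Z ha hb hc
  rw [hc, op]
  simp only [Pi.add_apply, Pi.smul_apply, smul_eq_mul]
  simp only [Complex.ofReal_add, Complex.ofReal_mul, Complex.ofReal_ofNat] at ha
  rw [ha, hb]
  change _ = (μ Z : ℂ) * φ.2 Z - Complex.I * h * ((μ Z : ℂ) * D φ.1 Z) - _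
  push_cast
  ring

/-- Eigenfunctions are eigenvectors of the quadratic form. -/
theorem IsEigenfunction.energy_eq (p : Profile μ lam ZI) {h E : ℝ} {φ : (ℝ → ℂ) × (ℝ → ℂ)}
    (hφ : IsEigenfunction μ lam h E φ) (y : FormSpace) :
    energy μ lam h
      (ofMemH1 hφ.memDomain.memH2_fst.memH1 hφ.memDomain.memH2_snd.memH1) y
      = E * mass (ofMemH1 hφ.memDomain.memH2_fst.memH1 hφ.memDomain.memH2_snd.memH1) y := by
  obtain ⟨s₂, o₂⟩ := isH1_stress₂ p h hφ.memDomain.memH2_fst hφ.memDomain.memH2_snd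
  obtain ⟨s₃, o₃⟩ := isH1_stress₃ p h hφ.memDomain.memH2_fst hφ.memDomain.memH2_snd
  have n₂ := hφ.memDomain.neumann_fst
  have n₃ := hφ.memDomain.neumann_snd
  have q₂ := hφ.eq_fst
  have q₃ := hφ.eq_snd
  set x := ofMemH1 hφ.memDomain.memH2_fst.memH1 hφ.memDomain.memH2_snd.memH1
  have z₂ : stress₂ μ h x 0 = 0 := by
    change (μ 0 : ℂ) * (h * D φ.1 0 + Complex.I * φ.2 0) = 0
    rw [add_comm, n₂, mul_zero]
  have z₃ : stress₃ μ lam h x 0 = 0 := by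
    change ((lam 0 + 2 * μ 0 : ℝ) : ℂ) * (h * D φ.2 0) + Complex.I * ((lam 0 : ℂ) * φ.1 0) = 0
    rw [← n₃]; push_cast; ring
  rw [← sub_eq_zero, energy_sub_mass_eq p]
  have b₂ := (isH1_fst y).integral_by_parts s₂.isH1 le_rfl
  have b₃ := (isH1_snd y).integral_by_parts s₃.isH1 le_rfl
  rw [z₂, map_zero, mul_zero] at b₂
  rw [z₃, map_zero, mul_zero] at b₃
  have c₂ : ∫ Z in Iic 0, (conj (force₂ μ lam h x Z - E * U₂ x Z) * U₂ y Z
      + conj (h * stress₂ μ h x Z) * G₂ y Z) = 0 := by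
    rw [← mul_zero (h : ℂ), ← b₂, ← integral_const_mul]
    refine integral_congr_ae ?_
    filter_upwards [o₂, q₂] with Z ho hq
    have : force₂ μ lam h x Z - E * U₂ x Z = h * D (stress₂ μ h x) Z := by
      rw [ho] at hq
      change _ = (E : ℂ) * U₂ x Z at hq
      rw [← hq]; ring
    rw [this, map_mul, map_mul, Complex.conj_ofReal]
    ring
  have c₃ : ∫ Z in Iic 0, (conj (force₃ μ h x Z - E * U₃ x Z) * U₃ y Z
      + conj (h * stress₃ μ lam h x Z) * G₃ y Z) = 0 := by
    rw [← mul_zero (h : ℂ), ← b₃, ← integral_const_mul]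
    refine integral_congr_ae ?_
    filter_upwards [o₃, q₃] with Z ho hq
    have : force₃ μ h x Z - E * U₃ x Z = h * D (stress₃ μ lam h x) Z := by
      rw [ho] at hq
      change _ = (E : ℂ) * U₃ x Z at hq
      rw [← hq]; ring
    rw [this, map_mul, map_mul, Complex.conj_ofReal]
    ring
  rw [c₂, c₃, add_zero]

/-- Eigenvectors of the quadratic form are eigenfunctions of the operator. -/
theorem isEigenfunction_of_energy_eq (p : Profile μ lam ZI) {h E : ℝ} (hh : 0 < h)
    {x : FormSpace} (hx : ∀ y, energy μ lam h x y = E * mass x y) (hx0 : 0 < (mass x x).re) :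
    IsEigenfunction μ lam h E (U₂ x, U₃ x) := by
  have hhc : (h : ℂ) ≠ 0 := by exact_mod_cast hh.ne'
  have hμ : ∀ Z ≤ 0, (μ Z : ℂ) ≠ 0 := fun Z hZ => by
    exact_mod_cast (p.mu_pos.trans_le (p.mu_ge hZ)).ne'
  have hN : ∀ Z ≤ 0, ((lam Z + 2 * μ Z : ℝ) : ℂ) ≠ 0 := fun Z hZ => by
    exact_mod_cast ((p.mu_pos.trans p.mu_lt).trans_le (p.lam_add_two_mu_ge hZ)).ne'
  -- Testing with `(v, 0)` and then with `(0, v)` decouples the weak equation into one conservation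
  -- law for each stress.
  obtain ⟨Φ₂, hΦ₂, hΦ₂0, hf₂⟩ := exists_isH1_of_weak
    (f := fun Z => h * stress₂ μ h x Z) (F := fun Z => force₂ μ lam h x Z - E * U₂ x Z)
    ((memLp_stress₂ p h x).const_smul (h : ℂ))
    ((memLp_force₂ p h x).sub ((memLp_U₂ x).const_smul (E : ℂ))) (fun v w hv => by
      have h1 := energy_sub_mass_eq p h E x ⟨((v, w), (0, 0)), hv, IsH1.zero⟩
      rw [hx, sub_self] at h1
      have h2 : ∀ Z, conj (force₃ μ h x Z - E * U₃ x Z) * (0 : ℂ)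
          + conj (h * stress₃ μ lam h x Z) * 0 = 0 := fun Z => by ring
      change 0 = (∫ Z in Iic 0, (conj (force₂ μ lam h x Z - E * U₂ x Z) * v Z
          + conj (h * stress₂ μ h x Z) * w Z))
        + ∫ Z in Iic 0, (conj (force₃ μ h x Z - E * U₃ x Z) * (0 : ℂ)
          + conj (h * stress₃ μ lam h x Z) * 0) at h1
      simp_rw [h2] at h1
      simpa using h1.symm)
  obtain ⟨Φ₃, hΦ₃, hΦ₃0, hf₃⟩ := exists_isH1_of_weak
    (f := fun Z => h * stress₃ μ lam h x Z) (F := fun Z => force₃ μ h x Z - E * U₃ x Z)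
    ((memLp_stress₃ p h x).const_smul (h : ℂ))
    ((memLp_force₃ p h x).sub ((memLp_U₃ x).const_smul (E : ℂ))) (fun v w hv => by
      have h1 := energy_sub_mass_eq p h E x ⟨((0, 0), (v, w)), IsH1.zero, hv⟩
      rw [hx, sub_self] at h1
      have h2 : ∀ Z, conj (force₂ μ lam h x Z - E * U₂ x Z) * (0 : ℂ)
          + conj (h * stress₂ μ h x Z) * 0 = 0 := fun Z => by ring
      change 0 = (∫ Z in Iic 0, (conj (force₂ μ lam h x Z - E * U₂ x Z) * (0 : ℂ)
          + conj (h * stress₂ μ h x Z) * 0))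
        + ∫ Z in Iic 0, (conj (force₃ μ h x Z - E * U₃ x Z) * v Z
          + conj (h * stress₃ μ lam h x Z) * w Z) at h1
      simp_rw [h2] at h1
      simpa using h1.symm)
  have a₂ := (((p.isCoeff_mu.inv fun Z hZ => by exact_mod_cast hμ Z hZ).isH1_mul p.ZI_neg
    hΦ₂).smul ((h : ℂ)⁻¹ ^ 2)).add ((isH1_snd x).smul (-(Complex.I / h)))
  have a₃ := ((((p.isCoeff_lam.add_two_mul p.isCoeff_mu).inv fun Z hZ => by
      exact_mod_cast hN Z hZ).isH1_mul p.ZI_neg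
    ((hΦ₃.smul ((h : ℂ)⁻¹ ^ 2)).add ((p.isCoeff_lam.isH1_mul p.ZI_neg (isH1_fst x)).smul
      (-(Complex.I / h))))))
  -- `K₂` and `K₃` are the derivatives solved for from the stresses. They lie in `H¹` since `μ` and
  -- `lam + 2 μ` are smooth and nowhere zero.
  set K₂ : ℝ → ℂ := (h : ℂ)⁻¹ ^ 2 • (fun Z => (((μ Z)⁻¹ : ℝ) : ℂ) * Φ₂ Z)
    + (-(Complex.I / h)) • U₃ x with hK₂
  set K₃ : ℝ → ℂ := fun Z => (((lam Z + 2 * μ Z)⁻¹ : ℝ) : ℂ) * (((h : ℂ)⁻¹ ^ 2 • Φ₃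
    + (-(Complex.I / h)) • fun Z => (lam Z : ℂ) * U₂ x Z) Z) with hK₃
  have eK₂ : ∀ Z ≤ 0, (μ Z : ℂ) * (h * K₂ Z + Complex.I * U₃ x Z) = Φ₂ Z / h := by
    intro Z hZ
    have := hμ Z hZ
    simp only [hK₂, Pi.add_apply, Pi.smul_apply, smul_eq_mul]
    push_cast
    field_simp
    ring
  have eK₃ : ∀ Z ≤ 0, ((lam Z + 2 * μ Z : ℝ) : ℂ) * (h * K₃ Z)
      + Complex.I * ((lam Z : ℂ) * U₂ x Z) = Φ₃ Z / h := by
    intro Z hZ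
    have := hN Z hZ
    simp only [hK₃, Pi.add_apply, Pi.smul_apply, smul_eq_mul, Complex.ofReal_inv]
    field_simp
    ring
  have g₂ : G₂ x =ᵐ[ν] K₂ := by
    filter_upwards [hf₂, ae_restrict_mem measurableSet_Iic] with Z hZ hZ0
    have h1 := eK₂ Z hZ0
    rw [← hZ, stress₂, mul_div_cancel_left₀ _ hhc] at h1
    have h2 := mul_left_cancel₀ (hμ Z hZ0) h1
    exact (mul_left_cancel₀ hhc (add_right_cancel h2)).symm
  have g₃ : G₃ x =ᵐ[ν] K₃ := by
    filter_upwards [hf₃, ae_restrict_mem measurableSet_Iic] with Z hZ hZ0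
    have h1 := eK₃ Z hZ0
    rw [← hZ, stress₃, mul_div_cancel_left₀ _ hhc] at h1
    have h2 := mul_left_cancel₀ (hN Z hZ0) (add_right_cancel h1)
    exact (mul_left_cancel₀ hhc h2).symm
  -- `G₂ x` is determined only almost everywhere; its continuous representative `K₂` is the true
  -- derivative at every point, including `0`.
  have d₂ : EqOn (D (U₂ x)) K₂ (Iic 0) :=
    ((isH1_fst x).congr (fun _ _ => rfl) g₂.symm).D_eq a₂.continuousOn
  have d₃ : EqOn (D (U₃ x)) K₃ (Iic 0) :=
    ((isH1_snd x).congr (fun _ _ => rfl) g₃.symm).D_eq a₃.continuousOn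
  have m₂ : MemH2 (U₂ x) :=
    ⟨(isH1_fst x).memH1, (a₂.congr d₂ (EventuallyEq.refl _ _)).memH1⟩
  have m₃ : MemH2 (U₃ x) :=
    ⟨(isH1_snd x).memH1, (a₃.congr d₃ (EventuallyEq.refl _ _)).memH1⟩
  obtain ⟨-, o₂⟩ := isH1_stress₂ (φ := (U₂ x, U₃ x)) p h m₂ m₃
  obtain ⟨-, o₃⟩ := isH1_stress₃ (φ := (U₂ x, U₃ x)) p h m₂ m₃
  set x' : FormSpace := ofMemH1 (φ := (U₂ x, U₃ x)) m₂.memH1 m₃.memH1 with hx'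
  have t₂ : EqOn (stress₂ μ h x') ((h : ℂ)⁻¹ • Φ₂) (Iic 0) := by
    intro Z hZ
    change (μ Z : ℂ) * (h * D (U₂ x) Z + Complex.I * U₃ x Z) = (h : ℂ)⁻¹ * Φ₂ Z
    rw [d₂ hZ, eK₂ Z hZ, div_eq_inv_mul]
  have t₃ : EqOn (stress₃ μ lam h x') ((h : ℂ)⁻¹ • Φ₃) (Iic 0) := by
    intro Z hZ
    change ((lam Z + 2 * μ Z : ℝ) : ℂ) * (h * D (U₃ x) Z)
      + Complex.I * ((lam Z : ℂ) * U₂ x Z) = (h : ℂ)⁻¹ * Φ₃ Z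
    rw [d₃ hZ, eK₃ Z hZ, div_eq_inv_mul]
  refine ⟨⟨m₂, m₃, ?_, ?_⟩, ?_, ?_, ?_⟩
  -- The Neumann conditions are natural: they express `Φ₂ 0 = 0` and `Φ₃ 0 = 0`.
  · have h1 := eK₂ 0 le_rfl
    rw [hΦ₂0, zero_div, mul_eq_zero, or_iff_right (hμ 0 le_rfl)] at h1
    rw [d₂ (mem_Iic.2 le_rfl), add_comm]
    exact h1
  · have h1 := eK₃ 0 le_rfl
    rw [hΦ₃0, zero_div] at h1
    rw [d₃ (mem_Iic.2 le_rfl), ← h1]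
    push_cast
    ring
  · by_contra hcon
    push Not at hcon
    rw [mass_re] at hx0
    have : ∫ Z in Iic 0, massDensity x Z = 0 := by
      refine setIntegral_eq_zero_of_forall_eq_zero fun Z hZ => ?_
      have := hcon Z hZ
      simp only [Prod.mk.injEq] at this
      rw [massDensity, this.1, this.2]
      simp
    linarith
  · filter_upwards [o₂, g₃, ae_restrict_mem measurableSet_Iic, (hΦ₂.smul (h : ℂ)⁻¹).ae_D_eq]
      with Z ho hg hZ hd
    rw [ho, D_congr t₂ hZ, hd]
    change ((lam Z + 2 * μ Z : ℝ) : ℂ) * U₂ x Z - Complex.I * h * ((lam Z : ℂ) * D (U₃ x) Z)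
      - h * ((h : ℂ)⁻¹ * (force₂ μ lam h x Z - E * U₂ x Z)) = E * U₂ x Z
    rw [d₃ hZ, ← hg, force₂, mul_inv_cancel_left₀ hhc]
    ring
  · filter_upwards [o₃, g₂, ae_restrict_mem measurableSet_Iic, (hΦ₃.smul (h : ℂ)⁻¹).ae_D_eq]
      with Z ho hg hZ hd
    rw [ho, D_congr t₃ hZ, hd]
    change (μ Z : ℂ) * U₃ x Z - Complex.I * h * ((μ Z : ℂ) * D (U₂ x) Z)
      - h * ((h : ℂ)⁻¹ * (force₃ μ h x Z - E * U₃ x Z)) = E * U₃ x Z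
    rw [d₂ hZ, ← hg, force₃, mul_inv_cancel_left₀ hhc]
    ring

end

/-! ### Exponential trial functions -/

theorem integrableOn_exp_mul {c : ℝ} (hc : 0 < c) :
    IntegrableOn (fun Z : ℝ => Real.exp (c * Z)) (Iic 0) :=
  integrableOn_exp_mul_Iic hc 0

theorem integral_exp_mul {c : ℝ} (hc : 0 < c) :
    ∫ Z in Iic (0 : ℝ), Real.exp (c * Z) = 1 / c := by
  rw [integral_exp_mul_Iic hc]; simp

theorem isH1_exp {c : ℝ} (hc : 0 < c) :
    IsH1 (fun Z => (Real.exp (c * Z) : ℂ)) (fun Z => ((c * Real.exp (c * Z) : ℝ) : ℂ)) := by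
  have h1 : MemLp (fun Z => Real.exp (c * Z)) 2 ν := by
    rw [memLp_two_iff_integrable_sq (by fun_prop)]
    refine (integrableOn_exp_mul (c := 2 * c) (by positivity)).congr_fun (fun Z _ => ?_)
      measurableSet_Iic
    simp only [← Real.exp_nat_mul]
    congr 1; push_cast; ring
  refine ⟨h1.ofReal, (h1.const_mul c).ofReal, fun a b _ _ => ?_⟩
  rw [intervalIntegral.integral_ofReal, ← Complex.ofReal_sub]
  congr 1
  refine intervalIntegral.integral_eq_sub_of_hasDerivAt
    (f := fun x => Real.exp (c * x)) (f' := fun x => c * Real.exp (c * x)) (fun x _ => ?_)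
    (Continuous.intervalIntegrable (by fun_prop) _ _)
  have h2 := ((hasDerivAt_id x).const_mul c).exp
  simpa [mul_comm] using h2

namespace FormSpace

/-- The trial function `(0, e^{cZ})`. -/
def expTrial {c : ℝ} (hc : 0 < c) : FormSpace := ⟨((0, 0), (_, _)), IsH1.zero, isH1_exp hc⟩

/-- The trial function `(0, a e^{Z/s} + b e^{2Z/s})`. -/
def trial {s : ℝ} (hs : 0 < s) (a b : ℂ) : FormSpace :=
  a • expTrial (inv_pos.2 hs) + b • expTrial (mul_pos two_pos (inv_pos.2 hs))

section

variable {s : ℝ} (hs : 0 < s) (a b : ℂ)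

theorem trial_U₂ (Z : ℝ) : U₂ (trial hs a b) Z = 0 := by
  change a * 0 + b * 0 = 0; ring

theorem trial_G₂ (Z : ℝ) : G₂ (trial hs a b) Z = 0 := by
  change a * 0 + b * 0 = 0; ring

theorem trial_U₃ (Z : ℝ) : U₃ (trial hs a b) Z
    = a * (Real.exp (s⁻¹ * Z) : ℂ) + b * (Real.exp (2 * s⁻¹ * Z) : ℂ) := rfl

theorem trial_G₃ (Z : ℝ) : G₃ (trial hs a b) Z
    = a * ((s⁻¹ * Real.exp (s⁻¹ * Z) : ℝ) : ℂ)
      + b * ((2 * s⁻¹ * Real.exp (2 * s⁻¹ * Z) : ℝ) : ℂ) := rfl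

theorem norm_add_sq_exp (a b : ℂ) (x y : ℝ) : ‖a * (x : ℂ) + b * (y : ℂ)‖ ^ 2
    = ‖a‖ ^ 2 * x ^ 2 + 2 * (a * conj b).re * (x * y) + ‖b‖ ^ 2 * y ^ 2 := by
  simp only [Complex.sq_norm, Complex.normSq_apply, Complex.add_re, Complex.add_im,
    Complex.mul_re, Complex.mul_im, Complex.ofReal_re, Complex.ofReal_im, Complex.conj_re,
    Complex.conj_im]
  ring

theorem norm_add_sq_le (a b : ℂ) (x y : ℝ) : ‖a * (x : ℂ) + b * (y : ℂ)‖ ^ 2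
    ≤ 2 * (‖a‖ ^ 2 * x ^ 2) + 2 * (‖b‖ ^ 2 * y ^ 2) := by
  have h1 := norm_add_le (a * (x : ℂ)) (b * (y : ℂ))
  rw [norm_mul, norm_mul, Complex.norm_real, Complex.norm_real, Real.norm_eq_abs,
    Real.norm_eq_abs] at h1
  have h2 := pow_le_pow_left₀ (norm_nonneg _) h1 2
  rw [← sq_abs x, ← sq_abs y]
  linarith [sq_nonneg (‖a‖ * |x| - ‖b‖ * |y|)]

/-- The Gram matrix of the two exponentials is `s` times a fixed positive definite matrix.
Multiplied by `72` it is `s` times the matrix with rows `36, 24` and `24, 18`, which is at least the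
identity since `35 · 17 > 24²`. -/
theorem trial_mass_ge : s * (‖a‖ ^ 2 + ‖b‖ ^ 2) ≤ 72 * (mass (trial hs a b) (trial hs a b)).re := by
  have e : ∀ Z, massDensity (trial hs a b) Z = ‖a‖ ^ 2 * Real.exp (2 * s⁻¹ * Z)
      + 2 * (a * conj b).re * Real.exp (3 * s⁻¹ * Z) + ‖b‖ ^ 2 * Real.exp (4 * s⁻¹ * Z) := by
    intro Z
    rw [massDensity, trial_U₂, trial_U₃, norm_add_sq_exp, ← Real.exp_nat_mul, ← Real.exp_nat_mul,
      ← Real.exp_add]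
    simp only [norm_zero]
    push_cast
    ring_nf
  have i2 := (integrableOn_exp_mul (c := 2 * s⁻¹) (by positivity)).const_mul (‖a‖ ^ 2)
  have i3 := (integrableOn_exp_mul (c := 3 * s⁻¹) (by positivity)).const_mul (2 * (a * conj b).re)
  have i4 := (integrableOn_exp_mul (c := 4 * s⁻¹) (by positivity)).const_mul (‖b‖ ^ 2)
  have e1 := integral_add (i2.add i3) i4
  simp only [Pi.add_apply] at e1
  rw [mass_re]
  simp_rw [e]
  rw [e1, integral_add i2 i3, integral_const_mul, integral_const_mul, integral_const_mul,
    integral_exp_mul (by positivity), integral_exp_mul (by positivity),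
    integral_exp_mul (by positivity)]
  have h1 : |(a * conj b).re| ≤ ‖a‖ * ‖b‖ := by
    refine (Complex.abs_re_le_norm _).trans ?_
    rw [norm_mul, RCLike.norm_conj]
  have h2 := neg_abs_le (a * conj b).re
  have e2 : 72 * (‖a‖ ^ 2 * (1 / (2 * s⁻¹)) + 2 * (a * conj b).re * (1 / (3 * s⁻¹))
      + ‖b‖ ^ 2 * (1 / (4 * s⁻¹)))
      = s * (36 * ‖a‖ ^ 2 + 48 * (a * conj b).re + 18 * ‖b‖ ^ 2) := by
    field_simp
    ring
  rw [e2]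
  refine mul_le_mul_of_nonneg_left ?_ hs.le
  nlinarith [sq_nonneg (35 * ‖a‖ - 24 * ‖b‖), sq_nonneg ‖b‖]

/-- With `φ₂ = 0` the density is `μ|φ₃|² + (λ + 2μ) h²|φ₃'|²`. One factor `e^{Z/s}` absorbs
`(-Z/s)^q`, at most `2` after absorption for `q ≤ 2`; another is left to integrate to `s`. The
constant `576` is `8 · 72`, with `72` from `trial_mass_ge`. -/
theorem trial_energy_le {μ lam : ℝ → ℝ} {ZI : ℝ} (p : Profile μ lam ZI) {B M : ℝ} {q : ℕ}
    (hq : q ≤ 2) (hB0 : 0 ≤ B) (hB : ∀ Z ≤ 0, μ Z ≤ μ 0 + B * (-Z) ^ q)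
    (hM0 : 0 ≤ M) (hM : ∀ Z ≤ 0, lam Z + 2 * μ Z ≤ M) (h : ℝ) :
    (energy μ lam h (trial hs a b) (trial hs a b)).re ≤
      (μ 0 + 576 * (B + M) * (s ^ q + h ^ 2 / s ^ 2))
        * (mass (trial hs a b) (trial hs a b)).re := by
  set x := trial hs a b with hx
  set N := ‖a‖ ^ 2 + ‖b‖ ^ 2 with hN
  have hN0 : 0 ≤ N := by positivity
  have hpt : ∀ Z ≤ 0, energyDensity μ lam h x Z ≤ μ 0 * massDensity x Z
      + 8 * N * (B * s ^ q + M * (h ^ 2 / s ^ 2)) * Real.exp (s⁻¹ * Z) := by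
    intro Z hZ
    set t := -(s⁻¹ * Z) with ht
    have ht0 : 0 ≤ t := by
      rw [ht]; have := mul_nonpos_of_nonneg_of_nonpos (inv_pos.2 hs).le hZ; linarith
    have hst : -Z = s * t := by rw [ht]; field_simp
    have eE : Real.exp (s⁻¹ * Z) = Real.exp (-t) := by rw [ht, neg_neg]
    have eE2 : Real.exp (2 * s⁻¹ * Z) = Real.exp (-t) ^ 2 := by
      rw [← Real.exp_nat_mul, ht]; congr 1; push_cast; ring
    have hE1 : Real.exp (-t) ≤ 1 := Real.exp_le_one_iff.2 (by linarith)
    have hEp := Real.exp_pos (-t)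
    have htq : t ^ q * Real.exp (-t) ≤ 2 := by
      rw [Real.exp_neg, ← div_eq_mul_inv, div_le_iff₀ (Real.exp_pos t)]
      have := Real.quadratic_le_exp_of_nonneg ht0
      interval_cases q <;> nlinarith
    rw [eE]
    have e3 : G₃ x Z = ((s⁻¹ : ℝ) : ℂ) * (a * ((Real.exp (-t) : ℝ) : ℂ)
        + b * ((2 * Real.exp (-t) ^ 2 : ℝ) : ℂ)) := by
      rw [hx, trial_G₃, eE, eE2]; push_cast; ring
    have e4 : U₃ x Z = a * ((Real.exp (-t) : ℝ) : ℂ) + b * ((Real.exp (-t) ^ 2 : ℝ) : ℂ) := by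
      rw [hx, trial_U₃, eE, eE2]
    have e5 : energyDensity μ lam h x Z
        = μ Z * ‖U₃ x Z‖ ^ 2 + (lam Z + 2 * μ Z) * (h ^ 2 * ‖G₃ x Z‖ ^ 2) := by
      rw [energyDensity, shear_apply, div_apply, hx, trial_U₂, trial_G₂, mul_zero, zero_add,
        mul_zero, add_zero, norm_mul, norm_mul, Complex.norm_I, Complex.norm_real, one_mul, mul_pow,
        Real.norm_eq_abs, sq_abs, norm_zero]
      ring
    have e6 : massDensity x Z = ‖U₃ x Z‖ ^ 2 := by
      rw [massDensity, hx, trial_U₂, norm_zero]; ring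
    generalize Real.exp (-t) = y at *
    have hy3 : y ^ 2 ≤ y := by nlinarith
    have hy2 : y ^ 4 ≤ y ^ 2 := by nlinarith [mul_le_mul hy3 hy3 (by positivity) hEp.le]
    have hU : ‖U₃ x Z‖ ^ 2 ≤ 2 * N * y ^ 2 := by
      rw [e4]
      refine (norm_add_sq_le a b y (y ^ 2)).trans ?_
      have := mul_le_mul_of_nonneg_left hy2 (sq_nonneg ‖b‖)
      rw [hN]; linarith
    have hG : ‖G₃ x Z‖ ^ 2 ≤ 8 * N / s ^ 2 * y ^ 2 := by
      rw [e3, norm_mul, mul_pow, Complex.norm_real, Real.norm_of_nonneg (inv_pos.2 hs).le]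
      have h1 : ‖a * ((y : ℝ) : ℂ) + b * ((2 * y ^ 2 : ℝ) : ℂ)‖ ^ 2 ≤ 8 * N * y ^ 2 := by
        refine (norm_add_sq_le a b y (2 * y ^ 2)).trans ?_
        have := mul_le_mul_of_nonneg_left hy2 (sq_nonneg ‖b‖)
        have h2 : 0 ≤ ‖a‖ ^ 2 * y ^ 2 := by positivity
        rw [hN]; linarith
      calc _ ≤ s⁻¹ ^ 2 * (8 * N * y ^ 2) := mul_le_mul_of_nonneg_left h1 (by positivity)
        _ = _ := by field_simp
    have k1 : μ Z * ‖U₃ x Z‖ ^ 2 ≤ μ 0 * ‖U₃ x Z‖ ^ 2 + 8 * N * (B * s ^ q) * y := by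
      have h1 := mul_le_mul_of_nonneg_right (hB Z hZ) (sq_nonneg ‖U₃ x Z‖)
      have h2 : B * (-Z) ^ q * ‖U₃ x Z‖ ^ 2 ≤ 8 * N * (B * s ^ q) * y := by
        rw [hst, mul_pow]
        calc B * (s ^ q * t ^ q) * ‖U₃ x Z‖ ^ 2 ≤ B * (s ^ q * t ^ q) * (2 * N * y ^ 2) :=
              mul_le_mul_of_nonneg_left hU (by positivity)
          _ = 2 * N * (B * s ^ q) * y * (t ^ q * y) := by ring
          _ ≤ 2 * N * (B * s ^ q) * y * 2 := mul_le_mul_of_nonneg_left htq (by positivity)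
          _ ≤ _ := by
            have : 0 ≤ N * (B * s ^ q) * y := by positivity
            linarith
      linarith
    have k2 : (lam Z + 2 * μ Z) * (h ^ 2 * ‖G₃ x Z‖ ^ 2) ≤ 8 * N * (M * (h ^ 2 / s ^ 2)) * y := by
      calc _ ≤ M * (h ^ 2 * (8 * N / s ^ 2 * y ^ 2)) := by gcongr; exact hM Z hZ
        _ = 8 * N * (M * (h ^ 2 / s ^ 2)) * y ^ 2 := by ring
        _ ≤ _ := mul_le_mul_of_nonneg_left hy3 (by positivity)
    rw [e5, e6]
    linarith
  have i1 := (integrable_massDensity x).const_mul (μ 0)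
  have i2 := (integrableOn_exp_mul (inv_pos.2 hs)).const_mul
    (8 * N * (B * s ^ q + M * (h ^ 2 / s ^ 2)))
  have h1 := setIntegral_mono_on (integrable_energyDensity p.isWeight_mu p.isWeight_lam h x)
    (i1.add i2) measurableSet_Iic hpt
  simp only [Pi.add_apply] at h1
  rw [integral_add i1 i2, integral_const_mul, integral_const_mul,
    integral_exp_mul (inv_pos.2 hs), one_div, inv_inv] at h1
  rw [energy_re p.isWeight_mu p.isWeight_lam]
  refine h1.trans ?_
  rw [← mass_re, add_mul]
  refine add_le_add le_rfl ?_
  have h2 := trial_mass_ge hs a b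
  have h3 : B * s ^ q + M * (h ^ 2 / s ^ 2) ≤ (B + M) * (s ^ q + h ^ 2 / s ^ 2) := by
    have c1 : 0 ≤ B * (h ^ 2 / s ^ 2) := by positivity
    have c2 : 0 ≤ M * s ^ q := by positivity
    linarith
  calc _ = 8 * (B * s ^ q + M * (h ^ 2 / s ^ 2)) * (s * N) := by ring
    _ ≤ 8 * ((B + M) * (s ^ q + h ^ 2 / s ^ 2)) * (72 * (mass x x).re) := by gcongr
    _ = _ := by ring

end

end FormSpace

/-! ### Existence, uniqueness and bounds for the second eigenvalue -/

open FormSpace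

variable {μ lam : ℝ → ℝ} {ZI : ℝ}

theorem FormSpace.mass_eq_zero_of_eqOn {x y : FormSpace} (h₂ : ∀ Z ≤ 0, U₂ y Z = 0)
    (h₃ : ∀ Z ≤ 0, U₃ y Z = 0) : mass x y = 0 := by
  have e : ∀ f g : ℝ → ℂ, (∀ Z ≤ 0, g Z = 0) → weightedInner (fun _ => 1) f g = 0 :=
    fun f g hg => setIntegral_eq_zero_of_forall_eq_zero fun Z hZ => by rw [hg Z hZ]; ring
  rw [mass, e _ _ h₂, e _ _ h₃, add_zero]

/-- Mass is only semidefinite on `FormSpace`, whose elements are functions on all of `ℝ`; continuity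
turns vanishing almost everywhere on the half-line into vanishing at each of its points. -/
theorem FormSpace.eq_zero_of_mass_eq_zero {x : FormSpace} (h : (mass x x).re ≤ 0) {Z : ℝ}
    (hZ : Z ≤ 0) : U₂ x Z = 0 ∧ U₃ x Z = 0 := by
  have hcont : ContinuousOn (massDensity x) (Iic 0) :=
    ((isH1_fst x).continuousOn.norm.pow 2).add ((isH1_snd x).continuousOn.norm.pow 2)
  rw [mass_re] at h
  have h0 : massDensity x Z = 0 := by
    by_contra hne
    have hpos : 0 < massDensity x Z := lt_of_le_of_ne (massDensity_nonneg x Z) (Ne.symm hne)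
    have hev := (hcont Z hZ).eventually (lt_mem_nhds hpos)
    obtain ⟨c, hc, hcZ⟩ : ∃ c < Z, Ioc c Z ⊆ {y | 0 < massDensity x y} := by
      have h1 : 𝓝[≤] Z ≤ 𝓝[Iic 0] Z := nhdsWithin_mono Z (Iic_subset_Iic.2 hZ)
      exact (mem_nhdsLE_iff_exists_Ioc_subset' (show Z - 1 < Z by linarith)).1 (h1 hev)
    have h2 : 0 < ∫ y in Iic 0, massDensity x y := by
      rw [setIntegral_pos_iff_support_of_nonneg_ae
        (Eventually.of_forall (massDensity_nonneg x)) (integrable_massDensity x)]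
      refine lt_of_lt_of_le ?_ (measure_mono (s := Ioc c Z) fun y hy =>
        ⟨(hcZ hy).ne', hy.2.trans hZ⟩)
      simp [hc]
    linarith
  rw [massDensity] at h0
  have h1 : ‖U₂ x Z‖ ^ 2 = 0 := by nlinarith [sq_nonneg ‖U₂ x Z‖, sq_nonneg ‖U₃ x Z‖]
  have h2 : ‖U₃ x Z‖ ^ 2 = 0 := by nlinarith [sq_nonneg ‖U₂ x Z‖, sq_nonneg ‖U₃ x Z‖]
  exact ⟨by simpa using h1, by simpa using h2⟩

/-- In the span of two independent eigenfunctions there is a nonzero vector in every hyperplane. -/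
theorem HasTwoEigenvalues.exists_energy_le (p : Profile μ lam ZI) {h : ℝ} {P : ℝ → Prop}
    (hP : HasTwoEigenvalues μ lam h P) :
    ∃ r, P r ∧ ∀ ℓ : FormSpace →ₗ[ℂ] ℂ, ∃ y, ℓ y = 0 ∧ 0 < (mass y y).re ∧
      (energy μ lam h y y).re ≤ r * (mass y y).re := by
  obtain ⟨E₁, E₂, φ₁, φ₂, hE₁, hE₂, h₁, h₂, hind⟩ := hP
  refine ⟨max E₁ E₂, by rcases max_choice E₁ E₂ with h | h <;> rwa [h], fun ℓ => ?_⟩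
  refine (isHermForm_energy p.isWeight_mu p.isWeight_lam h).exists_le_of_two_eigenvectors
    isHermForm_mass (h₁.energy_eq p) (h₂.energy_eq p) mass_nonneg (le_max_left _ _)
    (le_max_right _ _) (fun c₁ c₂ hc => ?_) ℓ
  by_contra hcon
  have hz : ∀ Z ≤ 0, c₁ * φ₁.1 Z + c₂ * φ₂.1 Z = 0 ∧ c₁ * φ₁.2 Z + c₂ * φ₂.2 Z = 0 :=
    fun Z hZ => FormSpace.eq_zero_of_mass_eq_zero (not_lt.1 hcon) hZ
  rw [LinearIndependent.pair_iff] at hind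
  have := hind c₁ c₂ (by
    funext Z
    have := hz Z Z.2
    exact Prod.ext this.1 this.2)
  rcases hc with h | h
  · exact h this.1
  · exact h this.2

theorem IsSecondEigenvalue.unique {h E E' : ℝ} (hE : IsSecondEigenvalue μ lam h E)
    (hE' : IsSecondEigenvalue μ lam h E') : E = E' := by
  have key : ∀ {a b : ℝ}, IsSecondEigenvalue μ lam h a → IsSecondEigenvalue μ lam h b →
      ¬ a < b := by
    intro a b ha hb hab
    obtain ⟨E₁, E₂, φ₁, φ₂, h₁, h₂, h⟩ := ha.le
    exact hb.lt ⟨E₁, E₂, φ₁, φ₂, h₁.trans_lt hab, h₂.trans_lt hab, h⟩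
  exact le_antisymm (not_lt.1 (key hE' hE)) (not_lt.1 (key hE hE'))

/-- The second eigenvalue is at least `μ(0) - O(h)`. -/
theorem IsSecondEigenvalue.ge (p : Profile μ lam ZI) : ∃ C, 0 ≤ C ∧ ∀ h > 0, ∀ E,
    IsSecondEigenvalue μ lam h E → μ 0 - C * h ≤ E := by
  obtain ⟨C, hC0, hC⟩ := energy_ge_of_fst_eq_zero p
  refine ⟨C, hC0, fun h hh E hE => ?_⟩
  obtain ⟨r, hr, hℓ⟩ := hE.le.exists_energy_le p
  -- The hyperplane is `φ₂(0) = 0`, on which the energy is at least `μ(0) - O(h)` times the mass.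
  obtain ⟨y, hy, hym, hye⟩ := hℓ ((LinearMap.proj 0).comp U₂)
  exact (le_of_mul_le_mul_right ((hC h hh y hy).trans hye) hym).trans hr

/-- Existence of the second eigenvalue below the essential spectrum, with an upper bound. -/
theorem exists_isSecondEigenvalue_le (p : Profile μ lam ZI) {h r : ℝ} (hh : 0 < h)
    (hr : r < μ ZI)
    (htrial : ∀ ℓ : FormSpace →ₗ[ℂ] ℂ, ∃ x, ℓ x = 0 ∧ 0 < (mass x x).re ∧
      (energy μ lam h x x).re ≤ r * (mass x x).re) :
    ∃ E ≤ r, IsSecondEigenvalue μ lam h E := by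
  have hb := isHermForm_mass
  obtain ⟨e₁, e₂, x₁, x₂, h12, h2r, hx₁, hx₂, horth, heig₁, heig₂, hmin⟩ :=
    (isHermForm_energy p.isWeight_mu p.isWeight_lam h).exists_two_eigenvectors hb sobolev_nonneg
      mass_nonneg (fun e he => energy_garding p hh he) (energy_coercive p hh)
      (abs_energy_le p h) ⟨1, fun x => by rw [one_mul]; exact mass_le_sobolev x⟩
      exists_sobolev_limit hr htrial
  have f₁ := isEigenfunction_of_energy_eq p hh heig₁ hx₁
  have f₂ := isEigenfunction_of_energy_eq p hh heig₂ hx₂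
  refine ⟨e₂, h2r, ⟨_, f₂⟩, fun hlt => ?_, e₁, e₂, _, _, h12, le_rfl, f₁, f₂, ?_⟩
  -- Two eigenvalues below `e₂` would produce a vector orthogonal to `x₁` with quotient below `e₂`,
  -- the minimum over that complement.
  · obtain ⟨r', hr', hℓ⟩ := hlt.exists_energy_le p
    obtain ⟨y, hy, hym, hye⟩ := hℓ
      { toFun := mass x₁
        map_add' := hb.add_right x₁
        map_smul' := fun c y => hb.smul_right c x₁ y }
    have h1 := (hmin y hy).trans hye
    have h2 := le_of_mul_le_mul_right h1 hym
    linarith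
  · rw [LinearIndependent.pair_iff]
    intro c₁ c₂ hc
    have hz : ∀ Z ≤ 0, U₂ (c₁ • x₁ + c₂ • x₂) Z = 0 ∧ U₃ (c₁ • x₁ + c₂ • x₂) Z = 0 := by
      intro Z hZ
      have := congrFun hc ⟨Z, hZ⟩
      exact ⟨congrArg Prod.fst this, congrArg Prod.snd this⟩
    have m : ∀ y, mass y (c₁ • x₁ + c₂ • x₂) = 0 := fun y =>
      FormSpace.mass_eq_zero_of_eqOn (fun Z hZ => (hz Z hZ).1) fun Z hZ => (hz Z hZ).2
    have m₁ := m x₁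
    have m₂ := m x₂
    have horth' : mass x₂ x₁ = 0 := by rw [← hb.conj_symm, horth, map_zero]
    rw [hb.add_right, hb.smul_right, hb.smul_right, horth, mul_zero, add_zero] at m₁
    rw [hb.add_right, hb.smul_right, hb.smul_right, horth', mul_zero, zero_add] at m₂
    have n₁ : mass x₁ x₁ ≠ 0 := fun h => by simp [h] at hx₁
    have n₂ : mass x₂ x₂ ≠ 0 := fun h => by simp [h] at hx₂
    exact ⟨(mul_eq_zero.1 m₁).resolve_right n₁, (mul_eq_zero.1 m₂).resolve_right n₂⟩

/-- Upper bound for the second eigenvalue by means of trial functions at scale `s`. -/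
theorem exists_isSecondEigenvalue_le_of_mu_le (p : Profile μ lam ZI) {B : ℝ} {q : ℕ} (hq : q ≤ 2)
    (hB0 : 0 ≤ B) (hB : ∀ Z ≤ 0, μ Z ≤ μ 0 + B * (-Z) ^ q) :
    ∃ K, 0 ≤ K ∧ ∀ h > 0, ∀ s > 0, K * (s ^ q + h ^ 2 / s ^ 2) < μ ZI - μ 0 →
      ∃ E ≤ μ 0 + K * (s ^ q + h ^ 2 / s ^ 2), IsSecondEigenvalue μ lam h E := by
  obtain ⟨M, hM⟩ := (p.isCoeff_lam.add_two_mul p.isCoeff_mu).isWeight.bound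
  have hM0 : 0 ≤ M := (abs_nonneg _).trans (hM 0 le_rfl)
  refine ⟨576 * (B + M), by positivity, fun h hh s hs hlt => ?_⟩
  refine exists_isSecondEigenvalue_le p hh (by linarith) fun ℓ => ?_
  have hle := fun a b => trial_energy_le hs a b p hq hB0 hB hM0
    (fun Z hZ => (le_abs_self _).trans (hM Z hZ)) h
  have hpos : ∀ a b : ℂ, (a ≠ 0 ∨ b ≠ 0) → 0 < (mass (trial hs a b) (trial hs a b)).re := by
    intro a b hab
    have h1 := trial_mass_ge hs a b
    have h2 : 0 < ‖a‖ ^ 2 + ‖b‖ ^ 2 := by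
      rcases hab with h | h
      · have := norm_pos_iff.2 h; positivity
      · have := norm_pos_iff.2 h; positivity
    have h3 := mul_pos hs h2
    linarith
  have hℓ : ∀ a b : ℂ, ℓ (trial hs a b) = a * ℓ (expTrial (inv_pos.2 hs))
      + b * ℓ (expTrial (mul_pos two_pos (inv_pos.2 hs))) := by
    intro a b
    rw [trial, map_add, map_smul, map_smul, smul_eq_mul, smul_eq_mul]
  by_cases h0 : ℓ (expTrial (inv_pos.2 hs)) = 0
  · exact ⟨trial hs 1 0, by rw [hℓ, h0]; ring, hpos _ _ (by simp), hle _ _⟩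
  · exact ⟨trial hs (-ℓ (expTrial (mul_pos two_pos (inv_pos.2 hs))))
      (ℓ (expTrial (inv_pos.2 hs))), by rw [hℓ]; ring, hpos _ _ (Or.inr h0), hle _ _⟩

/-! ### Taylor bounds for `μ` and the choice of scale -/

theorem abs_sub_le_of_derivWithin_le {f : ℝ → ℝ} (hf : ContDiffOn ℝ ∞ f (Iic 0)) {C Z : ℝ}
    (hZ : Z ≤ 0) (hC : ∀ Y ∈ Icc Z 0, |derivWithin f (Iic 0) Y| ≤ C) :
    |f Z - f 0| ≤ C * (-Z) := by
  have := (convex_Icc Z 0).norm_image_sub_le_of_norm_hasDerivWithin_le (f := f)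
    (f' := derivWithin f (Iic 0)) (C := C)
    (fun Y hY => (hasDerivWithinAt_of_contDiffOn hf hY.2).mono fun y hy => hy.2)
    (fun Y hY => hC Y hY) (right_mem_Icc.2 hZ) (left_mem_Icc.2 hZ)
  rwa [Real.norm_eq_abs, Real.norm_eq_abs, sub_zero, abs_of_nonpos hZ] at this

theorem Profile.mu_le_linear (p : Profile μ lam ZI) :
    ∃ B, 0 ≤ B ∧ ∀ Z ≤ 0, μ Z ≤ μ 0 + B * (-Z) ^ 1 := by
  obtain ⟨B, hB⟩ := p.isWeight_deriv_mu.bound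
  refine ⟨B, (abs_nonneg _).trans (hB 0 le_rfl), fun Z hZ => ?_⟩
  have := (le_abs_self _).trans
    (abs_sub_le_of_derivWithin_le p.smooth_mu hZ fun Y hY => hB Y hY.2)
  rw [pow_one]; linarith

theorem Profile.mu_le_quadratic (p : Profile μ lam ZI) (h0 : derivWithin μ (Iic 0) 0 = 0) :
    ∃ B, 0 ≤ B ∧ ∀ Z ≤ 0, μ Z ≤ μ 0 + B * (-Z) ^ 2 := by
  have hs : ContDiffOn ℝ ∞ (derivWithin μ (Iic 0)) (Iic 0) :=
    ((contDiffOn_infty_iff_derivWithin (uniqueDiffOn_Iic 0)).1 p.smooth_mu).2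
  have hzero : ∀ Z < ZI, derivWithin μ (Iic 0) Z = 0 := by
    intro Z hZ
    rw [derivWithin_of_mem_nhds (Iic_mem_nhds (hZ.trans p.ZI_neg))]
    have : μ =ᶠ[𝓝 Z] fun _ => μ ZI := by
      filter_upwards [Iio_mem_nhds hZ] with x hx using p.mu_const x (le_of_lt hx)
    rw [this.deriv_eq, deriv_const]
  -- `hzero` is strict at `ZI`, so `μ'` is treated as constant below `ZI - 1`; this makes `μ''`
  -- bounded.
  obtain ⟨B, hB⟩ := (isWeight_derivWithin (a := ZI - 1) (by linarith [p.ZI_neg]) hs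
    fun Z hZ => by rw [hzero Z (by linarith), hzero (ZI - 1) (by linarith)]).bound
  have hB0 : 0 ≤ B := (abs_nonneg _).trans (hB 0 le_rfl)
  refine ⟨B, hB0, fun Z hZ => ?_⟩
  have h1 := (le_abs_self _).trans
    (abs_sub_le_of_derivWithin_le p.smooth_mu hZ (C := B * (-Z)) fun Y hY => by
      have := abs_sub_le_of_derivWithin_le hs hY.2 fun X hX => hB X hX.2
      rw [h0, sub_zero] at this
      exact this.trans (mul_le_mul_of_nonneg_left (by linarith [hY.1]) hB0))
  linarith

theorem exists_bound_two_thirds (p : Profile μ lam ZI) : ∃ K, 0 ≤ K ∧ ∃ h₀ > (0 : ℝ),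
    ∀ h ∈ Ioo 0 h₀, ∃ E ≤ μ 0 + K * h ^ (2 / 3 : ℝ), IsSecondEigenvalue μ lam h E := by
  obtain ⟨B, hB0, hB⟩ := p.mu_le_linear
  obtain ⟨K, hK0, hK⟩ := exists_isSecondEigenvalue_le_of_mu_le p one_le_two hB0 hB
  have ht : Tendsto (fun h : ℝ => 2 * K * h ^ (2 / 3 : ℝ)) (𝓝[>] 0) (𝓝 0) := by
    have h1 : ContinuousAt (fun h : ℝ => h ^ (2 / 3 : ℝ)) 0 :=
      Real.continuousAt_rpow_const 0 _ (Or.inr (by norm_num))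
    have h2 := (h1.tendsto.mono_left (nhdsWithin_le_nhds (s := Ioi 0))).const_mul (2 * K)
    rwa [Real.zero_rpow (by norm_num), mul_zero] at h2
  obtain ⟨h₀, hh₀, hsub⟩ := mem_nhdsGT_iff_exists_Ioo_subset.1
    (ht.eventually (gt_mem_nhds (sub_pos.2 p.mu_lt)))
  refine ⟨2 * K, by positivity, h₀, hh₀, fun h hh => ?_⟩
  have hpos : 0 < h := hh.1
  -- The scale `s = h^{2/3}` balances `s` against `h² / s²`.
  have e : (h ^ (2 / 3 : ℝ)) ^ 1 + h ^ 2 / (h ^ (2 / 3 : ℝ)) ^ 2 = 2 * h ^ (2 / 3 : ℝ) := by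
    rw [← Real.rpow_natCast (h ^ (2 / 3 : ℝ)) 2, ← Real.rpow_mul hpos.le, ← Real.rpow_natCast h 2,
      ← Real.rpow_sub hpos]
    norm_num
    ring
  have h1 := hK h hpos (h ^ (2 / 3 : ℝ)) (by positivity)
  rw [e, ← mul_assoc, mul_comm K 2] at h1
  exact h1 (hsub hh)

theorem exists_bound_linear (p : Profile μ lam ZI) (h0 : derivWithin μ (Iic 0) 0 = 0) :
    ∃ K, 0 ≤ K ∧ ∃ h₀ > (0 : ℝ),
      ∀ h ∈ Ioo 0 h₀, ∃ E ≤ μ 0 + K * h, IsSecondEigenvalue μ lam h E := by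
  obtain ⟨B, hB0, hB⟩ := p.mu_le_quadratic h0
  obtain ⟨K, hK0, hK⟩ := exists_isSecondEigenvalue_le_of_mu_le p le_rfl hB0 hB
  have ht : Tendsto (fun h : ℝ => 2 * K * h) (𝓝[>] 0) (𝓝 0) := by
    have h2 := (tendsto_id.mono_left (nhdsWithin_le_nhds (a := (0 : ℝ)) (s := Ioi 0))).const_mul
      (2 * K)
    rwa [mul_zero] at h2
  obtain ⟨h₀, hh₀, hsub⟩ := mem_nhdsGT_iff_exists_Ioo_subset.1
    (ht.eventually (gt_mem_nhds (sub_pos.2 p.mu_lt)))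
  refine ⟨2 * K, by positivity, h₀, hh₀, fun h hh => ?_⟩
  have hpos : 0 < h := hh.1
  -- The scale `s = √h` balances `s²` against `h² / s²`.
  have e : Real.sqrt h ^ 2 + h ^ 2 / Real.sqrt h ^ 2 = 2 * h := by
    rw [Real.sq_sqrt hpos.le]; field_simp; ring
  have h1 := hK h hpos (Real.sqrt h) (Real.sqrt_pos.2 hpos)
  rw [e, ← mul_assoc, mul_comm K 2] at h1
  exact h1 (hsub hh)

end Rayleigh

end

theorem lemma2p1 (μ lam : ℝ → ℝ) (ZI : ℝ) (hprofile : Rayleigh.Profile μ lam ZI) :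
    ∃ lam₁ : ℝ → ℝ,
      (∃ h₀ > (0 : ℝ), ∀ h ∈ Ioo 0 h₀, ∀ E : ℝ,
        Rayleigh.IsSecondEigenvalue μ lam h E ↔ E = lam₁ h) ∧
      Tendsto lam₁ (𝓝[>] 0) (𝓝 (μ 0)) ∧
      (fun h => lam₁ h - μ 0) =O[𝓝[>] 0] (fun h : ℝ => h ^ (2 / 3 : ℝ)) ∧
      (derivWithin μ (Iic 0) 0 = 0 →
        (fun h => lam₁ h - μ 0) =O[𝓝[>] 0] (fun h : ℝ => h)) := by
  classical
  obtain ⟨K, hK0, h₀, hh₀, hK⟩ := Rayleigh.exists_bound_two_thirds hprofile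
  obtain ⟨C, hC0, hC⟩ := Rayleigh.IsSecondEigenvalue.ge hprofile
  have hex : ∀ h ∈ Ioo 0 h₀, ∃ E, Rayleigh.IsSecondEigenvalue μ lam h E := fun h hh =>
    let ⟨E, _, hE⟩ := hK h hh
    ⟨E, hE⟩
  -- The default value `0` is irrelevant: a second eigenvalue exists for every `h` in `Ioo 0 h₀`.
  let lam₁ : ℝ → ℝ := fun h =>
    if H : ∃ E, Rayleigh.IsSecondEigenvalue μ lam h E then H.choose else 0
  have hspec : ∀ h ∈ Ioo 0 h₀, Rayleigh.IsSecondEigenvalue μ lam h (lam₁ h) := by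
    intro h hh
    have H := hex h hh
    simp only [lam₁, dif_pos H]
    exact H.choose_spec
  have hO : (fun h => lam₁ h - μ 0) =O[𝓝[>] 0] (fun h : ℝ => h ^ (2 / 3 : ℝ)) := by
    refine IsBigO.of_bound (K + C) ?_
    filter_upwards [Ioo_mem_nhdsGT hh₀, Ioo_mem_nhdsGT (zero_lt_one (α := ℝ))] with h hh hh1
    obtain ⟨E, hE, hE2⟩ := hK h hh
    rw [hE2.unique (hspec h hh)] at hE
    have h1 := hC h hh.1 _ (hspec h hh)
    -- For `h < 1` the `O(h)` loss of the lower bound is absorbed in `h^{2/3}`.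
    have h2 : h ≤ h ^ (2 / 3 : ℝ) := by
      have := Real.rpow_le_rpow_of_exponent_ge hh1.1 hh1.2.le (show (2 / 3 : ℝ) ≤ 1 by norm_num)
      rwa [Real.rpow_one] at this
    have h3 : 0 ≤ h ^ (2 / 3 : ℝ) := hh.1.le.trans h2
    rw [Real.norm_eq_abs, Real.norm_of_nonneg h3, abs_le]
    have h4 := mul_le_mul_of_nonneg_left h2 hC0
    have h5 := mul_nonneg hK0 h3
    have h6 := mul_nonneg hC0 h3
    constructor <;> linarith
  refine ⟨lam₁, ⟨h₀, hh₀, fun h hh E => ⟨fun hE => hE.unique (hspec h hh), fun hE => ?_⟩⟩,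
    ?_, hO, fun h0 => ?_⟩
  · rw [hE]; exact hspec h hh
  · have ht : Tendsto (fun h : ℝ => h ^ (2 / 3 : ℝ)) (𝓝[>] 0) (𝓝 0) := by
      have h1 : ContinuousAt (fun h : ℝ => h ^ (2 / 3 : ℝ)) 0 :=
        Real.continuousAt_rpow_const 0 _ (Or.inr (by norm_num))
      have h2 := h1.tendsto.mono_left (nhdsWithin_le_nhds (s := Ioi 0))
      rwa [Real.zero_rpow (by norm_num)] at h2
    have h1 := (hO.trans_tendsto ht).add_const (μ 0)
    simpa using h1
  · obtain ⟨K', hK'0, h₁, hh₁, hK'⟩ := Rayleigh.exists_bound_linear hprofile h0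
    refine IsBigO.of_bound (K' + C) ?_
    filter_upwards [Ioo_mem_nhdsGT hh₀, Ioo_mem_nhdsGT hh₁] with h hh hh1
    obtain ⟨E, hE, hE2⟩ := hK' h hh1
    rw [hE2.unique (hspec h hh)] at hE
    have h1 := hC h hh.1 _ (hspec h hh)
    rw [Real.norm_eq_abs, Real.norm_of_nonneg hh.1.le, abs_le]
    have h5 := mul_nonneg hK'0 hh.1.le
    have h6 := mul_nonneg hC0 hh.1.le
    constructor <;> linarith
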